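/- Let $\Omega\subset\mathbb{R}^N$ be a non-empty bounded open set. Let $X_j=(\alpha_{j1},\dots,\alpha_{jN})$, $j=1,\dots,m$, be locally Lipschitz vector fields on $\mathbb{R}^N$, write $X_ju=\sum_k\alpha_{jk}\partial_{x_k}u$ and $Xu=(X_1u,\dots,X_mu)$, and let $\mathcal{L}u=\sum_{i,j=1}^N\partial_{x_i}(a_{ij}\partial_{x_j}u)$ with measurable $a_{ij}=a_{ji}$ be uniformly $X$-elliptic: for some $C>0$, $$\frac1C\sum_{j=1}^m\langle X_j(x),\xi\rangle^2\le\sum_{i,j=1}^Na_{ij}(x)\xi_i\xi_j\le C\sum_{j=1}^m\langle X_j(x),\xi\rangle^2\qquad\text{for all }x,\xi\in\mathbb{R}^N .$$ Let $H$ be the closure of $C_0^1(\Omega)$ with respect to $\|u\|_H=\|Xu\|_{L^2(\Omega)}$, and assume that for some $Q>2$ the embedding $H\hookrightarrow L^p(\Omega)$ is continuous for all $p\in[1,q]$, $q=\frac{2Q}{Q-2}$, and compact for all $p\in[1,q)$. Let $a(u,v)=(-\mathcal{L}u,v)$ be the bilinear form on $H$ that extends $\int_\Omega\sum_{i,j}a_{ij}\,\partial_{x_j}\varphi\,\partial_{x_i}\psi\,dx$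 ($\varphi,\psi\in C_0^1(\Omega)$) by continuity, let $\mu_1>0$ be the first eigenvalue of $-\mathcal{L}$ on $\Omega$ with homogeneous Dirichlet boundary conditions, and let $V=H\times L^2(\Omega)$ with $\|(u,v)\|_V=(a(u,u)+\|v\|_{L^2(\Omega)}^2)^{1/2}$. Assume that * $\beta:\mathbb{R}\to\mathbb{R}$ is continuous, $1\le\int_t^{t+1}\beta(\tau)\,d\tau\le C_\beta$ for all $t\in\mathbb{R}$ and some constant $C_\beta\ge1$, and $\int_{-\infty}^{\infty}\max\{-\beta(\tau),0\}\,d\tau<\infty$; * $f:\mathbb{R}\to\mathbb{R}$ satisfies $|f(u)-f(v)|\le c|u-v|(1+|u|^{\rho}+|v|^{\rho})$ for all $u,v\in\mathbb{R}$, with constants $c\ge0$ and $0<\rho\le\frac{q-2}{2}$; * $\limsup_{|u|\to\infty}\frac{f(u)}{u}<\mu_1$. For $s\in\mathbb{R}$, $s<T\le\infty$ and $w_0=(u_0,u_1)\in V$, a weak solution on $[s,T)$ of $$\partial_{tt}u+\beta(t)\partial_tu=\mathcal{L}u+f(u)\ \text{ in }\Omega,\qquad u=0\ \text{ on }\partial\Omega,\qquad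 u(s)=u_0,\ \partial_tu(s)=u_1$$ is $w=(u,\partial_tu)\in C([s,T);V)$ with $w(s)=w_0$, where $\partial_tu$ is the derivative of $u$ in $L^2(\Omega)$ on $(s,T)$, such that for all $v\in H$ and $t\in(s,T)$ $$\frac{d^2}{dt^2}\langle u(t),v\rangle_{L^2(\Omega)}+\beta(t)\frac{d}{dt}\langle u(t),v\rangle_{L^2(\Omega)}=-a(u(t),v)+\int_\Omega f(u(t))\,v\,dx .$$ Then: 1. Weak solutions are uniformly bounded in $V$: for every $R$ there is $M$ such that, for all $s$, all $T\in(s,\infty]$ and all $w_0$ with $\|w_0\|_V\le R$, every weak solution $w$ on $[s,T)$ with $w(s)=w_0$ satisfies $\|w(t)\|_V\le M$ for all $t\in[s,T)$. 2. Every weak solution on a maximal interval of existence $[s,T)$ is global, i.e. $T=\infty$. 3. The problem generates a process on $V$: there are maps $S(t,s):V\to V$, $t\ge s$, with $S(t,t)=I$, $S(t,s)=S(t,\tau)S(\tau,s)$ for $t\ge\tau\ge s$, and $(t,s,x)\mapsto S(t,s)x$ continuous on $\{t\ge s\}\times V$, such that for all $s\in\mathbb{R}$ and $w_0\in V$ the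 function $t\mapsto S(t,s)w_0$ is a weak solution on $[s,\infty)$ with value $w_0$ at $s$, and every weak solution on an interval $[s,T)$ with value $w_0$ at $s$ coincides with it on $[s,T)$. -/

import Mathlib

open MeasureTheory Filter Topology Set
open scoped ENNReal NNReal

noncomputable section

/-- The Euclidean space `ℝ^N`. -/
abbrev Eucl (N : ℕ) : Type := EuclideanSpace ℝ (Fin N)

/-- A uniformly `X`-elliptic operator `ℒ u = ∑ i j, ∂_i (a_ij ∂_j u)` on `ℝ^N`, together with the
locally Lipschitz vector fields `X = (X_1, …, X_m)` with respect to which it is `X`-elliptic. -/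
structure XEllipticOperator (N m : ℕ) where
  /-- the vector fields `X_1, …, X_m` -/
  X : Fin m → Eucl N → Eucl N
  /-- the coefficient matrix `(a_ij)` -/
  a : Eucl N → Matrix (Fin N) (Fin N) ℝ
  locallyLipschitz_X : ∀ j, LocallyLipschitz (X j)
  aemeasurable_a : ∀ i j, AEMeasurable (fun x => a x i j) volume
  symm_a : ∀ x i j, a x i j = a x j i
  elliptic : ∃ C : ℝ, 0 < C ∧ ∀ x ξ : Eucl N,
    1 / C * ∑ j, (inner ℝ (X j x) ξ) ^ 2 ≤ ∑ i, ∑ j, a x i j * ξ i * ξ j ∧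
    ∑ i, ∑ j, a x i j * ξ i * ξ j ≤ C * ∑ j, (inner ℝ (X j x) ξ) ^ 2

/-- `C_0^1(Ω)`: the `C^1` functions with compact support contained in `Ω`. -/
def testFunctions {N : ℕ} (Ω : Set (Eucl N)) : Submodule ℝ (Eucl N → ℝ) where
  carrier := {φ | ContDiff ℝ 1 φ ∧ HasCompactSupport φ ∧ tsupport φ ⊆ Ω}
  add_mem' := by
    rintro φ ψ ⟨h1, h2, h3⟩ ⟨k1, k2, k3⟩
    exact ⟨h1.add k1, h2.add k2, (tsupport_add φ ψ).trans (union_subset h3 k3)⟩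
  zero_mem' := by
    refine ⟨contDiff_const, HasCompactSupport.zero, ?_⟩
    simp [tsupport]
  smul_mem' := by
    rintro c φ ⟨h1, h2, h3⟩
    refine ⟨h1.const_smul c, h2.smul_left (f := fun _ => c), ?_⟩
    exact (closure_mono (Function.support_const_smul_subset c φ)).trans h3

/-- The real space `L²(Ω)`. -/
abbrev L2 {N : ℕ} (Ω : Set (Eucl N)) : Type := Lp ℝ 2 (volume.restrict Ω)

/-- The space `L²(Ω; ℝ^m)`. -/
abbrev L2Vec {N : ℕ} (Ω : Set (Eucl N)) (m : ℕ) : Type := Lp (Eucl m) 2 (volume.restrict Ω)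

namespace XEllipticOperator

variable {N m : ℕ} (L : XEllipticOperator N m) (Ω : Set (Eucl N))

/-- The `X`-gradient `Xφ = (X_1 φ, …, X_m φ)` of a function, `X_j φ = ∑ k, α_jk ∂_k φ`. -/
def Xgrad (φ : Eucl N → ℝ) (x : Eucl N) : Eucl m :=
  WithLp.toLp 2 fun j => fderiv ℝ φ x (L.X j x)

theorem memLp_testFunction {Ω : Set (Eucl N)} (φ : testFunctions Ω) :
    MemLp (φ : Eucl N → ℝ) 2 (volume.restrict Ω) :=
  (φ.2.1.continuous.memLp_of_hasCompactSupport φ.2.2.1).restrict Ω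

theorem memLp_Xgrad {Ω : Set (Eucl N)} (φ : testFunctions Ω) :
    MemLp (L.Xgrad (φ : Eucl N → ℝ)) 2 (volume.restrict Ω) := by
  have hc : Continuous (L.Xgrad (φ : Eucl N → ℝ)) := by
    refine (PiLp.continuous_toLp 2 _).comp (continuous_pi fun j => ?_)
    exact (φ.2.1.continuous_fderiv one_ne_zero).clm_apply (L.locallyLipschitz_X j).continuous
  have hs : HasCompactSupport (L.Xgrad (φ : Eucl N → ℝ)) := by
    refine (φ.2.2.1.fderiv (𝕜 := ℝ)).mono fun x hx => ?_
    rw [Function.mem_support] at hx ⊢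
    intro h0
    apply hx
    ext j
    simp [Xgrad, h0]
  exact (hc.memLp_of_hasCompactSupport hs).restrict Ω

/-- The map `φ ↦ (φ, Xφ)` from `C_0^1(Ω)` to `L²(Ω) × L²(Ω; ℝ^m)`. -/
def graphMap : testFunctions Ω →ₗ[ℝ] WithLp 2 (L2 Ω × L2Vec Ω m) where
  toFun φ := WithLp.toLp 2 ((memLp_testFunction φ).toLp _, (L.memLp_Xgrad φ).toLp _)
  map_add' φ ψ := by
    have h : L.Xgrad ((φ + ψ : testFunctions Ω) : Eucl N → ℝ)
        = L.Xgrad (φ : Eucl N → ℝ) + L.Xgrad (ψ : Eucl N → ℝ) := by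
      funext x
      ext j
      have h1 := (φ.2.1.differentiable one_ne_zero) x
      have h2 := (ψ.2.1.differentiable one_ne_zero) x
      simp [Xgrad, fderiv_add h1 h2]
    rw [← WithLp.toLp_add, Prod.mk_add_mk, ← MemLp.toLp_add, ← MemLp.toLp_add]
    congr 2
    exact MemLp.toLp_congr _ _ (by rw [h])
  map_smul' c φ := by
    have h : L.Xgrad ((c • φ : testFunctions Ω) : Eucl N → ℝ)
        = c • L.Xgrad (φ : Eucl N → ℝ) := by
      funext x
      ext j
      have h1 := (φ.2.1.differentiable one_ne_zero) x
      simp [Xgrad, fderiv_const_smul h1 c]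
    rw [RingHom.id_apply, ← WithLp.toLp_smul, Prod.smul_mk, ← MemLp.toLp_const_smul,
      ← MemLp.toLp_const_smul]
    congr 2
    exact MemLp.toLp_congr _ _ (by rw [h])

/-- The Hilbert space `H`: the closure of `C_0^1(Ω)`, each function `φ` being recorded together
with its `X`-gradient as the pair `(φ, Xφ)`. An element is a pair `(u, Xu)`. The topology is the one
of the graph norm `(‖u‖² + ‖Xu‖²)^{1/2}`; as soon as `‖u‖_{L²} ≤ C ‖Xu‖_{L²}` holds (which is part of
the Sobolev embedding below), this norm is equivalent to `‖Xu‖_{L²}`, so that this is the closure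
of `C_0^1(Ω)` with respect to `‖Xu‖_{L²}`. -/
def H : Submodule ℝ (WithLp 2 (L2 Ω × L2Vec Ω m)) :=
  (LinearMap.range (L.graphMap Ω)).topologicalClosure

variable {Ω}

/-- The inclusion `H → L²(Ω)`. -/
def toL2 (u : L.H Ω) : L2 Ω := (u : WithLp 2 (L2 Ω × L2Vec Ω m)).fst

/-- The `X`-gradient `Xu ∈ L²(Ω; ℝ^m)` of `u ∈ H`; one has `‖u‖_H = ‖Xu‖_{L²}`. -/
def grad (u : L.H Ω) : L2Vec Ω m := (u : WithLp 2 (L2 Ω × L2Vec Ω m)).snd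

variable (Ω)

/-- The form `a(φ, ψ) = (-ℒ φ, ψ)_{L²(Ω)} = ∫_Ω ∑ i j, a_ij ∂_j φ ∂_i ψ` on `C_0^1(Ω)`. -/
def testForm (φ ψ : Eucl N → ℝ) : ℝ :=
  ∫ x in Ω, ∑ i, ∑ j, L.a x i j * fderiv ℝ φ x (EuclideanSpace.single j 1) *
    fderiv ℝ ψ x (EuclideanSpace.single i 1)

variable {Ω}

/-- The form `a(u, v) = (-ℒ u, v)` on `H`: the extension by continuity of `testForm`, i.e. the limit
of `a(φ, ψ)` as the test functions `φ`, `ψ` tend to `u`, `v` in `H`. (The limit exists by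
`X`-ellipticity, which gives `|a(φ, ψ)| ≤ C ‖Xφ‖ ‖Xψ‖`.) -/
def form (u v : L.H Ω) : ℝ :=
  limUnder
    (comap (fun p : testFunctions Ω × testFunctions Ω => (L.graphMap Ω p.1, L.graphMap Ω p.2))
      (𝓝 ((u : WithLp 2 (L2 Ω × L2Vec Ω m)), (v : WithLp 2 (L2 Ω × L2Vec Ω m)))))
    (fun p => L.testForm Ω (p.1 : Eucl N → ℝ) (p.2 : Eucl N → ℝ))

variable (Ω)

/-- The Sobolev-type embedding with (homogeneous) dimension `Q`: `H ↪ L^p(Ω)` continuously for every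
`p ∈ [1, 2Q/(Q-2)]`, and compactly for every `p ∈ [1, 2Q/(Q-2))`. -/
def SobolevEmbedding (Q : ℝ) : Prop :=
  (∀ p : ℝ, 1 ≤ p → p ≤ 2 * Q / (Q - 2) → ∃ C : ℝ≥0, ∀ u : L.H Ω,
    eLpNorm (L.toL2 u) (ENNReal.ofReal p) (volume.restrict Ω) ≤ C * ‖L.grad u‖ₑ) ∧
  (∀ p : ℝ, 1 ≤ p → p < 2 * Q / (Q - 2) → ∀ u : ℕ → L.H Ω, (∃ M : ℝ, ∀ n, ‖L.grad (u n)‖ ≤ M) →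
    ∃ (k : ℕ → ℕ) (g : Eucl N → ℝ), StrictMono k ∧
      MemLp g (ENNReal.ofReal p) (volume.restrict Ω) ∧
      Tendsto (fun n => eLpNorm (fun x => L.toL2 (u (k n)) x - g x) (ENNReal.ofReal p)
        (volume.restrict Ω)) atTop (𝓝 0))

/-- `μ` is an eigenvalue of `-ℒ` on `Ω` with homogeneous Dirichlet boundary conditions. -/
def IsEigenvalue (μ : ℝ) : Prop :=
  ∃ u : L.H Ω, u ≠ 0 ∧ ∀ v : L.H Ω, L.form u v = μ * inner ℝ (L.toL2 u) (L.toL2 v)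

/-- The first eigenvalue `μ₁` of `-ℒ` on `Ω` with homogeneous Dirichlet boundary conditions. -/
def firstEigenvalue : ℝ := sInf {μ : ℝ | L.IsEigenvalue Ω μ}

/-- The phase space `V = H × L²(Ω)`. -/
abbrev V : Type := L.H Ω × L2 Ω

variable {Ω}

/-- `‖(u, v)‖_V = (a(u, u) + ‖v‖²_{L²(Ω)})^{1/2}`. -/
def normV (w : L.V Ω) : ℝ := Real.sqrt (L.form w.1 w.1 + ‖w.2‖ ^ 2)

end XEllipticOperator

/-- The time interval `[s, T)` with `T ≤ ∞`. -/
def timeInterval (s : ℝ) (T : EReal) : Set ℝ := {t : ℝ | s ≤ t ∧ (t : EReal) < T}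

/-- `w = (u, ∂_t u)` is a weak solution on `[s, T)` of `∂_tt u + β(t) ∂_t u = ℒ u + f(u)` in `Ω`,
`u = 0` on `∂Ω`, `(u(s), ∂_t u(s)) = w₀`: one has `u ∈ C([s, T); H)`, `∂_t u ∈ C([s, T); L²(Ω))`,
where `∂_t u` is the derivative of `u` in `L²(Ω)`, and
`d²/dt² ⟨u, v⟩ + β(t) d/dt ⟨u, v⟩ = - a(u, v) + ⟨f(u), v⟩` for all `v ∈ H` and `t ∈ (s, T)`. -/
structure IsWeakSolution {N m : ℕ} (L : XEllipticOperator N m) (Ω : Set (Eucl N)) (β f : ℝ → ℝ)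
    (s : ℝ) (T : EReal) (w₀ : L.V Ω) (w : ℝ → L.V Ω) : Prop where
  continuousOn : ContinuousOn w (timeInterval s T)
  initial : w s = w₀
  hasDerivAt : ∀ t ∈ timeInterval s T, s < t →
    HasDerivAt (fun τ => L.toL2 (w τ).1) (w t).2 t
  equation : ∀ t ∈ timeInterval s T, s < t → ∀ v : L.H Ω,
    HasDerivAt (fun τ => (inner ℝ (w τ).2 (L.toL2 v) : ℝ))
      (-β t * inner ℝ (w t).2 (L.toL2 v) - L.form (w t).1 v
        + ∫ x in Ω, f (L.toL2 (w t).1 x) * L.toL2 v x) t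

/-- A weak solution on `[s, T)` for which `[s, T)` is the maximal interval of existence: it has no
extension to a weak solution on a longer interval. -/
def IsMaximalWeakSolution {N m : ℕ} (L : XEllipticOperator N m) (Ω : Set (Eucl N)) (β f : ℝ → ℝ)
    (s : ℝ) (T : EReal) (w₀ : L.V Ω) (w : ℝ → L.V Ω) : Prop :=
  IsWeakSolution L Ω β f s T w₀ w ∧
    ∀ (T' : EReal) (w' : ℝ → L.V Ω), IsWeakSolution L Ω β f s T' w₀ w' →
      EqOn w w' (timeInterval s T) → T' ≤ T

/-- A process `{S(t, s) : t ≥ s}` on a topological space; the values `S t s` with `t < s` are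
irrelevant. -/
structure IsProcess {Y : Type*} [TopologicalSpace Y] (S : ℝ → ℝ → Y → Y) : Prop where
  self : ∀ t x, S t t x = x
  comp : ∀ t τ s, s ≤ τ → τ ≤ t → ∀ x, S t s x = S t τ (S τ s x)
  continuousOn : ContinuousOn (fun p : ℝ × ℝ × Y => S p.1 p.2.1 p.2.2) {p | p.2.1 ≤ p.1}

end

/-! The wave equation becomes an ordinary differential equation with a locally Lipschitz right-hand
side, and an energy estimate bounds its trajectories.

By ellipticity and the Sobolev embedding, the form `a` is an inner product on `H` equivalent to the
given one; call the renormed space `E` (`SobolevEmbedding.exists_energy_space`). The inclusion `J :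
E → L²(Ω)` is compact with dense range, and it is injective because the `X`-gradient is closable
(`injective_toL2L`). Its singular value decomposition gives orthonormal bases `b k` of `E` and `e k`
of `L²` with `J (b k) = (ω k)⁻¹ • e k`, each `ω k ^ 2` being an eigenvalue of `-ℒ`. In the complex
modes `z k = ⟨b k, u⟩ + i ⟨e k, ∂_t u⟩` the free equation `∂_tt u = ℒ u` reads `z k' = -i ω k z k`:
phase space is isometric to a complex `ℓ²`, and the free evolution is a group of rotations. Undoing
the rotation (the interaction picture) removes the unbounded operator. Weak solutions then
correspond to trajectories driven only by the rotated term `-β ∂_t u + f(u)`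
(`IsWaveSolution.isTrajectory`, `IsTrajectory.isWaveSolution`).

The growth restriction and Hölder's inequality make `u ↦ f(u)` Lipschitz from bounded sets of `E` to
`L²` (`exists_lipschitzOnWith_nemytskii`). Picard–Lindelöf and Grönwall then give a continuous flow,
provided that trajectories stay bounded (`exists_flow`).

For the bound (`hasBoundedTrajectories_waveField`), let `Φ(u) = ∫ F(u)`, with `F` the primitive of
`f`. The quantity `‖u‖_E² + ‖∂_t u‖² - 2 Φ(u)` has derivative `-2 β ‖∂_t u‖²`. The limsup condition
gives `2 F(a) ≤ ν a² + C` with `ν < μ₁`, and Parseval gives `μ₁ ‖u‖_{L²}² ≤ a(u, u)`; so, up to a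
constant, this quantity dominates a positive multiple of the squared norm. It therefore grows at
most by a factor determined by the integral of the negative part of `β` over the whole line,
uniformly in the initial time. Every weak solution is a restriction of the global one, so a maximal
interval must be unbounded. -/

noncomputable section

set_option linter.unusedSectionVars false

/-! ### Spectral theory: singular values of a compact embedding, renorming by a form. -/

section Spectral

universe u v

variable {E : Type u} {F : Type v} [NormedAddCommGroup E] [InnerProductSpace ℝ E] [CompleteSpace E]
  [NormedAddCommGroup F] [InnerProductSpace ℝ F] [CompleteSpace F]

/-- A compact symmetric operator on a Hilbert space has a Hilbert basis of eigenvectors. -/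
theorem exists_hilbertBasis_eigenvectors (T : F →L[ℝ] F) (hT : IsCompactOperator T)
    (hs : (T : F →ₗ[ℝ] F).IsSymmetric) :
    ∃ (ι : Type v) (e : HilbertBasis ι ℝ F) (κ : ι → ℝ), ∀ k, T (e k) = κ k • e k := by
  have hcl : ∀ μ : ℝ, CompleteSpace (Module.End.eigenspace (T : F →ₗ[ℝ] F) μ) := fun μ => by
    have h : IsClosed (Module.End.eigenspace (T : F →ₗ[ℝ] F) μ : Set F) := by
      have : (Module.End.eigenspace (T : F →ₗ[ℝ] F) μ : Set F) = {x | T x = μ • x} := by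
        ext x
        simp
      rw [this]
      exact isClosed_eq T.continuous (continuous_const_smul μ)
    exact h.completeSpace_coe
  -- All real `μ` are taken at once; if `μ` is not an eigenvalue, the basis is empty.
  choose w b hb using fun μ : ℝ =>
    exists_hilbertBasis ℝ (Module.End.eigenspace (T : F →ₗ[ℝ] F) μ)
  have ho := hs.orthogonalFamily_eigenspaces.orthonormal_sigma_orthonormal
    (v_family := fun μ => b μ) fun μ => (b μ).orthonormal
  have hbot : (Submodule.span ℝ (Set.range fun a : Σ μ, w μ =>
      (Module.End.eigenspace (T : F →ₗ[ℝ] F) a.1).subtypeₗᵢ (b a.1 a.2)))ᗮ = ⊥ := by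
    rw [eq_bot_iff]
    intro x hx
    have hx' := fun a => (Submodule.mem_orthogonal _ x).1 hx _ (Submodule.subset_span ⟨a, rfl⟩)
    have hmem : x ∈ (⨆ μ, Module.End.eigenspace (T : F →ₗ[ℝ] F) μ)ᗮ := by
      rw [← Submodule.iInf_orthogonal, Submodule.mem_iInf]
      intro μ
      rw [Submodule.mem_orthogonal]
      intro y hy
      have h1 := (b μ).hasSum_repr ⟨y, hy⟩
      have h2 := h1.mapL ((innerSL ℝ x) ∘L (Module.End.eigenspace (T : F →ₗ[ℝ] F) μ).subtypeL)
      have h3 : ∀ i, ((innerSL ℝ x) ∘L (Module.End.eigenspace (T : F →ₗ[ℝ] F) μ).subtypeL)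
          ((b μ).repr ⟨y, hy⟩ i • (b μ) i) = 0 := by
        intro i
        have : inner ℝ x (b μ i : F) = 0 := by
          rw [real_inner_comm]
          exact hx' ⟨μ, i⟩
        simp [this]
      simp only [h3] at h2
      have := h2.unique hasSum_zero
      rw [real_inner_comm]
      simpa using this
    rw [ContinuousLinearMap.orthogonalComplement_iSup_eigenspaces_eq_bot hT hs] at hmem
    exact hmem
  refine ⟨Σ μ, w μ, HilbertBasis.mkOfOrthogonalEqBot ho hbot, fun a => a.1, fun a => ?_⟩
  rw [HilbertBasis.coe_mkOfOrthogonalEqBot]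
  exact Module.End.mem_eigenspace_iff.1 (b a.1 a.2).2

/-- Singular value decomposition of an injective compact operator with dense range; the singular
values are written as `1 / ω k`. -/
theorem exists_singular_value_decomposition (J : E →L[ℝ] F) (hJ : IsCompactOperator J)
    (hinj : Function.Injective J) (hdense : DenseRange J) :
    ∃ (ι : Type v) (b : HilbertBasis ι ℝ E) (e : HilbertBasis ι ℝ F) (ω : ι → ℝ),
      (∀ k, 0 < ω k) ∧ (∀ k, J (b k) = (ω k)⁻¹ • e k) ∧
      ∀ k u, inner ℝ (b k) u = ω k * inner ℝ (e k) (J u) := by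
  obtain ⟨ι, e, κ, he⟩ := exists_hilbertBasis_eigenvectors (J ∘L J.adjoint)
    (hJ.comp_clm J.adjoint) (fun x y => by
      change inner ℝ (J (J.adjoint x)) y = inner ℝ x (J (J.adjoint y))
      rw [← ContinuousLinearMap.adjoint_inner_right J, ContinuousLinearMap.adjoint_inner_left])
  -- Density of the range of `J` makes the adjoint injective, which excludes zero eigenvalues of `J
  -- ∘ J*`.
  have hadj : ∀ x : F, J.adjoint x = 0 → x = 0 := by
    intro x hx
    have : ∀ y : F, inner ℝ x y = 0 := by
      intro y
      refine hdense.induction_on (p := fun y => inner ℝ x y = 0) y ?_ ?_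
      · exact isClosed_eq (by fun_prop) continuous_const
      · intro u
        rw [← ContinuousLinearMap.adjoint_inner_left, hx, inner_zero_left]
    exact inner_self_eq_zero.1 (this x)
  have hinner : ∀ i j, inner ℝ (J.adjoint (e i)) (J.adjoint (e j)) = κ j * inner ℝ (e i) (e j) := by
    intro i j
    have := he j
    rw [ContinuousLinearMap.comp_apply] at this
    rw [ContinuousLinearMap.adjoint_inner_left, this, inner_smul_right]
  have hκ : ∀ k, 0 < κ k := by
    intro k
    have h1 := hinner k k
    rw [real_inner_self_eq_norm_sq, real_inner_self_eq_norm_sq, e.orthonormal.1 k] at h1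
    have h2 : 0 < ‖J.adjoint (e k)‖ := by
      rw [norm_pos_iff]
      intro h0
      have := e.orthonormal.1 k
      rw [hadj _ h0] at this
      simp at this
    nlinarith [pow_pos h2 2]
  -- Since `‖J* (e k)‖² = κ k`, this is the factor that normalizes `J* (e k)`.
  set ω : ι → ℝ := fun k => (Real.sqrt (κ k))⁻¹ with hω
  have hωpos : ∀ k, 0 < ω k := fun k => inv_pos.2 (Real.sqrt_pos.2 (hκ k))
  have hωκ : ∀ k, ω k * ω k * κ k = 1 := by
    intro k
    have h1 := Real.mul_self_sqrt (hκ k).le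
    have h2 := (Real.sqrt_pos.2 (hκ k)).ne'
    rw [hω]
    field_simp
    nlinarith
  set bv : ι → E := fun k => ω k • J.adjoint (e k) with hbv
  have hort : Orthonormal ℝ bv := by
    classical
    rw [orthonormal_iff_ite]
    intro i j
    have h := orthonormal_iff_ite.1 e.orthonormal i j
    simp only [hbv, inner_smul_left, inner_smul_right, hinner, h]
    split_ifs with hij
    · subst hij
      simpa [mul_assoc] using hωκ i
    · simp
  have hbu : ∀ k u, inner ℝ (bv k) u = ω k * inner ℝ (e k) (J u) := by
    intro k u
    simp [hbv, inner_smul_left, ContinuousLinearMap.adjoint_inner_left]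
  -- Completeness of the second family comes from injectivity of `J`: a vector orthogonal to it has
  -- image orthogonal to every `e k`.
  have hbot : (Submodule.span ℝ (Set.range bv))ᗮ = ⊥ := by
    rw [eq_bot_iff]
    intro x hx
    have hx' := fun k => (Submodule.mem_orthogonal _ x).1 hx _ (Submodule.subset_span ⟨k, rfl⟩)
    have h0 : e.repr (J x) = 0 := by
      ext k
      have := hx' k
      rw [hbu] at this
      rw [e.repr_apply_apply]
      simpa [(hωpos k).ne'] using this
    have h1 : J x = 0 := by simpa using h0
    exact (Submodule.mem_bot ℝ).2 (hinj (by simpa using h1))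
  refine ⟨ι, HilbertBasis.mkOfOrthogonalEqBot hort hbot, e, ω, hωpos, fun k => ?_, fun k u => ?_⟩
  · rw [HilbertBasis.coe_mkOfOrthogonalEqBot]
    have := he k
    rw [ContinuousLinearMap.comp_apply] at this
    simp only [hbv, map_smul, this, smul_smul]
    congr 1
    have h1 := hωκ k
    have h2 := (hωpos k).ne'
    field_simp
    nlinarith
  · rw [HilbertBasis.coe_mkOfOrthogonalEqBot]
    exact hbu k u

/-- A copy of a vector space, to carry another norm. -/
def Renormed (E : Type u) : Type u := E

/-- A Hilbert space can be renormed by a coercive bounded symmetric bilinear form. -/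
theorem exists_renorming (B : E →L[ℝ] E →L[ℝ] ℝ) (hsymm : ∀ x y, B x y = B y x)
    (hcoer : ∃ α : ℝ, 0 < α ∧ ∀ x, α * ‖x‖ ^ 2 ≤ B x x) :
    ∃ (E' : Type u) (_ : NormedAddCommGroup E') (_ : InnerProductSpace ℝ E') (_ : CompleteSpace E')
      (φ : E' ≃L[ℝ] E), ∀ x y, inner ℝ x y = B (φ x) (φ y) := by
  obtain ⟨α, hα, hB⟩ := hcoer
  let i1 : AddCommGroup (Renormed E) := inferInstanceAs (AddCommGroup E)
  let i2 : Module ℝ (Renormed E) := inferInstanceAs (Module ℝ E)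
  let φ : Renormed E ≃ₗ[ℝ] E := LinearEquiv.refl ℝ E
  let core : InnerProductSpace.Core ℝ (Renormed E) :=
    { inner := fun x y => B (φ x) (φ y)
      conj_inner_symm := fun x y => by simpa using hsymm (φ y) (φ x)
      re_inner_nonneg := fun x => by
        have := hB (φ x)
        simp only [RCLike.re_to_real]
        nlinarith [mul_nonneg hα.le (sq_nonneg ‖φ x‖)]
      add_left := fun x y z => by simp
      smul_left := fun x y r => by simp
      definite := fun x hx => by
        have h1 := hB (φ x)
        have h2 : ‖φ x‖ ^ 2 ≤ 0 := by
          by_contra! h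
          nlinarith [mul_pos hα h]
        have h3 := norm_eq_zero.1 (pow_eq_zero_iff (two_ne_zero) |>.1 (le_antisymm h2 (sq_nonneg _)))
        simpa using h3 }
  let i3 : NormedAddCommGroup (Renormed E) := core.toNormedAddCommGroup
  let i4 : InnerProductSpace ℝ (Renormed E) := InnerProductSpace.ofCore core.toCore
  have hin : ∀ x y : Renormed E, inner ℝ x y = B (φ x) (φ y) := fun x y => rfl
  have hnorm : ∀ x : Renormed E, ‖x‖ ^ 2 = B (φ x) (φ x) := fun x => by
    rw [← hin, real_inner_self_eq_norm_sq]
  -- Coercivity bounds the identity in one direction, boundedness of `B` in the other.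
  let ψ : Renormed E ≃L[ℝ] E := φ.toContinuousLinearEquivOfBounds (Real.sqrt α⁻¹) (Real.sqrt ‖B‖)
    (fun x => by
      refine abs_le_of_sq_le_sq' ?_ (by positivity) |>.2
      rw [mul_pow, Real.sq_sqrt (by positivity), hnorm, inv_mul_eq_div, le_div_iff₀ hα, mul_comm]
      exact hB (φ x))
    (fun x => by
      refine abs_le_of_sq_le_sq' ?_ (by positivity) |>.2
      rw [mul_pow, Real.sq_sqrt (by positivity), hnorm, φ.apply_symm_apply]
      have := B.le_opNorm₂ x x
      rw [Real.norm_eq_abs] at this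
      nlinarith [le_abs_self (B x x)])
  have hcomp : CompleteSpace (Renormed E) :=
    (completeSpace_congr (e := ψ.toEquiv) ψ.isUniformEmbedding).2 inferInstance
  exact ⟨Renormed E, i3, i4, hcomp, ψ, hin⟩

end Spectral

/-! ### Complex modes and the free evolution as a group of rotations. -/

section Coordinates

/-- The isometry of `ℓ²`-sums induced by a family of isometries. -/
def lpMapIsometry {ι : Type*} {F G : ι → Type*} [∀ i, NormedAddCommGroup (F i)]
    [∀ i, NormedSpace ℝ (F i)] [∀ i, NormedAddCommGroup (G i)] [∀ i, NormedSpace ℝ (G i)]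
    (g : ∀ i, F i →ₗᵢ[ℝ] G i) : lp F 2 →ₗᵢ[ℝ] lp G 2 where
  toFun x := ⟨fun i => g i (x i), by
    have hx := lp.memℓp x
    rw [memℓp_gen_iff (by norm_num)] at hx
    refine memℓp_gen ?_
    simpa using hx⟩
  map_add' x y := by
    ext i
    exact (g i).map_add _ _
  map_smul' c x := by
    ext i
    exact (g i).map_smul _ _
  norm_map' x := by
    rw [← Real.rpow_left_inj (norm_nonneg _) (norm_nonneg _) (by norm_num : (2 : ℝ≥0∞).toReal ≠ 0),
      lp.norm_rpow_eq_tsum (by norm_num), lp.norm_rpow_eq_tsum (by norm_num)]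
    exact tsum_congr fun i => by
      congr 1
      exact (g i).norm_map _

variable {ι : Type*}

/-- Square summable families of complex numbers, as a real Hilbert space. -/
abbrev ComplexSeq (ι : Type*) : Type _ := lp (fun _ : ι => ℂ) 2

/-- Multiplication by a complex number of modulus one. -/
def unitMul (w : ℂ) (hw : ‖w‖ = 1) : ℂ →ₗᵢ[ℝ] ℂ where
  toLinearMap := LinearMap.mulLeft ℝ w
  norm_map' z := by simp [hw]

/-- The unitary group `z ↦ (exp (-i ω k t) z k)`. -/
def modeRotation (ω : ι → ℝ) (t : ℝ) : ComplexSeq ι →ₗᵢ[ℝ] ComplexSeq ι :=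
  lpMapIsometry fun k => unitMul (Complex.exp (-(ω k * t : ℝ) * Complex.I))
    (by rw [← Complex.ofReal_neg]; exact Complex.norm_exp_ofReal_mul_I _)

theorem modeRotation_apply (ω : ι → ℝ) (t : ℝ) (z : ComplexSeq ι) (k : ι) :
    modeRotation ω t z k = Complex.exp (-(ω k * t : ℝ) * Complex.I) * z k := rfl

theorem modeRotation_modeRotation_neg (ω : ι → ℝ) (t : ℝ) (z : ComplexSeq ι) :
    modeRotation ω t (modeRotation ω (-t) z) = z := by
  ext k
  rw [modeRotation_apply, modeRotation_apply, ← mul_assoc, ← Complex.exp_add]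
  simp

theorem modeRotation_neg_modeRotation (ω : ι → ℝ) (t : ℝ) (z : ComplexSeq ι) :
    modeRotation ω (-t) (modeRotation ω t z) = z := by
  simpa using modeRotation_modeRotation_neg ω (-t) z

/-- As `ω` may be unbounded, only strong continuity can be expected. The inner products with a fixed
vector are continuous by dominated summation, and weak continuity together with constant norm gives
norm continuity of the orbit. -/
theorem continuous_modeRotation_apply (ω : ι → ℝ) (z : ComplexSeq ι) :
    Continuous fun t => modeRotation ω t z := by
  have hinner : ∀ x : ComplexSeq ι, Continuous fun t => inner ℝ (modeRotation ω t z) x := by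
    intro x
    simp_rw [lp.inner_eq_tsum]
    have hs : Summable fun k => ‖z k‖ * ‖x k‖ :=
      lp.summable_mul (by rw [Real.holderConjugate_iff]; norm_num) z x
    refine continuous_tsum (fun k => ?_) hs fun k t => ?_
    · simp only [modeRotation_apply]
      fun_prop
    · refine (norm_inner_le_norm _ _).trans (le_of_eq ?_)
      rw [modeRotation_apply, norm_mul, ← Complex.ofReal_neg, Complex.norm_exp_ofReal_mul_I, one_mul]
  rw [continuous_iff_continuousAt]
  intro t₀
  rw [ContinuousAt, tendsto_iff_norm_sub_tendsto_zero]
  have h1 : ∀ t, ‖modeRotation ω t z - modeRotation ω t₀ z‖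
      = Real.sqrt (2 * ‖z‖ ^ 2 - 2 * inner ℝ (modeRotation ω t z) (modeRotation ω t₀ z)) := by
    intro t
    rw [← Real.sqrt_sq (norm_nonneg (modeRotation ω t z - modeRotation ω t₀ z)), norm_sub_sq_real,
      LinearIsometry.norm_map, LinearIsometry.norm_map]
    congr 1
    ring
  simp_rw [h1]
  have h2 : Continuous fun t =>
      Real.sqrt (2 * ‖z‖ ^ 2 - 2 * inner ℝ (modeRotation ω t z) (modeRotation ω t₀ z)) := by
    have := hinner (modeRotation ω t₀ z)
    fun_prop
  have h3 := h2.tendsto t₀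
  rwa [← h1, sub_self, norm_zero] at h3

theorem continuous_modeRotation (ω : ι → ℝ) :
    Continuous fun p : ℝ × ComplexSeq ι => modeRotation ω p.1 p.2 := by
  rw [continuous_iff_continuousAt]
  rintro ⟨t₀, z₀⟩
  rw [ContinuousAt, tendsto_iff_norm_sub_tendsto_zero]
  have h1 : Tendsto (fun p : ℝ × ComplexSeq ι =>
      ‖p.2 - z₀‖ + ‖modeRotation ω p.1 z₀ - modeRotation ω t₀ z₀‖) (𝓝 (t₀, z₀)) (𝓝 0) := by
    have h2 : Continuous fun p : ℝ × ComplexSeq ι =>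
        ‖p.2 - z₀‖ + ‖modeRotation ω p.1 z₀ - modeRotation ω t₀ z₀‖ := by
      have := (continuous_modeRotation_apply ω z₀).comp (continuous_fst (X := ℝ) (Y := ComplexSeq ι))
      simp only [Function.comp_def] at this
      fun_prop
    simpa using h2.tendsto (t₀, z₀)
  refine squeeze_zero (fun p => norm_nonneg _) (fun p => ?_) h1
  calc ‖modeRotation ω p.1 p.2 - modeRotation ω t₀ z₀‖
      = ‖modeRotation ω p.1 (p.2 - z₀)
        + (modeRotation ω p.1 z₀ - modeRotation ω t₀ z₀)‖ := by rw [map_sub]; abel_nf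
    _ ≤ _ := by
      refine (norm_add_le _ _).trans ?_
      rw [LinearIsometry.norm_map]

/-- The coordinates of an element of a Hilbert space, times a fixed complex number of
modulus one. -/
def coordinates {F : Type*} [NormedAddCommGroup F] [InnerProductSpace ℝ F]
    (e : HilbertBasis ι ℝ F) (w : ℂ) (hw : ‖w‖ = 1) : F →ₗᵢ[ℝ] ComplexSeq ι :=
  (lpMapIsometry fun _ => (unitMul w hw).comp Complex.ofRealLI).comp e.repr.toLinearIsometry

theorem coordinates_apply {F : Type*} [NormedAddCommGroup F] [InnerProductSpace ℝ F]
    (e : HilbertBasis ι ℝ F) (w : ℂ) (hw : ‖w‖ = 1) (x : F) (k : ι) :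
    coordinates e w hw x k = w * (inner ℝ (e k) x : ℝ) := by
  rw [← e.repr_apply_apply]
  rfl

/-- The vector `e k` is mapped to the family with the single entry `w` at `k`. With `w = 1` and `w =
I` the adjoint thus extracts real and imaginary parts. -/
theorem inner_adjoint_coordinates {F : Type*} [NormedAddCommGroup F] [InnerProductSpace ℝ F]
    [CompleteSpace F] (e : HilbertBasis ι ℝ F) (w : ℂ) (hw : ‖w‖ = 1) (z : ComplexSeq ι) (k : ι) :
    inner ℝ (e k) ((coordinates e w hw).toContinuousLinearMap.adjoint z) = inner ℝ w (z k) := by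
  classical
  rw [ContinuousLinearMap.adjoint_inner_right]
  have : coordinates e w hw (e k) = lp.single 2 k w := by
    ext j
    rw [coordinates_apply, orthonormal_iff_ite.1 e.orthonormal, lp.single_apply]
    by_cases h : j = k
    · subst h; simp
    · simp [h]
  rw [LinearIsometry.coe_toContinuousLinearMap, this]
  exact lp.inner_single_left (𝕜 := ℝ) (G := fun _ : ι => ℂ) k w z

section Phase

variable {E F : Type*} [NormedAddCommGroup E] [InnerProductSpace ℝ E] [CompleteSpace E]
  [NormedAddCommGroup F] [InnerProductSpace ℝ F] [CompleteSpace F]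

/-- The real parts of the modes. -/
def reModes (b : HilbertBasis ι ℝ E) : E →ₗᵢ[ℝ] ComplexSeq ι := coordinates b 1 (by simp)

/-- The imaginary parts of the modes. -/
def imModes (e : HilbertBasis ι ℝ F) : F →ₗᵢ[ℝ] ComplexSeq ι := coordinates e Complex.I (by simp)

/-- The element with given real parts of the modes. -/
def ofRe (b : HilbertBasis ι ℝ E) : ComplexSeq ι →L[ℝ] E :=
  (reModes b).toContinuousLinearMap.adjoint

/-- The element with given imaginary parts of the modes. -/
def ofIm (e : HilbertBasis ι ℝ F) : ComplexSeq ι →L[ℝ] F :=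
  (imModes e).toContinuousLinearMap.adjoint

variable (b : HilbertBasis ι ℝ E) (e : HilbertBasis ι ℝ F)

theorem reModes_apply (u : E) (k : ι) : reModes b u k = (inner ℝ (b k) u : ℝ) := by
  rw [reModes, coordinates_apply, one_mul]

theorem imModes_apply (v : F) (k : ι) : imModes e v k = Complex.I * (inner ℝ (e k) v : ℝ) := by
  rw [imModes, coordinates_apply]

theorem inner_ofRe (z : ComplexSeq ι) (k : ι) : inner ℝ (b k) (ofRe b z) = (z k).re := by
  rw [ofRe, reModes, inner_adjoint_coordinates]
  simp [Complex.inner]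

theorem inner_ofIm (z : ComplexSeq ι) (k : ι) : inner ℝ (e k) (ofIm e z) = (z k).im := by
  rw [ofIm, imModes, inner_adjoint_coordinates]
  simp [Complex.inner]

theorem HilbertBasis.ext_inner {x y : E} (h : ∀ k, inner ℝ (b k) x = inner ℝ (b k) y) : x = y := by
  refine b.repr.injective ?_
  ext k
  rw [b.repr_apply_apply, b.repr_apply_apply, h]

theorem reModes_ofRe_add_imModes_ofIm (z : ComplexSeq ι) :
    reModes b (ofRe b z) + imModes e (ofIm e z) = z := by
  ext k
  rw [lp.coeFn_add, Pi.add_apply, reModes_apply, imModes_apply, inner_ofRe, inner_ofIm, mul_comm,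
    Complex.re_add_im]

theorem ofRe_add (u : E) (v : F) : ofRe b (reModes b u + imModes e v) = u := by
  refine b.ext_inner fun k => ?_
  rw [inner_ofRe, lp.coeFn_add, Pi.add_apply, reModes_apply, imModes_apply]
  simp

theorem ofIm_add (u : E) (v : F) : ofIm e (reModes b u + imModes e v) = v := by
  refine e.ext_inner fun k => ?_
  rw [inner_ofIm, lp.coeFn_add, Pi.add_apply, reModes_apply, imModes_apply]
  simp

/-- The real and imaginary axes are orthogonal in every mode, so the modes preserve the Hilbert norm
of the phase space. -/
theorem norm_sq_modes (u : E) (v : F) :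
    ‖reModes b u + imModes e v‖ ^ 2 = ‖u‖ ^ 2 + ‖v‖ ^ 2 := by
  rw [norm_add_sq_real, LinearIsometry.norm_map, LinearIsometry.norm_map]
  have : inner ℝ (reModes b u) (imModes e v) = 0 := by
    rw [lp.inner_eq_tsum]
    refine (tsum_congr fun k => ?_).trans tsum_zero
    rw [reModes_apply, imModes_apply]
    simp [Complex.inner]
  rw [this]
  ring

theorem norm_sq_eq_ofRe_ofIm (z : ComplexSeq ι) : ‖z‖ ^ 2 = ‖ofRe b z‖ ^ 2 + ‖ofIm e z‖ ^ 2 := by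
  rw [← norm_sq_modes b e, reModes_ofRe_add_imModes_ofIm]

theorem norm_ofRe_le (z : ComplexSeq ι) : ‖ofRe b z‖ ≤ ‖z‖ := by
  have h := norm_sq_eq_ofRe_ofIm b b z
  exact abs_le_of_sq_le_sq' (by nlinarith [sq_nonneg ‖ofIm b z‖]) (norm_nonneg _) |>.2

theorem norm_ofIm_le (z : ComplexSeq ι) : ‖ofIm e z‖ ≤ ‖z‖ := by
  have h := norm_sq_eq_ofRe_ofIm e e z
  exact abs_le_of_sq_le_sq' (by nlinarith [sq_nonneg ‖ofRe e z‖]) (norm_nonneg _) |>.2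

end Phase

end Coordinates

/-! ### Ordinary differential equations with locally Lipschitz fields in Banach spaces. -/

section Trajectories

variable {G : Type*} [NormedAddCommGroup G] [NormedSpace ℝ G]

/-- A function with values in a Banach space is differentiable as soon as its images under a
separating family of functionals are, and the candidate for the derivative is continuous. -/
theorem hasDerivAt_of_separating [CompleteSpace G] {κ W : Type*} [NormedAddCommGroup W]
    [NormedSpace ℝ W] [CompleteSpace W] (l : κ → G →L[ℝ] W)
    (hl : ∀ x y, (∀ k, l k x = l k y) → x = y)
    {Y Z : ℝ → G} {U : Set ℝ} (hU : IsOpen U) (hZ : ContinuousOn Z U)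
    (h : ∀ k, ∀ t ∈ U, HasDerivAt (fun τ => l k (Y τ)) (l k (Z t)) t) {t : ℝ} (ht : t ∈ U) :
    HasDerivAt Y (Z t) t := by
  obtain ⟨ε, hε, hball⟩ := Metric.isOpen_iff.1 hU t ht
  have hsub : ∀ τ ∈ Metric.ball t ε, uIcc t τ ⊆ U := fun τ hτ =>
    ((convex_ball t ε).ordConnected.uIcc_subset (Metric.mem_ball_self hε) hτ).trans hball
  -- The functionals commute with the integral, so the scalar fundamental theorem of calculus
  -- identifies `Y` with a primitive of `Z`.
  have hev : Y =ᶠ[𝓝 t] fun τ => Y t + ∫ r in t..τ, Z r := by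
    filter_upwards [Metric.ball_mem_nhds t hε] with τ hτ
    have hint : IntervalIntegrable Z volume t τ := (hZ.mono (hsub τ hτ)).intervalIntegrable
    refine hl _ _ fun k => ?_
    rw [map_add, ← (l k).intervalIntegral_comp_comm hint,
      intervalIntegral.integral_eq_sub_of_hasDerivAt (fun r hr => h k r (hsub τ hτ hr))]
    · abel
    · exact ((l k).continuous.comp_continuousOn (hZ.mono (hsub τ hτ))).intervalIntegrable
  refine HasDerivAt.congr_of_eventuallyEq ?_ hev
  exact (intervalIntegral.integral_hasDerivAt_right (by simp)
    (hZ.stronglyMeasurableAtFilter hU t ht) (hZ.continuousAt (hU.mem_nhds ht))).const_add _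

/-- `y` solves `y' = Ψ(t, y)` on `[s, b]`. -/
structure IsTrajectory (Ψ : ℝ → G → G) (y : ℝ → G) (s b : ℝ) : Prop where
  continuousOn : ContinuousOn y (Icc s b)
  hasDerivAt : ∀ t ∈ Ioo s b, HasDerivAt y (Ψ t (y t)) t

/-- A time-dependent vector field which is Lipschitz on bounded sets, locally uniformly in time. -/
structure IsLocallyLipschitzField (Ψ : ℝ → G → G) : Prop where
  lipschitz : ∀ a b M : ℝ, ∃ K : ℝ≥0, ∀ t ∈ Icc a b,
    LipschitzOnWith K (Ψ t) (Metric.closedBall 0 M)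
  continuous : ∀ x, Continuous fun t => Ψ t x

namespace IsTrajectory

variable {Ψ : ℝ → G → G} {y y₁ y₂ : ℝ → G} {s b : ℝ}

theorem mono (h : IsTrajectory Ψ y s b) {s' b' : ℝ} (hs : s ≤ s') (hb : b' ≤ b) :
    IsTrajectory Ψ y s' b' :=
  ⟨h.continuousOn.mono (Icc_subset_Icc hs hb), fun t ht =>
    h.hasDerivAt t ⟨hs.trans_lt ht.1, ht.2.trans_le hb⟩⟩

theorem congr (h : IsTrajectory Ψ y₁ s b) (he : EqOn y₂ y₁ (Icc s b)) : IsTrajectory Ψ y₂ s b := by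
  refine ⟨h.continuousOn.congr he, fun t ht => ?_⟩
  rw [he (Ioo_subset_Icc_self ht)]
  refine (h.hasDerivAt t ht).congr_of_eventuallyEq ?_
  filter_upwards [Icc_mem_nhds ht.1 ht.2] with τ hτ using he hτ

end IsTrajectory

namespace IsLocallyLipschitzField

variable {Ψ : ℝ → G → G}

/-- Joint continuity: the state is frozen at its limit to use continuity in time, and the error is
absorbed by a Lipschitz constant uniform for nearby times. -/
theorem tendsto (hΨ : IsLocallyLipschitzField Ψ) {α : Type*} {l : Filter α} {τ : α → ℝ} {y : α → G}
    {t : ℝ} {x : G} (hτ : Tendsto τ l (𝓝 t)) (hy : Tendsto y l (𝓝 x)) :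
    Tendsto (fun a => Ψ (τ a) (y a)) l (𝓝 (Ψ t x)) := by
  obtain ⟨K, hK⟩ := hΨ.lipschitz (t - 1) (t + 1) (‖x‖ + 1)
  have h1 : Tendsto (fun a => Ψ (τ a) x) l (𝓝 (Ψ t x)) := ((hΨ.continuous x).tendsto t).comp hτ
  refine h1.congr_dist ?_
  have h2 : Tendsto (fun a => K * dist x (y a)) l (𝓝 0) := by
    simpa using ((tendsto_const_nhds (x := x)).dist hy).const_mul (K : ℝ)
  refine squeeze_zero' (Eventually.of_forall fun _ => dist_nonneg) ?_ h2
  have h3 : ∀ᶠ a in l, τ a ∈ Icc (t - 1) (t + 1) :=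
    hτ (Icc_mem_nhds (by linarith) (by linarith))
  have h4 : ∀ᶠ a in l, y a ∈ Metric.closedBall 0 (‖x‖ + 1) := by
    filter_upwards [hy.norm.eventually (gt_mem_nhds (lt_add_one ‖x‖))] with a ha
    simpa using ha.le
  filter_upwards [h3, h4] with a ha hb
  exact (hK _ ha).dist_le_mul _ (by simp) _ hb

theorem continuousOn (hΨ : IsLocallyLipschitzField Ψ) {U : Set ℝ} {y : ℝ → G}
    (hy : ContinuousOn y U) : ContinuousOn (fun t => Ψ t (y t)) U := fun t ht =>
  hΨ.tendsto (tendsto_id.mono_left nhdsWithin_le_nhds) (hy t ht)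

theorem exists_bound (hΨ : IsLocallyLipschitzField Ψ) (a b M : ℝ) :
    ∃ B : ℝ≥0, ∀ t ∈ Icc a b, ∀ x ∈ Metric.closedBall (0 : G) M, ‖Ψ t x‖ ≤ B := by
  obtain ⟨K, hK⟩ := hΨ.lipschitz a b M
  obtain ⟨C, hC⟩ := isCompact_Icc.exists_bound_of_continuousOn
    (hΨ.continuous 0).continuousOn (s := Icc a b)
  refine ⟨⟨|C| + K * |M|, by positivity⟩, fun t ht x hx => ?_⟩
  have hM : 0 ≤ M := Metric.nonempty_closedBall.1 ⟨x, hx⟩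
  have h1 := (hK t ht).dist_le_mul x hx 0 (by simpa using hM)
  rw [dist_eq_norm, dist_zero_right] at h1
  have h2 : ‖x‖ ≤ |M| := (by simpa using hx : ‖x‖ ≤ M).trans (le_abs_self M)
  calc ‖Ψ t x‖ = ‖(Ψ t x - Ψ t 0) + Ψ t 0‖ := by rw [sub_add_cancel]
    _ ≤ K * ‖x‖ + C := (norm_add_le _ _).trans (add_le_add h1 (hC t ht))
    _ ≤ |C| + K * |M| := by
      have := mul_le_mul_of_nonneg_left h2 K.2
      exact (add_le_add this (le_abs_self C)).trans (add_comm _ _).le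

/-- Grönwall-type lemmas need a right derivative at the initial time too, where a trajectory is only
assumed continuous. There it is the limit of the derivatives at later times. -/
theorem hasDerivWithinAt_Ici (hΨ : IsLocallyLipschitzField Ψ) {y : ℝ → G} {s b : ℝ}
    (hy : IsTrajectory Ψ y s b) {t : ℝ} (ht : t ∈ Ico s b) :
    HasDerivWithinAt y (Ψ t (y t)) (Ici t) t := by
  rcases ht.1.eq_or_lt with rfl | hst
  · have hIoo : Ioo s b ∈ 𝓝[>] s := Ioo_mem_nhdsGT ht.2
    have hcw : Tendsto y (𝓝[>] s) (𝓝 (y s)) := by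
      have := (hy.continuousOn s ⟨le_rfl, ht.2.le⟩).mono Ioo_subset_Icc_self
      rwa [ContinuousWithinAt, nhdsWithin_Ioo_eq_nhdsGT ht.2] at this
    refine hasDerivWithinAt_Ici_of_tendsto_deriv (s := Ioo s b)
      (fun r hr => (hy.hasDerivAt r hr).differentiableAt.differentiableWithinAt)
      ((hy.continuousOn s ⟨le_rfl, ht.2.le⟩).mono Ioo_subset_Icc_self) hIoo ?_
    refine (hΨ.tendsto (tendsto_id.mono_left nhdsWithin_le_nhds) hcw).congr' ?_
    filter_upwards [hIoo] with r hr using (hy.hasDerivAt r hr).deriv.symm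
  · exact (hy.hasDerivAt t ⟨hst, ht.2⟩).hasDerivWithinAt

theorem norm_sub_le (hΨ : IsLocallyLipschitzField Ψ) {y : ℝ → G} {s b M : ℝ} {B : ℝ≥0}
    (hy : IsTrajectory Ψ y s b) (hM : ∀ t ∈ Icc s b, ‖y t‖ ≤ M)
    (hB : ∀ t ∈ Icc s b, ∀ x ∈ Metric.closedBall (0 : G) M, ‖Ψ t x‖ ≤ B) {r t : ℝ}
    (hr : s ≤ r) (hrt : r ≤ t) (ht : t ≤ b) : ‖y t - y r‖ ≤ B * (t - r) := by
  have hy' := hy.mono hr ht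
  refine norm_image_sub_le_of_norm_deriv_right_le_segment hy'.continuousOn
    (fun τ hτ => hΨ.hasDerivWithinAt_Ici hy' hτ) (fun τ hτ => ?_) t ⟨hrt, le_rfl⟩
  have : τ ∈ Icc s b := ⟨hr.trans hτ.1, hτ.2.le.trans ht⟩
  exact hB τ this _ (by simpa using hM τ this)

theorem dist_le (hΨ : IsLocallyLipschitzField Ψ) {y₁ y₂ : ℝ → G} {s b M : ℝ} {K : ℝ≥0}
    (hy₁ : IsTrajectory Ψ y₁ s b) (hy₂ : IsTrajectory Ψ y₂ s b)
    (hM₁ : ∀ t ∈ Icc s b, ‖y₁ t‖ ≤ M) (hM₂ : ∀ t ∈ Icc s b, ‖y₂ t‖ ≤ M)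
    (hK : ∀ t ∈ Icc s b, LipschitzOnWith K (Ψ t) (Metric.closedBall 0 M)) {t : ℝ}
    (ht : t ∈ Icc s b) : dist (y₁ t) (y₂ t) ≤ dist (y₁ s) (y₂ s) * Real.exp (K * (t - s)) :=
  dist_le_of_trajectories_ODE_of_mem (v := Ψ) (s := fun _ => Metric.closedBall 0 M)
    (fun r hr => hK r (Ico_subset_Icc_self hr)) hy₁.continuousOn
    (fun r hr => hΨ.hasDerivWithinAt_Ici hy₁ hr)
    (fun r hr => by simpa using hM₁ r (Ico_subset_Icc_self hr)) hy₂.continuousOn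
    (fun r hr => hΨ.hasDerivWithinAt_Ici hy₂ hr)
    (fun r hr => by simpa using hM₂ r (Ico_subset_Icc_self hr)) le_rfl t ht

theorem eqOn (hΨ : IsLocallyLipschitzField Ψ) {y₁ y₂ : ℝ → G} {s b : ℝ}
    (hy₁ : IsTrajectory Ψ y₁ s b) (hy₂ : IsTrajectory Ψ y₂ s b) (h : y₁ s = y₂ s) :
    EqOn y₁ y₂ (Icc s b) := by
  obtain ⟨C₁, hC₁⟩ := isCompact_Icc.exists_bound_of_continuousOn hy₁.continuousOn
  obtain ⟨C₂, hC₂⟩ := isCompact_Icc.exists_bound_of_continuousOn hy₂.continuousOn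
  obtain ⟨K, hK⟩ := hΨ.lipschitz s b (max C₁ C₂)
  intro t ht
  have := hΨ.dist_le hy₁ hy₂ (fun t ht => (hC₁ t ht).trans (le_max_left _ _))
    (fun t ht => (hC₂ t ht).trans (le_max_right _ _)) hK ht
  rw [h, dist_self, zero_mul] at this
  exact dist_le_zero.1 this

end IsLocallyLipschitzField

/-- The radial retraction onto the ball of radius `M`. -/
def radialRetraction (M : ℝ) (x : G) : G := (M / max M ‖x‖) • x

theorem radialRetraction_of_norm_le {M : ℝ} (hM : 0 < M) {x : G} (hx : ‖x‖ ≤ M) :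
    radialRetraction M x = x := by
  rw [radialRetraction, max_eq_left hx, div_self hM.ne', one_smul]

theorem norm_radialRetraction_le {M : ℝ} (hM : 0 < M) (x : G) : ‖radialRetraction M x‖ ≤ M := by
  have h : 0 < max M ‖x‖ := hM.trans_le (le_max_left _ _)
  rw [radialRetraction, norm_smul, Real.norm_of_nonneg (by positivity), div_mul_eq_mul_div,
    div_le_iff₀ h]
  exact mul_le_mul_of_nonneg_left (le_max_right _ _) hM.le

theorem lipschitzWith_radialRetraction {M : ℝ} (hM : 0 < M) :
    LipschitzWith 2 (radialRetraction M : G → G) := by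
  refine LipschitzWith.of_dist_le_mul fun x y => ?_
  have hx : 0 < max M ‖x‖ := hM.trans_le (le_max_left _ _)
  have hy : 0 < max M ‖y‖ := hM.trans_le (le_max_left _ _)
  have hmax : |max M ‖y‖ - max M ‖x‖| ≤ ‖x - y‖ := by
    rw [max_comm M, max_comm M, abs_sub_comm]
    refine (abs_max_sub_max_le_abs _ _ _).trans ?_
    exact abs_norm_sub_norm_le x y
  -- One term moves the point, the other changes the scaling factor. Each is at most `‖x - y‖`,
  -- hence the constant `2`.
  have key : radialRetraction M x - radialRetraction M y = (M / max M ‖x‖) • (x - y)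
      + ((M / max M ‖x‖) * ((max M ‖y‖ - max M ‖x‖) / max M ‖y‖)) • y := by
    rw [radialRetraction, radialRetraction, smul_sub, sub_add, ← sub_smul]
    congr 2
    field_simp
    ring
  have h1 : M / max M ‖x‖ ≤ 1 := (div_le_one hx).2 (le_max_left _ _)
  have h2 : ‖y‖ / max M ‖y‖ ≤ 1 := (div_le_one hy).2 (le_max_right _ _)
  rw [dist_eq_norm, dist_eq_norm, key]
  refine (norm_add_le _ _).trans ?_
  rw [norm_smul, norm_smul, norm_mul, norm_div (_ - _), Real.norm_of_nonneg (by positivity),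
    Real.norm_of_nonneg hy.le, Real.norm_eq_abs]
  have h3 : M / max M ‖x‖ * (|max M ‖y‖ - max M ‖x‖| / max M ‖y‖) * ‖y‖
      = M / max M ‖x‖ * |max M ‖y‖ - max M ‖x‖| * (‖y‖ / max M ‖y‖) := by ring
  rw [h3]
  have h4 : M / max M ‖x‖ * |max M ‖y‖ - max M ‖x‖| * (‖y‖ / max M ‖y‖) ≤ 1 * ‖x - y‖ * 1 := by
    gcongr
  have h5 : M / max M ‖x‖ * ‖x - y‖ ≤ 1 * ‖x - y‖ := by gcongr
  simp only [NNReal.coe_ofNat]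
  linarith

/-- Trajectories starting in a bounded set remain bounded, uniformly in the initial time. -/
def HasBoundedTrajectories (Ψ : ℝ → G → G) : Prop :=
  ∀ R : ℝ, ∃ M : ℝ, ∀ (s b : ℝ) (y : ℝ → G), ‖y s‖ ≤ R → IsTrajectory Ψ y s b →
    ∀ t ∈ Icc s b, ‖y t‖ ≤ M

namespace IsLocallyLipschitzField

variable [CompleteSpace G] {Ψ : ℝ → G → G}

/-- Composed with the retraction onto a ball, the field is bounded and Lipschitz on all of `G`, so
Picard–Lindelöf applies on the entire interval at once. The a priori bound shows that the solution
never reaches the sphere where the truncation starts to act. -/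
theorem exists_trajectory (hΨ : IsLocallyLipschitzField Ψ) (hb : HasBoundedTrajectories Ψ)
    (s b : ℝ) (x : G) : ∃ y : ℝ → G, y s = x ∧ IsTrajectory Ψ y s b := by
  rcases lt_or_ge b s with hsb | hsb
  · exact ⟨fun _ => x, rfl, continuousOn_const, fun t ht => absurd (ht.1.trans ht.2) hsb.not_gt⟩
  obtain ⟨M₀, hM₀⟩ := hb ‖x‖
  -- The margin `1` makes the radius strictly larger than the a priori bound.
  set M := max M₀ ‖x‖ + 1 with hMdef
  have hM₀M : M₀ < M := (le_max_left _ _).trans_lt (lt_add_one _)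
  have hxM : ‖x‖ < M := (le_max_right _ _).trans_lt (lt_add_one _)
  have hM : 0 < M := (norm_nonneg x).trans_lt hxM
  obtain ⟨K, hK⟩ := hΨ.lipschitz s b M
  obtain ⟨B, hB⟩ := hΨ.exists_bound s b M
  have hmem : ∀ z : G, radialRetraction M z ∈ Metric.closedBall (0 : G) M := fun z => by
    simpa using norm_radialRetraction_le hM z
  -- The radius `B * (b - s)` is how far a curve of speed at most `B` can travel, so the Picard
  -- condition does not shorten the interval.
  have hPL : IsPicardLindelof (fun t z => Ψ t (radialRetraction M z))
      (⟨s, le_rfl, hsb⟩ : Icc s b) x (B * Real.toNNReal (b - s)) 0 B (K * 2) :=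
    { lipschitzOnWith := fun t ht => ((hK t ht).comp
        (lipschitzWith_radialRetraction hM).lipschitzOnWith fun z _ => hmem z).mono
          (subset_univ _)
      continuousOn := fun z _ => (hΨ.continuous _).continuousOn
      norm_le := fun t ht z _ => hB t ht _ (hmem z)
      mul_max_le := by
        simp [hsb] }
  obtain ⟨y, hys, hy⟩ := hPL.exists_eq_forall_mem_Icc_hasDerivWithinAt₀
  have hyc : ContinuousOn y (Icc s b) := fun t ht => (hy t ht).continuousWithinAt
  have htraj : ∀ b' ≤ b, (∀ t ∈ Ioo s b', ‖y t‖ ≤ M) → IsTrajectory Ψ y s b' := by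
    intro b' hb' h
    refine ⟨hyc.mono (Icc_subset_Icc_right hb'), fun t ht => ?_⟩
    have := (hy t ⟨ht.1.le, ht.2.le.trans hb'⟩).hasDerivAt (Icc_mem_nhds ht.1 (ht.2.trans_le hb'))
    rwa [radialRetraction_of_norm_le hM (h t ht)] at this
  have hlt : ∀ t ∈ Icc s b, ‖y t‖ < M := by
    by_contra! hne
    have hcpt : IsCompact {t ∈ Icc s b | M ≤ ‖y t‖} := by
      refine isCompact_Icc.of_isClosed_subset ?_ (sep_subset _ _)
      exact hyc.norm.preimage_isClosed_of_isClosed isClosed_Icc isClosed_Ici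
    -- Up to the first time of norm at least `M` the curve solves the untruncated equation, so the a
    -- priori bound `M₀ < M` still applies at that time.
    obtain ⟨t₁, ht₁, hmin⟩ := hcpt.exists_isLeast hne
    have hle : ∀ t ∈ Ioo s t₁, ‖y t‖ ≤ M := fun t ht => by
      by_contra! h
      exact (hmin ⟨⟨ht.1.le, ht.2.le.trans ht₁.1.2⟩, h.le⟩).not_gt ht.2
    have := hM₀ s t₁ y (by rw [hys]) (htraj t₁ ht₁.1.2 hle) t₁ ⟨ht₁.1.1, le_rfl⟩
    linarith [ht₁.2]
  exact ⟨y, hys, htraj b le_rfl fun t ht => (hlt t (Ioo_subset_Icc_self ht)).le⟩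

/-- By uniqueness the solutions on different intervals agree, so evaluating at the right endpoint
defines the flow and gives the process law. For joint continuity, both trajectories are moved to
common initial and final times at the cost of the speed bound `B`, and compared in between by
Grönwall. -/
theorem exists_flow (hΨ : IsLocallyLipschitzField Ψ) (hb : HasBoundedTrajectories Ψ) :
    ∃ Y : ℝ → ℝ → G → G, IsProcess Y ∧ (∀ s b x, IsTrajectory Ψ (fun t => Y t s x) s b) ∧
      ∀ s b y, IsTrajectory Ψ y s b → ∀ t ∈ Icc s b, y t = Y t s (y s) := by
  choose y hys hy using hΨ.exists_trajectory hb
  have huniq : ∀ s b z, IsTrajectory Ψ z s b → ∀ t ∈ Icc s b, z t = y s t (z s) t :=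
    fun s b z hz t ht => hΨ.eqOn (hz.mono le_rfl ht.2) (hy s t (z s)) (hys s t (z s)).symm
      ⟨ht.1, le_rfl⟩
  have htraj : ∀ s b x, IsTrajectory Ψ (fun t => y s t x t) s b := fun s b x =>
    (hy s b x).congr fun t ht => by
      have := huniq s b _ (hy s b x) t ht
      rw [hys] at this
      exact this.symm
  refine ⟨fun t s x => y s t x t, ⟨fun t x => hys t t x, ?_, ?_⟩, htraj, huniq⟩
  · intro t τ s hsτ hτt x
    exact huniq τ t (fun r => y s r x r) ((htraj s t x).mono hsτ le_rfl) t ⟨hτt, le_rfl⟩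
  · rintro ⟨t₀, s₀, x₀⟩ (hst₀ : s₀ ≤ t₀)
    obtain ⟨M, hM⟩ := hb (‖x₀‖ + 1)
    obtain ⟨K, hK⟩ := hΨ.lipschitz (s₀ - 1) (t₀ + 1) M
    obtain ⟨B, hB⟩ := hΨ.exists_bound (s₀ - 1) (t₀ + 1) M
    have hMx : ∀ s x, ‖x‖ ≤ ‖x₀‖ + 1 → ∀ t, s ≤ t → ‖y s t x t‖ ≤ M := fun s x hx t hst =>
      hM s t (fun t => y s t x t) (by simpa only [hys] using hx) (htraj s t x) t ⟨hst, le_rfl⟩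
    have hstep : ∀ s x, s₀ - 1 ≤ s → ‖x‖ ≤ ‖x₀‖ + 1 → ∀ r t, s ≤ r → r ≤ t → t ≤ t₀ + 1 →
        ‖y s t x t - y s r x r‖ ≤ B * (t - r) := fun s x hs hx r t hr hrt ht =>
      hΨ.norm_sub_le (htraj s (t₀ + 1) x) (fun τ hτ => hMx s x hx τ hτ.1)
        (fun τ hτ => hB τ ⟨hs.trans hτ.1, hτ.2⟩) hr hrt ht
    rw [ContinuousWithinAt, tendsto_iff_norm_sub_tendsto_zero]
    set D := Real.exp (K * (t₀ + 1 - (s₀ - 1))) with hD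
    have hlim : Tendsto (fun p : ℝ × ℝ × G => 2 * B * |p.1 - t₀|
        + (‖p.2.2 - x₀‖ + 2 * B * |p.2.1 - s₀|) * D)
        (𝓝[{p | p.2.1 ≤ p.1}] (t₀, s₀, x₀)) (𝓝 0) := by
      refine Tendsto.mono_left ?_ nhdsWithin_le_nhds
      have : Continuous (fun p : ℝ × ℝ × G => 2 * B * |p.1 - t₀|
        + (‖p.2.2 - x₀‖ + 2 * B * |p.2.1 - s₀|) * D) := by fun_prop
      simpa using this.tendsto (t₀, s₀, x₀)
    refine squeeze_zero' (Eventually.of_forall fun _ => norm_nonneg _) ?_ hlim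
    have hev : ∀ᶠ p : ℝ × ℝ × G in 𝓝[{p | p.2.1 ≤ p.1}] (t₀, s₀, x₀),
        p.1 ≤ t₀ + 1 ∧ s₀ - 1 ≤ p.2.1 ∧ p.2.1 ≤ t₀ + 1 ∧ ‖p.2.2‖ ≤ ‖x₀‖ + 1 := by
      refine nhdsWithin_le_nhds ?_
      have h1 : ∀ᶠ p : ℝ × ℝ × G in 𝓝 (t₀, s₀, x₀), p.1 < t₀ + 1 :=
        continuous_fst.continuousAt.eventually (gt_mem_nhds (by simp))
      have h2 : ∀ᶠ p : ℝ × ℝ × G in 𝓝 (t₀, s₀, x₀), s₀ - 1 < p.2.1 :=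
        (continuous_snd.fst).continuousAt.eventually (lt_mem_nhds (by simp))
      have h3 : ∀ᶠ p : ℝ × ℝ × G in 𝓝 (t₀, s₀, x₀), p.2.1 < t₀ + 1 :=
        (continuous_snd.fst).continuousAt.eventually
          (gt_mem_nhds (by simpa using hst₀.trans_lt (lt_add_one t₀)))
      have h4 : ∀ᶠ p : ℝ × ℝ × G in 𝓝 (t₀, s₀, x₀), ‖p.2.2‖ < ‖x₀‖ + 1 :=
        (continuous_snd.snd.norm).continuousAt.eventually (gt_mem_nhds (by simp))
      filter_upwards [h1, h2, h3, h4] with p a b c d using ⟨a.le, b.le, c.le, d.le⟩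
    filter_upwards [hev, self_mem_nhdsWithin] with ⟨t, s, x⟩ ⟨h1, h2, h3, h4⟩ (h5 : s ≤ t)
    dsimp only at h1 h2 h3 h4 ⊢
    have hx₀ : ‖x₀‖ ≤ ‖x₀‖ + 1 := by linarith
    -- On `[σ, τ]` both trajectories are defined, whatever the order of the initial times.
    set σ := max s s₀ with hσ
    set τ := max t t₀ with hτ
    have hστ : σ ≤ τ := max_le_max h5 hst₀
    have hτ1 : τ ≤ t₀ + 1 := max_le h1 (by linarith)
    have hsσ : s ≤ σ := le_max_left _ _
    have hsσ₀ : s₀ ≤ σ := le_max_right _ _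
    have e1 := hstep s x h2 h4 t τ h5 (le_max_left _ _) hτ1
    have e2 := hstep s₀ x₀ (by linarith) hx₀ t₀ τ hst₀ (le_max_right _ _) hτ1
    have e3 := hstep s x h2 h4 s σ le_rfl hsσ (hστ.trans hτ1)
    have e4 := hstep s₀ x₀ (by linarith) hx₀ s₀ σ le_rfl hsσ₀ (hστ.trans hτ1)
    rw [hys] at e3 e4
    have e5 := hΨ.dist_le (b := τ) ((htraj s τ x).mono hsσ le_rfl)
      ((htraj s₀ τ x₀).mono hsσ₀ le_rfl) (M := M) (K := K)
      (fun r hr => hMx s x h4 r (hsσ.trans hr.1)) (fun r hr => hMx s₀ x₀ hx₀ r (hsσ₀.trans hr.1))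
      (fun r hr => hK r ⟨by linarith [hr.1], hr.2.trans hτ1⟩) (t := τ) ⟨hστ, le_rfl⟩
    have e6 : Real.exp (K * (τ - σ)) ≤ D := by
      refine Real.exp_le_exp.2 (mul_le_mul_of_nonneg_left ?_ K.2)
      linarith
    have e7 : τ - t ≤ |t - t₀| := by
      rcases max_cases t t₀ with h | h <;> rw [hτ, h.1]
      · simp
      · linarith [neg_abs_le (t - t₀)]
    have e8 : τ - t₀ ≤ |t - t₀| := by
      rcases max_cases t t₀ with h | h <;> rw [hτ, h.1]
      · exact le_abs_self _
      · simp
    have e9 : σ - s ≤ |s - s₀| := by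
      rcases max_cases s s₀ with h | h <;> rw [hσ, h.1]
      · simp
      · linarith [neg_abs_le (s - s₀)]
    have e10 : σ - s₀ ≤ |s - s₀| := by
      rcases max_cases s s₀ with h | h <;> rw [hσ, h.1]
      · exact le_abs_self _
      · simp
    have e11 : dist (y s σ x σ) (y s₀ σ x₀ σ) ≤ ‖x - x₀‖ + 2 * B * |s - s₀| := by
      rw [dist_eq_norm]
      calc ‖y s σ x σ - y s₀ σ x₀ σ‖
          = ‖(y s σ x σ - x) + (x - x₀) - (y s₀ σ x₀ σ - x₀)‖ := by congr 1; abel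
        _ ≤ ‖y s σ x σ - x‖ + ‖x - x₀‖ + ‖y s₀ σ x₀ σ - x₀‖ :=
          (_root_.norm_sub_le _ _).trans (add_le_add_left (norm_add_le _ _) _)
        _ ≤ B * |s - s₀| + ‖x - x₀‖ + B * |s - s₀| :=
          add_le_add (add_le_add_left (e3.trans (mul_le_mul_of_nonneg_left e9 B.2)) _)
            (e4.trans (mul_le_mul_of_nonneg_left e10 B.2))
        _ = _ := by ring
    have e12 : dist (y s τ x τ) (y s₀ τ x₀ τ) ≤ (‖x - x₀‖ + 2 * B * |s - s₀|) * D :=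
      e5.trans (mul_le_mul e11 e6 (Real.exp_pos _).le (by positivity))
    rw [dist_eq_norm] at e12
    calc ‖y s t x t - y s₀ t₀ x₀ t₀‖
        = ‖(y s τ x τ - y s₀ τ x₀ τ) - (y s τ x τ - y s t x t)
            + (y s₀ τ x₀ τ - y s₀ t₀ x₀ t₀)‖ := by congr 1; abel
      _ ≤ ‖y s τ x τ - y s₀ τ x₀ τ‖ + ‖y s τ x τ - y s t x t‖
            + ‖y s₀ τ x₀ τ - y s₀ t₀ x₀ t₀‖ :=
          (norm_add_le _ _).trans (add_le_add_left (_root_.norm_sub_le _ _) _)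
      _ ≤ (‖x - x₀‖ + 2 * B * |s - s₀|) * D + B * |t - t₀| + B * |t - t₀| :=
          add_le_add (add_le_add e12 (e1.trans (mul_le_mul_of_nonneg_left e7 B.2)))
            (e2.trans (mul_le_mul_of_nonneg_left e8 B.2))
      _ = _ := by ring

end IsLocallyLipschitzField

end Trajectories

/-! ### The abstract wave equation in the interaction picture. -/

section Wave

variable {ι E F : Type*} [NormedAddCommGroup E] [InnerProductSpace ℝ E] [CompleteSpace E]
  [NormedAddCommGroup F] [InnerProductSpace ℝ F] [CompleteSpace F]

/-- Weak solutions on `[s, b]` of `u'' + β u' = -A u + g(u)`, `A` being the operator associated with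
the inner product of `E` and the embedding `J : E → F`. -/
structure IsWaveSolution (J : E →L[ℝ] F) (β : ℝ → ℝ) (g : E → F) (w : ℝ → E × F) (s b : ℝ) :
    Prop where
  continuousOn : ContinuousOn w (Icc s b)
  hasDerivAt : ∀ t ∈ Ioo s b, HasDerivAt (fun τ => J (w τ).1) (w t).2 t
  equation : ∀ t ∈ Ioo s b, ∀ φ : E, HasDerivAt (fun τ => inner ℝ (w τ).2 (J φ))
    (-β t * inner ℝ (w t).2 (J φ) - inner ℝ (w t).1 φ + inner ℝ (g (w t).1) (J φ)) t

variable (ω : ι → ℝ) (b : HilbertBasis ι ℝ E) (e : HilbertBasis ι ℝ F)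

/-- The modes of a state at time `t`, transported back to time `0` by the free evolution. -/
def toInteraction (t : ℝ) (w : E × F) : ComplexSeq ι :=
  modeRotation ω (-t) (reModes b w.1 + imModes e w.2)

/-- The inverse of `toInteraction`. -/
def ofInteraction (t : ℝ) (y : ComplexSeq ι) : E × F :=
  (ofRe b (modeRotation ω t y), ofIm e (modeRotation ω t y))

theorem ofInteraction_toInteraction (t : ℝ) (w : E × F) :
    ofInteraction ω b e t (toInteraction ω b e t w) = w := by
  simp only [ofInteraction, toInteraction, modeRotation_modeRotation_neg, ofRe_add, ofIm_add]

theorem toInteraction_ofInteraction (t : ℝ) (y : ComplexSeq ι) :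
    toInteraction ω b e t (ofInteraction ω b e t y) = y := by
  simp only [ofInteraction, toInteraction, reModes_ofRe_add_imModes_ofIm,
    modeRotation_neg_modeRotation]

theorem norm_sq_toInteraction (t : ℝ) (w : E × F) :
    ‖toInteraction ω b e t w‖ ^ 2 = ‖w.1‖ ^ 2 + ‖w.2‖ ^ 2 := by
  rw [toInteraction, LinearIsometry.norm_map, norm_sq_modes]

theorem ContinuousOn.modeRotation {X : Type*} [TopologicalSpace X] {S : Set X} {τ : X → ℝ}
    {z : X → ComplexSeq ι} (hτ : ContinuousOn τ S) (hz : ContinuousOn z S) :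
    ContinuousOn (fun x => modeRotation ω (τ x) (z x)) S := by
  have h := (continuous_modeRotation ω).comp_continuousOn (hτ.prodMk hz)
  exact h

theorem ContinuousOn.toInteraction {X : Type*} [TopologicalSpace X] {S : Set X} {τ : X → ℝ}
    {w : X → E × F} (hτ : ContinuousOn τ S) (hw : ContinuousOn w S) :
    ContinuousOn (fun x => toInteraction ω b e (τ x) (w x)) S := by
  unfold _root_.toInteraction
  exact hτ.neg.modeRotation ω (((reModes b).continuous.comp_continuousOn hw.fst).add
    ((imModes e).continuous.comp_continuousOn hw.snd))

theorem ContinuousOn.ofInteraction {X : Type*} [TopologicalSpace X] {S : Set X} {τ : X → ℝ}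
    {y : X → ComplexSeq ι} (hτ : ContinuousOn τ S) (hy : ContinuousOn y S) :
    ContinuousOn (fun x => ofInteraction ω b e (τ x) (y x)) S := by
  unfold _root_.ofInteraction
  exact ((ofRe b).continuous.comp_continuousOn (hτ.modeRotation ω hy)).prodMk
    ((ofIm e).continuous.comp_continuousOn (hτ.modeRotation ω hy))

/-- The vector field of the wave equation in the interaction picture. -/
def waveField (β : ℝ → ℝ) (g : E → F) (t : ℝ) (y : ComplexSeq ι) : ComplexSeq ι :=
  modeRotation ω (-t) (imModes e
    (-β t • (ofInteraction ω b e t y).2 + g (ofInteraction ω b e t y).1))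

theorem norm_ofInteraction_fst_le (t : ℝ) (y : ComplexSeq ι) :
    ‖(ofInteraction ω b e t y).1‖ ≤ ‖y‖ :=
  (norm_ofRe_le b _).trans_eq ((modeRotation ω t).norm_map y)

theorem norm_ofInteraction_snd_le (t : ℝ) (y : ComplexSeq ι) :
    ‖(ofInteraction ω b e t y).2‖ ≤ ‖y‖ :=
  (norm_ofIm_le e _).trans_eq ((modeRotation ω t).norm_map y)

theorem ofInteraction_sub (t : ℝ) (x y : ComplexSeq ι) :
    ofInteraction ω b e t (x - y) = ofInteraction ω b e t x - ofInteraction ω b e t y := by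
  simp [ofInteraction]

variable {β : ℝ → ℝ} {g : E → F}

/-- Rotations and mode maps do not increase norms and the unbounded operator is absorbed in the
rotation, so the constant is only a local bound of `|β|` plus the Lipschitz constant of `g`. -/
theorem isLocallyLipschitzField_waveField (hβ : Continuous β)
    (hg : ∀ M : ℝ, ∃ K : ℝ≥0, LipschitzOnWith K g (Metric.closedBall 0 M)) :
    IsLocallyLipschitzField (waveField ω b e β g) where
  lipschitz a c M := by
    obtain ⟨C, hC⟩ := isCompact_Icc.exists_bound_of_continuousOn hβ.continuousOn (s := Icc a c)
    obtain ⟨K, hK⟩ := hg M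
    refine ⟨C.toNNReal + K, fun t ht => LipschitzOnWith.of_dist_le_mul fun x hx y hy => ?_⟩
    have hm : ∀ z ∈ Metric.closedBall (0 : ComplexSeq ι) M,
        (ofInteraction ω b e t z).1 ∈ Metric.closedBall (0 : E) M := fun z hz => by
      simpa using (norm_ofInteraction_fst_le ω b e t z).trans (by simpa using hz)
    have h1 := hK.dist_le_mul _ (hm x hx) _ (hm y hy)
    rw [dist_eq_norm, dist_eq_norm, ← Prod.fst_sub, ← ofInteraction_sub] at h1
    rw [dist_eq_norm, dist_eq_norm, waveField, waveField, ← map_sub, LinearIsometry.norm_map,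
      ← map_sub, LinearIsometry.norm_map, add_sub_add_comm, ← smul_sub, ← Prod.snd_sub,
      ← ofInteraction_sub]
    refine (norm_add_le _ _).trans ?_
    rw [NNReal.coe_add, add_mul]
    refine add_le_add ?_ (h1.trans ?_)
    · rw [norm_smul, norm_neg]
      exact mul_le_mul ((hC t ht).trans (Real.le_coe_toNNReal C))
        (norm_ofInteraction_snd_le ω b e t _) (norm_nonneg _) (NNReal.coe_nonneg _)
    · exact mul_le_mul_of_nonneg_left (norm_ofInteraction_fst_le ω b e t _) K.2
  continuous x := by
    have hgc : Continuous g := by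
      rw [continuous_iff_continuousAt]
      intro u
      obtain ⟨K, hK⟩ := hg (‖u‖ + 1)
      refine hK.continuousOn.continuousAt ?_
      refine Filter.mem_of_superset (Metric.ball_mem_nhds u one_pos) fun v hv => ?_
      rw [mem_closedBall_zero_iff]
      have := norm_le_norm_add_norm_sub' v u
      rw [mem_ball_iff_norm] at hv
      linarith
    have h1 : ContinuousOn (fun t => ofInteraction ω b e t x) univ :=
      continuousOn_id.ofInteraction ω b e continuousOn_const
    have h2 : ContinuousOn (fun t => -β t • (ofInteraction ω b e t x).2
        + g (ofInteraction ω b e t x).1) univ :=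
      (hβ.neg.continuousOn.smul h1.snd).add (hgc.comp_continuousOn h1.fst)
    rw [← continuousOn_univ]
    unfold waveField
    exact continuousOn_id.neg.modeRotation ω ((imModes e).continuous.comp_continuousOn h2)

variable {ω b e} {J : E →L[ℝ] F}

/-- Testing with `ω k • b k` gives a scalar equation for each mode, in which the derivative of the
phase cancels the term `-i ω k z k`. The modes separate points and the candidate derivative is
continuous, so the equation holds in `ℓ²`. -/
theorem IsWaveSolution.isTrajectory (hω : ∀ k, 0 < ω k) (hJ : ∀ k, J (b k) = (ω k)⁻¹ • e k)
    (hJ' : ∀ k u, inner ℝ (b k) u = ω k * inner ℝ (e k) (J u))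
    (hΨ : IsLocallyLipschitzField (waveField ω b e β g)) {w : ℝ → E × F} {s c : ℝ}
    (hw : IsWaveSolution J β g w s c) :
    IsTrajectory (waveField ω b e β g) (fun t => toInteraction ω b e t (w t)) s c := by
  have hc : ContinuousOn (fun t => toInteraction ω b e t (w t)) (Icc s c) :=
    continuousOn_id.toInteraction ω b e hw.continuousOn
  refine ⟨hc, fun t ht => hasDerivAt_of_separating
    (l := fun k : ι => lp.evalCLM (𝕜 := ℝ) (fun _ : ι => ℂ) 2 k)
    (fun x y h => lp.ext (funext h)) isOpen_Ioo
    (hΨ.continuousOn (hc.mono Ioo_subset_Icc_self)) (fun k t ht => ?_) ht⟩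
  have hφ : J (ω k • b k) = e k := by
    rw [map_smul, hJ, smul_smul, mul_inv_cancel₀ (hω k).ne', one_smul]
  have d1 : HasDerivAt (fun τ => inner ℝ (b k) (w τ).1) (ω k * inner ℝ (e k) (w t).2) t := by
    simp_rw [hJ']
    exact (((innerSL ℝ (e k)).hasFDerivAt.comp_hasDerivAt t (hw.hasDerivAt t ht))).const_mul (ω k)
  have d2 := hw.equation t ht (ω k • b k)
  rw [hφ, inner_smul_right, real_inner_comm (b k), real_inner_comm (e k),
    real_inner_comm (e k)] at d2
  simp_rw [real_inner_comm (e k)] at d2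
  have d3 : HasDerivAt (fun τ : ℝ => Complex.exp (-(ω k * -τ : ℝ) * Complex.I))
      (Complex.exp (-(ω k * -t : ℝ) * Complex.I) * (ω k * Complex.I)) t := by
    have : HasDerivAt (fun τ : ℝ => -((ω k * -τ : ℝ) : ℂ) * Complex.I) (ω k * Complex.I) t := by
      have h0 := ((((hasDerivAt_id t).neg.const_mul (ω k)).ofReal_comp).neg).mul_const Complex.I
      simpa using h0
    exact this.cexp
  have d4 := d3.mul (d1.ofReal_comp.add (d2.ofReal_comp.const_mul Complex.I))
  have hfun : (fun τ => lp.evalCLM (𝕜 := ℝ) (fun _ : ι => ℂ) 2 k (toInteraction ω b e τ (w τ)))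
      = fun τ : ℝ => Complex.exp (-(ω k * -τ : ℝ) * Complex.I) *
        (((inner ℝ (b k) (w τ).1 : ℝ) : ℂ) + Complex.I * ((inner ℝ (e k) (w τ).2 : ℝ) : ℂ)) := by
    funext τ
    change toInteraction ω b e τ (w τ) k = _
    rw [toInteraction, modeRotation_apply, lp.coeFn_add, Pi.add_apply, reModes_apply,
      imModes_apply]
  rw [hfun]
  refine d4.congr_deriv ?_
  change _ = waveField ω b e β g t (toInteraction ω b e t (w t)) k
  rw [waveField, modeRotation_apply, imModes_apply, ofInteraction_toInteraction, inner_add_right,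
    inner_smul_right, Pi.add_apply]
  generalize Complex.exp (-(ω k * -t : ℝ) * Complex.I) = x
  push_cast
  linear_combination (x * ω k * (inner ℝ (e k) (w t).2 : ℝ)) * Complex.I_sq

/-- Rotating back, each mode satisfies its oscillator equation. Real parts give the derivative of `J
u` in `F`, imaginary parts give the weak equation. -/
theorem IsTrajectory.isWaveSolution (hω : ∀ k, 0 < ω k) (hJ : ∀ k, J (b k) = (ω k)⁻¹ • e k)
    (hJ' : ∀ k u, inner ℝ (b k) u = ω k * inner ℝ (e k) (J u)) (hβ : Continuous β)
    (hg : Continuous g) {y : ℝ → ComplexSeq ι} {s c : ℝ}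
    (hy : IsTrajectory (waveField ω b e β g) y s c) :
    IsWaveSolution J β g (fun t => ofInteraction ω b e t (y t)) s c := by
  set w := fun t => ofInteraction ω b e t (y t) with hwdef
  have hwc : ContinuousOn w (Icc s c) :=
    continuousOn_id.ofInteraction ω b e hy.continuousOn
  have hwc' : ContinuousOn w (Ioo s c) := hwc.mono Ioo_subset_Icc_self
  set q := fun t => -β t • (w t).2 + g (w t).1 with hq
  have hqc : ContinuousOn q (Ioo s c) :=
    (hβ.neg.continuousOn.smul hwc'.snd).add (hg.comp_continuousOn hwc'.fst)
  have hz : ∀ k, ∀ t ∈ Ioo s c, HasDerivAt (fun τ => modeRotation ω τ (y τ) k)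
      (-(ω k * Complex.I) * modeRotation ω t (y t) k + Complex.I * (inner ℝ (e k) (q t) : ℝ))
      t := by
    intro k t ht
    have d1 : HasDerivAt (fun τ : ℝ => Complex.exp (-(ω k * τ : ℝ) * Complex.I))
        (Complex.exp (-(ω k * t : ℝ) * Complex.I) * (-(ω k * Complex.I))) t := by
      have : HasDerivAt (fun τ : ℝ => -((ω k * τ : ℝ) : ℂ) * Complex.I) (-(ω k * Complex.I)) t := by
        have h0 := ((((hasDerivAt_id t).const_mul (ω k)).ofReal_comp).neg).mul_const Complex.I
        simpa using h0
      exact this.cexp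
    have d2 : HasDerivAt (fun τ => y τ k) (waveField ω b e β g t (y t) k) t :=
      (lp.evalCLM (𝕜 := ℝ) (fun _ : ι => ℂ) 2 k).hasFDerivAt.comp_hasDerivAt t (hy.hasDerivAt t ht)
    refine (d1.mul d2).congr_deriv ?_
    have h1 : Complex.exp (-(ω k * t : ℝ) * Complex.I) * waveField ω b e β g t (y t) k
        = Complex.I * (inner ℝ (e k) (q t) : ℝ) := by
      rw [← modeRotation_apply, waveField, modeRotation_modeRotation_neg, imModes_apply]
    rw [h1, modeRotation_apply]
    ring
  have hre : ∀ k, ∀ t ∈ Ioo s c, HasDerivAt (fun τ => (modeRotation ω τ (y τ) k).re)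
      (ω k * inner ℝ (e k) (w t).2) t := by
    intro k t ht
    refine (Complex.reCLM.hasFDerivAt.comp_hasDerivAt t (hz k t ht)).congr_deriv ?_
    simp [w, ofInteraction, inner_ofIm]
  have him : ∀ k, ∀ t ∈ Ioo s c, HasDerivAt (fun τ => inner ℝ (e k) (w τ).2)
      (-(ω k * inner ℝ (b k) (w t).1) + inner ℝ (e k) (q t)) t := by
    intro k t ht
    have h := (Complex.imCLM.hasFDerivAt.comp_hasDerivAt t (hz k t ht))
    have hfun : (fun τ => inner ℝ (e k) (w τ).2)
        = ⇑Complex.imCLM ∘ fun τ => modeRotation ω τ (y τ) k := by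
      funext τ
      simp [w, ofInteraction, inner_ofIm]
    rw [hfun]
    refine h.congr_deriv ?_
    simp [w, ofInteraction, inner_ofRe]
  refine ⟨hwc, fun t ht => ?_, fun t ht φ => ?_⟩
  · refine hasDerivAt_of_separating (l := fun k => innerSL ℝ (e k)) (fun x y h => e.ext_inner h)
      isOpen_Ioo hwc'.snd (fun k t ht => ?_) ht
    have hfun : (fun τ => innerSL ℝ (e k) (J (w τ).1))
        = fun τ => (ω k)⁻¹ * (modeRotation ω τ (y τ) k).re := by
      funext τ
      have := hJ' k (w τ).1
      rw [eq_inv_mul_iff_mul_eq₀ (hω k).ne', innerSL_apply_apply, ← this]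
      exact inner_ofRe b _ k
    rw [hfun]
    refine ((hre k t ht).const_mul _).congr_deriv ?_
    rw [inv_mul_cancel_left₀ (hω k).ne', innerSL_apply_apply]
  -- The velocity need not be differentiable in `F`, but its image under `J*` is differentiable in
  -- `E`. Pairing with `φ` then covers all test elements, not only finite combinations of modes.
  · have h : HasDerivAt (fun τ => J.adjoint (w τ).2) (-(w t).1 + J.adjoint (q t)) t := by
      refine hasDerivAt_of_separating (Z := fun t => -(w t).1 + J.adjoint (q t))
        (l := fun k => innerSL ℝ (b k)) (fun x y h => b.ext_inner h)
        isOpen_Ioo (hwc'.fst.neg.add (J.adjoint.continuous.comp_continuousOn hqc))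
        (fun k t ht => ?_) ht
      have hfun : ∀ v : F, innerSL ℝ (b k) (J.adjoint v) = (ω k)⁻¹ * inner ℝ (e k) v := by
        intro v
        rw [innerSL_apply_apply, ContinuousLinearMap.adjoint_inner_right, hJ,
          real_inner_smul_left]
      simp_rw [map_add, hfun]
      refine ((him k t ht).const_mul _).congr_deriv ?_
      rw [mul_add, map_neg, innerSL_apply_apply, mul_neg, inv_mul_cancel_left₀ (hω k).ne']
    have h' := (innerSL ℝ φ).hasFDerivAt.comp_hasDerivAt t h
    have hfun : (fun τ => inner ℝ (w τ).2 (J φ)) = ⇑(innerSL ℝ φ) ∘ fun τ => J.adjoint (w τ).2 := by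
      funext τ
      rw [Function.comp_apply, innerSL_apply_apply, ContinuousLinearMap.adjoint_inner_right,
        real_inner_comm]
    rw [hfun]
    refine h'.congr_deriv ?_
    rw [map_add, map_neg, innerSL_apply_apply, innerSL_apply_apply,
      ContinuousLinearMap.adjoint_inner_right, inner_add_right, inner_smul_right,
      real_inner_comm (w t).1, real_inner_comm (w t).2, real_inner_comm (g (w t).1)]
    ring

end Wave

/-! ### The energy estimate. -/

section Energy

variable {ι E F : Type*} [NormedAddCommGroup E] [InnerProductSpace ℝ E] [CompleteSpace E]
  [NormedAddCommGroup F] [InnerProductSpace ℝ F] [CompleteSpace F]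

/-- `Φ` is a potential of the nonlinearity `g : E → F` along the embedding `J : E → F`, with a
remainder that is controlled in the weaker norm of `F`. -/
def IsPotential (J : E →L[ℝ] F) (g : E → F) (Φ : E → ℝ) : Prop :=
  ∀ M : ℝ, ∃ K : ℝ≥0, ∀ u ∈ Metric.closedBall (0 : E) M, ∀ v ∈ Metric.closedBall (0 : E) M,
    |Φ v - Φ u - inner ℝ (g u) (J (v - u))| ≤ K * ‖J (v - u)‖ * ‖v - u‖

variable {J : E →L[ℝ] F} {g : E → F} {Φ : E → ℝ} {β : ℝ → ℝ}

/-- A chain rule for curves that are only continuous in `E` and differentiable in `F`: the remainder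
is a product of `‖J (u τ - u t)‖ = O(τ - t)` and `‖u τ - u t‖ = o(1)`. -/
theorem IsPotential.hasDerivAt (hΦ : IsPotential J g Φ) {u : ℝ → E} {v : F} {t : ℝ}
    (hu : ContinuousAt u t) (hJu : HasDerivAt (fun τ => J (u τ)) v t) :
    HasDerivAt (fun τ => Φ (u τ)) (inner ℝ (g (u t)) v) t := by
  have h1 : HasDerivAt (fun τ => inner ℝ (g (u t)) (J (u τ))) (inner ℝ (g (u t)) v) t :=
    (innerSL ℝ (g (u t))).hasFDerivAt.comp_hasDerivAt t hJu
  have h2 : HasDerivAt (fun τ => Φ (u τ) - inner ℝ (g (u t)) (J (u τ))) 0 t := by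
    obtain ⟨K, hK⟩ := hΦ (‖u t‖ + 1)
    rw [hasDerivAt_iff_isLittleO]
    have hO : (fun τ => ‖J (u τ - u t)‖) =O[𝓝 t] fun τ => τ - t := by
      simpa only [map_sub] using hJu.differentiableAt.isBigO_sub.norm_left
    have ho : (fun τ => K * ‖u τ - u t‖) =o[𝓝 t] fun _ => (1 : ℝ) := by
      rw [Asymptotics.isLittleO_one_iff]
      have := ((tendsto_iff_norm_sub_tendsto_zero.1 hu).const_mul (K : ℝ))
      rwa [mul_zero] at this
    have hmul := hO.mul_isLittleO ho
    simp only [mul_one] at hmul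
    refine Asymptotics.IsBigO.trans_isLittleO (Asymptotics.IsBigO.of_bound 1 ?_) hmul
    filter_upwards [hu.norm.eventually (gt_mem_nhds (lt_add_one ‖u t‖))] with τ hτ
    have := hK (u t) (by simp) (u τ) (by simpa using hτ.le)
    rw [map_sub, inner_sub_right] at this
    rw [smul_zero, sub_zero, one_mul, Real.norm_eq_abs, Real.norm_of_nonneg (by positivity),
      map_sub]
    refine le_trans (le_of_eq ?_) (this.trans (le_of_eq (by ring)))
    congr 1
    ring
  refine ((h2.add h1).congr_deriv (zero_add _)).congr_of_eventuallyEq ?_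
  exact Eventually.of_forall fun τ => by simp

theorem IsPotential.exists_bound (hΦ : IsPotential J g Φ) (R : ℝ) :
    ∃ C : ℝ, ∀ u : E, ‖u‖ ≤ R → |Φ u| ≤ C := by
  obtain ⟨K, hK⟩ := hΦ |R|
  refine ⟨|Φ 0| + ‖g 0‖ * (‖J‖ * |R|) + K * (‖J‖ * |R|) * |R|, fun u hu => ?_⟩
  have hu' : ‖u‖ ≤ |R| := hu.trans (le_abs_self R)
  have h := hK 0 (by simp) u (by simpa using hu')
  rw [sub_zero] at h
  have hJ : ‖J u‖ ≤ ‖J‖ * |R| := (J.le_opNorm u).trans (by gcongr)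
  have h1 : |inner ℝ (g 0) (J u)| ≤ ‖g 0‖ * (‖J‖ * |R|) :=
    (abs_real_inner_le_norm _ _).trans (by gcongr)
  have h2 : K * ‖J u‖ * ‖u‖ ≤ K * (‖J‖ * |R|) * |R| := by gcongr
  calc |Φ u| = |(Φ u - Φ 0 - inner ℝ (g 0) (J u)) + (Φ 0 + inner ℝ (g 0) (J u))| := by
        congr 1; ring
    _ ≤ |Φ u - Φ 0 - inner ℝ (g 0) (J u)| + (|Φ 0| + |inner ℝ (g 0) (J u)|) :=
      (abs_add_le _ _).trans (add_le_add_right (abs_add_le _ _) _)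
    _ ≤ _ := by linarith

variable {ω : ι → ℝ} {b : HilbertBasis ι ℝ E} {e : HilbertBasis ι ℝ F}

/-- Trajectories of the damped wave equation are bounded: the energy grows at most by a factor
determined by the integral of the negative part of the damping. -/
theorem hasBoundedTrajectories_waveField (hω : ∀ k, 0 < ω k)
    (hJ : ∀ k, J (b k) = (ω k)⁻¹ • e k)
    (hJ' : ∀ k u, inner ℝ (b k) u = ω k * inner ℝ (e k) (J u)) (hβ : Continuous β)
    (hβ1 : Integrable fun t => max (-β t) 0) (hg : Continuous g) (hΦ : IsPotential J g Φ)
    {θ C : ℝ} (hθ0 : 0 ≤ θ) (hθ : θ < 1) (hΦθ : ∀ u, 2 * Φ u ≤ θ * ‖u‖ ^ 2 + C) :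
    HasBoundedTrajectories (waveField ω b e β g) := by
  intro R
  obtain ⟨D, hD⟩ := hΦ.exists_bound R
  -- The rate for which `2 β⁻ ‖y‖² ≤ κ β⁻ Nr`, given the lower bound `(1 - θ) ‖y‖² ≤ Nr`.
  set κ := 2 / (1 - θ) with hκ
  have hθ1 : 0 < 1 - θ := by linarith
  have hκ0 : 0 ≤ κ := by positivity
  set I := ∫ t, max (-β t) 0 with hI
  set bm := fun t => max (-β t) 0 with hbm
  have hbmc : Continuous bm := hβ.neg.max continuous_const
  set A := (R ^ 2 + 2 * D + C) * Real.exp (κ * I) / (1 - θ) with hA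
  refine ⟨Real.sqrt A, fun s c y hys hy t ht => ?_⟩
  have hst : s ≤ t := ht.1
  have hsc : s ≤ c := hst.trans ht.2
  have hw := hy.isWaveSolution hω hJ hJ' hβ hg
  set w := fun t => ofInteraction ω b e t (y t) with hwdef
  -- Twice the physical energy, shifted by `C` to be nonnegative.
  set Nr := fun t => ‖y t‖ ^ 2 - 2 * Φ (w t).1 + C with hN
  have hNlow : ∀ t, (1 - θ) * ‖y t‖ ^ 2 ≤ Nr t := by
    intro t
    have h1 := hΦθ (w t).1
    have h2 : ‖(w t).1‖ ^ 2 ≤ ‖y t‖ ^ 2 :=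
      pow_le_pow_left₀ (norm_nonneg _) (norm_ofInteraction_fst_le ω b e t (y t)) 2
    have h3 := mul_le_mul_of_nonneg_left h2 hθ0
    simp only [hN]
    linarith
  have hNder : ∀ t ∈ Ioo s c, HasDerivAt Nr (-2 * β t * ‖(w t).2‖ ^ 2) t := by
    intro t ht
    have h1 := (hy.hasDerivAt t ht).norm_sq
    have h2 := hΦ.hasDerivAt
      ((hw.continuousOn.continuousAt (Icc_mem_nhds ht.1 ht.2)).fst) (hw.hasDerivAt t ht)
    refine ((h1.sub (h2.const_mul 2)).add_const C).congr_deriv ?_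
    -- The rotation is an isometry, so the free evolution drops out; only the velocity component
    -- pairs with the forcing.
    have h3 : inner ℝ (y t) (waveField ω b e β g t (y t))
        = inner ℝ (w t).2 (-β t • (w t).2 + g (w t).1) := by
      rw [waveField, ← (modeRotation ω t).inner_map_map, modeRotation_modeRotation_neg,
        ← LinearIsometry.coe_toContinuousLinearMap (imModes e),
        ← ContinuousLinearMap.adjoint_inner_left]
      rfl
    rw [h3, inner_add_right, inner_smul_right, real_inner_self_eq_norm_sq,
      real_inner_comm (g (w t).1)]
    ring
  have hNcont : ContinuousOn Nr (Icc s c) := by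
    have hΦc : Continuous Φ := by
      rw [continuous_iff_continuousAt]
      intro u
      obtain ⟨K, hK⟩ := hΦ (‖u‖ + 1)
      rw [ContinuousAt, tendsto_iff_norm_sub_tendsto_zero]
      have hlim : Tendsto (fun v => K * ‖J (v - u)‖ * ‖v - u‖ + |inner ℝ (g u) (J (v - u))|)
          (𝓝 u) (𝓝 0) := by
        have : Continuous fun v => K * ‖J (v - u)‖ * ‖v - u‖ + |inner ℝ (g u) (J (v - u))| := by
          fun_prop
        simpa using this.tendsto u
      refine squeeze_zero' (Eventually.of_forall fun _ => norm_nonneg _) ?_ hlim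
      filter_upwards [continuous_norm.continuousAt.eventually (gt_mem_nhds (lt_add_one ‖u‖))]
        with v hv
      have := hK u (by simp) v (by simpa using hv.le)
      rw [Real.norm_eq_abs]
      calc |Φ v - Φ u| = |(Φ v - Φ u - inner ℝ (g u) (J (v - u))) + inner ℝ (g u) (J (v - u))| := by
            rw [sub_add_cancel]
        _ ≤ _ := (abs_add_le _ _).trans (add_le_add_left this _)
    exact ((hy.continuousOn.norm.pow 2).sub
      ((hΦc.comp_continuousOn hw.continuousOn.fst).const_smul (2 : ℝ))).add continuousOn_const
  have hEder : ∀ t, HasDerivAt (fun t => Real.exp (-(κ * ∫ τ in s..t, bm τ)))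
      (Real.exp (-(κ * ∫ τ in s..t, bm τ)) * -(κ * bm t)) t := fun t =>
    ((hbmc.integral_hasStrictDerivAt s t).hasDerivAt.const_mul κ).neg.exp
  -- Grönwall's inequality by an integrating factor for `Nr' ≤ κ β⁻ Nr`.
  have hanti : AntitoneOn (fun t => Nr t * Real.exp (-(κ * ∫ τ in s..t, bm τ))) (Icc s c) := by
    refine antitoneOn_of_hasDerivWithinAt_nonpos (convex_Icc s c)
      (hNcont.mul fun t _ => (hEder t).continuousAt.continuousWithinAt)
      (fun t ht => ((hNder t (by simpa using ht)).mul (hEder t)).hasDerivWithinAt) fun t ht => ?_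
    have h1 : -2 * β t * ‖(w t).2‖ ^ 2 ≤ κ * bm t * Nr t := by
      have h2 : ‖(w t).2‖ ^ 2 ≤ ‖y t‖ ^ 2 :=
        pow_le_pow_left₀ (norm_nonneg _) (norm_ofInteraction_snd_le ω b e t (y t)) 2
      have h3 : -β t ≤ bm t := le_max_left _ _
      have h4 : 0 ≤ bm t := le_max_right _ _
      have h5 : -β t * ‖(w t).2‖ ^ 2 ≤ bm t * ‖y t‖ ^ 2 :=
        mul_le_mul h3 h2 (by positivity) h4
      have h6 : κ * ((1 - θ) * ‖y t‖ ^ 2) = 2 * ‖y t‖ ^ 2 := by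
        rw [hκ]; field_simp
      have h7 := mul_le_mul_of_nonneg_left (hNlow t) (mul_nonneg hκ0 h4)
      nlinarith
    have h2 := Real.exp_pos (-(κ * ∫ τ in s..t, bm τ))
    nlinarith
  have hle := hanti ⟨le_rfl, hsc⟩ ht hst
  simp only [intervalIntegral.integral_same, mul_zero, neg_zero, Real.exp_zero, mul_one] at hle
  have hint : ∫ τ in s..t, bm τ ≤ I := by
    rw [intervalIntegral.integral_of_le hst]
    exact setIntegral_le_integral hβ1 (Eventually.of_forall fun τ => le_max_right _ _)
  have hexp : Real.exp (-(κ * I)) ≤ Real.exp (-(κ * ∫ τ in s..t, bm τ)) :=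
    Real.exp_le_exp.2 (neg_le_neg (mul_le_mul_of_nonneg_left hint hκ0))
  have hR : 0 ≤ R := (norm_nonneg _).trans hys
  have hNs : Nr s ≤ R ^ 2 + 2 * D + C := by
    have h1 := hD (w s).1 ((norm_ofInteraction_fst_le ω b e s (y s)).trans hys)
    have h2 : ‖y s‖ ^ 2 ≤ R ^ 2 := pow_le_pow_left₀ (norm_nonneg _) hys 2
    simp only [hN]
    linarith [neg_abs_le (Φ (w s).1)]
  have hNt : Nr t ≤ (R ^ 2 + 2 * D + C) * Real.exp (κ * I) := by
    have h0 : 0 ≤ Nr t := (mul_nonneg hθ1.le (sq_nonneg _)).trans (hNlow t)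
    have h1 : Nr t * Real.exp (-(κ * I)) ≤ R ^ 2 + 2 * D + C :=
      (mul_le_mul_of_nonneg_left hexp h0).trans (hle.trans hNs)
    rw [Real.exp_neg] at h1
    exact (mul_inv_le_iff₀ (Real.exp_pos _)).1 h1
  refine Real.le_sqrt_of_sq_le ?_
  rw [hA, le_div_iff₀ hθ1, mul_comm]
  exact (hNlow t).trans hNt

end Energy

/-! ### Poincaré inequality, process and bounds for the abstract wave equation. -/

section WaveProcess

variable {ι E F : Type*} [NormedAddCommGroup E] [InnerProductSpace ℝ E] [CompleteSpace E]
  [NormedAddCommGroup F] [InnerProductSpace ℝ F] [CompleteSpace F]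
  {J : E →L[ℝ] F} {g : E → F} {Φ : E → ℝ} {β : ℝ → ℝ}
  {ω : ι → ℝ} {b : HilbertBasis ι ℝ E} {e : HilbertBasis ι ℝ F}

/-- Parseval in both bases: the coefficients satisfy `⟨b k, u⟩² = ω k² ⟨e k, J u⟩²`. -/
theorem mul_norm_sq_le_of_le_singular_values
    (hJ' : ∀ k u, inner ℝ (b k) u = ω k * inner ℝ (e k) (J u)) {μ : ℝ}
    (hμ : ∀ k, μ ≤ ω k ^ 2) (u : E) : μ * ‖J u‖ ^ 2 ≤ ‖u‖ ^ 2 := by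
  have h1 := (e.hasSum_inner_mul_inner (J u) (J u)).mul_left μ
  have h2 := b.hasSum_inner_mul_inner u u
  rw [real_inner_self_eq_norm_sq] at h1 h2
  refine hasSum_le (fun k => ?_) h1 h2
  rw [real_inner_comm (b k), real_inner_comm (e k), hJ']
  nlinarith [mul_le_mul_of_nonneg_right (hμ k) (sq_nonneg (inner ℝ (e k) (J u)))]

theorem IsLocallyLipschitzField.exists_wave_process (hω : ∀ k, 0 < ω k)
    (hJ : ∀ k, J (b k) = (ω k)⁻¹ • e k)
    (hJ' : ∀ k u, inner ℝ (b k) u = ω k * inner ℝ (e k) (J u)) (hβ : Continuous β)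
    (hg : Continuous g) (hΨ : IsLocallyLipschitzField (waveField ω b e β g))
    (hb : HasBoundedTrajectories (waveField ω b e β g)) :
    ∃ S : ℝ → ℝ → E × F → E × F, IsProcess S ∧
      (∀ s c x, IsWaveSolution J β g (fun t => S t s x) s c) ∧
      ∀ s c w, IsWaveSolution J β g w s c → ∀ t ∈ Icc s c, w t = S t s (w s) := by
  obtain ⟨Y, hY, hYt, hYu⟩ := hΨ.exists_flow hb
  refine ⟨fun t s x => ofInteraction ω b e t (Y t s (toInteraction ω b e s x)), ⟨?_, ?_, ?_⟩,
    fun s c x => (hYt s c _).isWaveSolution hω hJ hJ' hβ hg, fun s c w hw t ht => ?_⟩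
  · intro t x
    rw [hY.self, ofInteraction_toInteraction]
  · intro t τ s hsτ hτt x
    rw [toInteraction_ofInteraction, ← hY.comp t τ s hsτ hτt]
  · have h1 : ContinuousOn (fun p : ℝ × ℝ × E × F => toInteraction ω b e p.2.1 p.2.2)
        {p | p.2.1 ≤ p.1} :=
      continuous_snd.fst.continuousOn.toInteraction ω b e continuous_snd.snd.continuousOn
    have h2 := hY.continuousOn.comp (continuous_fst.continuousOn.prodMk
      (continuous_snd.fst.continuousOn.prodMk h1)) (fun p hp => hp)
    exact continuous_fst.continuousOn.ofInteraction ω b e h2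
  · have := hYu s c (fun t => toInteraction ω b e t (w t)) (hw.isTrajectory hω hJ hJ' hΨ) t ht
    change w t = ofInteraction ω b e t (Y t s (toInteraction ω b e s (w s)))
    rw [← this, ofInteraction_toInteraction]

theorem HasBoundedTrajectories.bounded_waves (hω : ∀ k, 0 < ω k)
    (hJ : ∀ k, J (b k) = (ω k)⁻¹ • e k)
    (hJ' : ∀ k u, inner ℝ (b k) u = ω k * inner ℝ (e k) (J u))
    (hΨ : IsLocallyLipschitzField (waveField ω b e β g))
    (hb : HasBoundedTrajectories (waveField ω b e β g)) (R : ℝ) :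
    ∃ M : ℝ, ∀ s c w, IsWaveSolution J β g w s c →
      Real.sqrt (‖(w s).1‖ ^ 2 + ‖(w s).2‖ ^ 2) ≤ R →
      ∀ t ∈ Icc s c, Real.sqrt (‖(w t).1‖ ^ 2 + ‖(w t).2‖ ^ 2) ≤ M := by
  obtain ⟨M, hM⟩ := hb R
  refine ⟨M, fun s c w hw hR t ht => ?_⟩
  have hn : ∀ t, Real.sqrt (‖(w t).1‖ ^ 2 + ‖(w t).2‖ ^ 2) = ‖toInteraction ω b e t (w t)‖ :=
    fun t => by rw [← norm_sq_toInteraction ω b e t, Real.sqrt_sq (norm_nonneg _)]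
  rw [hn] at hR ⊢
  exact hM s c (fun t => toInteraction ω b e t (w t)) hR (hw.isTrajectory hω hJ hJ' hΨ) t ht

end WaveProcess

/-! ### Lipschitz functions with compact support. -/

section LipschitzCompactSupport

/-- A locally Lipschitz function with compact support is Lipschitz. -/
theorem LocallyLipschitz.exists_lipschitzWith_of_hasCompactSupport {G W : Type*}
    [NormedAddCommGroup G] [NormedSpace ℝ G] [ProperSpace G] [NormedAddCommGroup W] {f : G → W}
    (hf : LocallyLipschitz f) (hs : HasCompactSupport f) : ∃ C, LipschitzWith C f := by
  obtain ⟨R, hR⟩ := hs.isCompact.isBounded.subset_ball (0 : G)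
  set R' := max R 1
  have hR' : 0 < R' := lt_max_of_lt_right one_pos
  have hsub : tsupport f ⊆ Metric.ball 0 R' := hR.trans (Metric.ball_subset_ball (le_max_left _ _))
  have hz : ∀ x, R' ≤ ‖x‖ → f x = 0 := fun x hx => by
    by_contra h
    have := hsub (subset_tsupport f h)
    rw [mem_ball_zero_iff] at this
    linarith
  obtain ⟨C, hC⟩ := (hf.locallyLipschitzOn (s := Metric.closedBall 0 R')).exists_lipschitzOnWith_of_compact
    (isCompact_closedBall _ _)
  -- The retraction sends the exterior of the ball to its boundary sphere, where `f` vanishes too.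
  have hfr : f = f ∘ radialRetraction R' := by
    funext x
    rcases le_total ‖x‖ R' with h | h
    · rw [Function.comp_apply, radialRetraction_of_norm_le hR' h]
    · have : ‖radialRetraction R' x‖ = R' := by
        have hx : 0 < ‖x‖ := hR'.trans_le h
        rw [radialRetraction, norm_smul, max_eq_right h, norm_div, norm_norm,
          Real.norm_of_nonneg hR'.le, div_mul_cancel₀ _ hx.ne']
      rw [Function.comp_apply, hz x h, hz _ this.ge]
  refine ⟨C * 2, ?_⟩
  rw [hfr, ← lipschitzOnWith_univ]
  exact hC.comp (lipschitzWith_radialRetraction hR').lipschitzOnWith fun x _ => by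
    simpa using norm_radialRetraction_le hR' x

end LipschitzCompactSupport

/-! ### Formal adjoints, closability of the `X`-gradient and density of `H` in `L²`. -/

namespace XEllipticOperator

variable {N m : ℕ} (L : XEllipticOperator N m) {Ω : Set (Eucl N)}

theorem setIntegral_eq_integral_of_testFunction (φ : testFunctions Ω) (h : Eucl N → ℝ) :
    ∫ x in Ω, h x * (φ : Eucl N → ℝ) x = ∫ x, h x * (φ : Eucl N → ℝ) x := by
  refine setIntegral_eq_integral_of_forall_compl_eq_zero fun x hx => ?_
  rw [image_eq_zero_of_notMem_tsupport (fun hm => hx (φ.2.2.2 hm)), mul_zero]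

/-- The formal adjoint of `X_j` on test functions: the field being only Lipschitz, it is given by
almost everywhere derivatives. -/
theorem exists_formal_adjoint (hΩb : Bornology.IsBounded Ω) (j : Fin m) (ψ : testFunctions Ω) :
    ∃ h : Eucl N → ℝ, MemLp h 2 (volume.restrict Ω) ∧ ∀ φ : testFunctions Ω,
      ∫ x in Ω, L.Xgrad φ x j * (ψ : Eucl N → ℝ) x = ∫ x in Ω, h x * (φ : Eucl N → ℝ) x := by
  have : IsFiniteMeasure (volume.restrict Ω) := ⟨by
    rw [Measure.restrict_apply_univ]
    exact hΩb.measure_lt_top⟩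
  have hg : ∀ k : Fin N, ∃ C, LipschitzWith C fun x => L.X j x k * (ψ : Eucl N → ℝ) x := fun k => by
    have h1 : LocallyLipschitz fun x => L.X j x k :=
      (EuclideanSpace.proj k : Eucl N →L[ℝ] ℝ).lipschitz.locallyLipschitz.comp
        (L.locallyLipschitz_X j)
    have h2 : LocallyLipschitz fun p : ℝ × ℝ => p.1 * p.2 :=
      ContDiff.locallyLipschitz (𝕂 := ℝ) (contDiff_fst.mul contDiff_snd)
    refine LocallyLipschitz.exists_lipschitzWith_of_hasCompactSupport
      (h2.comp (h1.prodMk (ContDiff.locallyLipschitz (𝕂 := ℝ) ψ.2.1))) ?_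
    exact ψ.2.2.1.mul_left (f := fun x => L.X j x k)
  choose C hC using hg
  have hs : ∀ k : Fin N, HasCompactSupport fun x => L.X j x k * (ψ : Eucl N → ℝ) x := fun k =>
    ψ.2.2.1.mul_left (f := fun x => L.X j x k)
  -- Differentiating in the direction `-e_k` supplies the minus sign of the integration by parts.
  set d : Fin N → Eucl N → ℝ := fun k x =>
    lineDeriv ℝ (fun x => L.X j x k * (ψ : Eucl N → ℝ) x) x (-EuclideanSpace.single k 1) with hd
  have hdmem : ∀ k, MemLp (d k) 2 (volume.restrict Ω) := fun k =>
    ((hC k).memLp_lineDeriv _ (μ := volume.restrict Ω)).mono_exponent le_top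
  refine ⟨fun x => ∑ k, d k x, memLp_finsetSum _ fun k _ => hdmem k, fun φ => ?_⟩
  obtain ⟨D, hD⟩ := ContDiff.lipschitzWith_of_hasCompactSupport (𝕂 := ℝ) φ.2.2.1 φ.2.1 one_ne_zero
  have hpt : ∀ x, L.Xgrad φ x j * (ψ : Eucl N → ℝ) x
      = ∑ k, lineDeriv ℝ (φ : Eucl N → ℝ) x (EuclideanSpace.single k 1)
        * (L.X j x k * (ψ : Eucl N → ℝ) x) := fun x => by
    have h1 : L.X j x = ∑ k, L.X j x k • EuclideanSpace.single k (1 : ℝ) := by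
      ext i
      simp [Pi.single_apply]
    have h2 : L.Xgrad φ x j = fderiv ℝ (φ : Eucl N → ℝ) x (L.X j x) := rfl
    rw [h2, h1, map_sum, Finset.sum_mul]
    refine Finset.sum_congr rfl fun k _ => ?_
    rw [((φ.2.1.differentiable one_ne_zero) x).lineDeriv_eq_fderiv, map_smul, smul_eq_mul, ← h1]
    ring
  rw [setIntegral_eq_integral_of_testFunction ψ, setIntegral_eq_integral_of_testFunction φ]
  simp_rw [hpt, Finset.sum_mul]
  have hint : ∀ (k : Fin N) (f₁ f₂ : Eucl N → ℝ) {C₁ C₂ : ℝ≥0} (v : Eucl N),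
      LipschitzWith C₁ f₁ → LipschitzWith C₂ f₂ → HasCompactSupport f₂ →
      Integrable (fun x => lineDeriv ℝ f₁ x v * f₂ x) := by
    intro k f₁ f₂ C₁ C₂ v h1 h2 h3
    exact Integrable.bdd_mul (h2.continuous.integrable_of_hasCompactSupport h3)
      (h1.memLp_lineDeriv v (μ := volume)).1
      (.of_forall fun x => norm_lineDeriv_le_of_lipschitz ℝ h1)
  rw [integral_finsetSum _ fun k _ => hint k _ _ _ hD (hC k) (hs k),
    integral_finsetSum _ fun k _ => hint k _ _ _ (hC k) hD φ.2.2.1]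
  exact Finset.sum_congr rfl fun k _ => hD.integral_lineDeriv_mul_eq (hC k) (hs k) _

instance completeSpace_H : CompleteSpace (L.H Ω) :=
  (Submodule.isClosed_topologicalClosure _).completeSpace_coe

/-- The inclusion `H → L²(Ω)` as a continuous linear map. -/
def toL2L : L.H Ω →L[ℝ] L2 Ω :=
  (WithLp.fstL 2 ℝ (L2 Ω) (L2Vec Ω m)) ∘L (L.H Ω).subtypeL

/-- The `X`-gradient as a continuous linear map. -/
def gradL : L.H Ω →L[ℝ] L2Vec Ω m :=
  (WithLp.sndL 2 ℝ (L2 Ω) (L2Vec Ω m)) ∘L (L.H Ω).subtypeL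

theorem toL2L_apply (u : L.H Ω) : L.toL2L u = L.toL2 u := rfl

theorem gradL_apply (u : L.H Ω) : L.gradL u = L.grad u := rfl

/-- Test functions as elements of `H`. -/
def ofTest : testFunctions Ω →ₗ[ℝ] L.H Ω :=
  (L.graphMap Ω).codRestrict _ fun φ =>
    (Submodule.le_topologicalClosure _) (LinearMap.mem_range_self _ φ)

theorem toL2_ofTest (φ : testFunctions Ω) : L.toL2 (L.ofTest φ) = (memLp_testFunction φ).toLp _ :=
  rfl

theorem grad_ofTest (φ : testFunctions Ω) : L.grad (L.ofTest φ) = (L.memLp_Xgrad φ).toLp _ :=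
  rfl

theorem denseRange_ofTest : DenseRange (L.ofTest : testFunctions Ω → L.H Ω) := by
  intro u
  have hu : (u : WithLp 2 (L2 Ω × L2Vec Ω m)) ∈ closure (range (L.graphMap Ω)) := u.2
  rw [Topology.IsInducing.subtypeVal.closure_eq_preimage_closure_image]
  rw [← range_comp]
  exact hu

/-- A function in `L²(Ω)` orthogonal to all test functions vanishes. -/
theorem eq_zero_of_forall_integral_testFunction (hΩo : IsOpen Ω) {f : Eucl N → ℝ}
    (hf : MemLp f 2 (volume.restrict Ω))
    (h : ∀ ψ : testFunctions Ω, ∫ x in Ω, f x * (ψ : Eucl N → ℝ) x = 0) :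
    f =ᵐ[volume.restrict Ω] 0 := by
  have hloc : LocallyIntegrableOn f Ω volume := by
    intro x _
    obtain ⟨s, hs, hi⟩ := hf.locallyIntegrable one_le_two x
    refine ⟨s ∩ Ω, inter_mem (mem_nhdsWithin_of_mem_nhds hs) self_mem_nhdsWithin, ?_⟩
    rwa [IntegrableOn, Measure.restrict_restrict' hΩo.measurableSet] at hi
  rw [EventuallyEq, ae_restrict_iff' hΩo.measurableSet]
  refine hΩo.ae_eq_zero_of_integral_contDiff_smul_eq_zero hloc fun g hg hgc hgs => ?_
  have := h ⟨g, hg.of_le (by simp), hgc, hgs⟩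
  rw [setIntegral_eq_integral_of_testFunction] at this
  rw [← this]
  exact integral_congr_ae (.of_forall fun x => by simp [mul_comm])

/-- Elements of `H` are pairs, so a vanishing function must be shown to have vanishing gradient. The
formal adjoint identity extends from test functions to `H` by density; for `u = 0` it says that each
component of the gradient is orthogonal to all test functions. -/
theorem injective_toL2L (hΩo : IsOpen Ω) (hΩb : Bornology.IsBounded Ω) :
    Function.Injective (L.toL2L (Ω := Ω)) := by
  rw [injective_iff_map_eq_zero]
  intro u hu
  have hgrad : L.grad u = 0 := by
    rw [Lp.eq_zero_iff_ae_eq_zero]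
    have hj : ∀ j : Fin m, (fun x => L.grad u x j) =ᵐ[volume.restrict Ω] 0 := by
      intro j
      have hmem : ∀ v : L.H Ω, MemLp (fun x => L.grad v x j) 2 (volume.restrict Ω) := fun v =>
        (Lp.memLp (L.grad v)).continuousLinearMap_comp
          (EuclideanSpace.proj j : Eucl m →L[ℝ] ℝ)
      refine eq_zero_of_forall_integral_testFunction hΩo (hmem u) fun ψ => ?_
      obtain ⟨h, hh, hadj⟩ := L.exists_formal_adjoint hΩb j ψ
      have hψ := memLp_testFunction ψ
      let c := (EuclideanSpace.proj j : Eucl m →L[ℝ] ℝ)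
      have h1 : ∀ v : L.H Ω, ∫ x in Ω, L.grad v x j * (ψ : Eucl N → ℝ) x
          = inner ℝ (hψ.toLp _) ((c.compLpL 2 (volume.restrict Ω)) (L.gradL v)) := fun v => by
        rw [MeasureTheory.L2.inner_def]
        refine integral_congr_ae ?_
        filter_upwards [hψ.coeFn_toLp, c.coeFn_compLpL (L.gradL v)] with x hx1 hx2
        rw [hx1, hx2]
        rfl
      have h2 : ∀ v : L.H Ω, ∫ x in Ω, h x * L.toL2 v x = inner ℝ (hh.toLp _) (L.toL2L v) := fun v => by
        rw [MeasureTheory.L2.inner_def]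
        refine integral_congr_ae ?_
        filter_upwards [hh.coeFn_toLp] with x hx1
        rw [hx1, toL2L_apply]
        simp [mul_comm]
      have h3 : ∀ v : L.H Ω, ∫ x in Ω, L.grad v x j * (ψ : Eucl N → ℝ) x
          = ∫ x in Ω, h x * L.toL2 v x := by
        intro v
        refine L.denseRange_ofTest.induction_on v ?_ fun φ => ?_
        · simp_rw [h1, h2]
          exact isClosed_eq (by fun_prop) (by fun_prop)
        · have e1 : ∫ x in Ω, L.grad (L.ofTest φ) x j * (ψ : Eucl N → ℝ) x
              = ∫ x in Ω, L.Xgrad φ x j * (ψ : Eucl N → ℝ) x := by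
            refine integral_congr_ae ?_
            filter_upwards [(L.memLp_Xgrad φ).coeFn_toLp] with x hx
            rw [grad_ofTest, hx]
          have e2 : ∫ x in Ω, h x * L.toL2 (L.ofTest φ) x
              = ∫ x in Ω, h x * (φ : Eucl N → ℝ) x := by
            refine integral_congr_ae ?_
            filter_upwards [(memLp_testFunction φ).coeFn_toLp] with x hx
            rw [toL2_ofTest, hx]
          rw [e1, e2, hadj]
      rw [h3, h2, hu, inner_zero_right]
    filter_upwards [ae_all_iff.2 hj] with x hx
    ext j
    exact hx j
  refine Subtype.ext ?_
  refine (WithLp.equiv 2 _).injective (Prod.ext ?_ ?_)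
  · exact hu
  · exact hgrad

theorem denseRange_toL2L (hΩo : IsOpen Ω) : DenseRange (L.toL2L (Ω := Ω)) := by
  have hbot : (LinearMap.range (L.toL2L (Ω := Ω) : L.H Ω →ₗ[ℝ] L2 Ω))ᗮ = ⊥ := by
    rw [eq_bot_iff]
    intro f hf
    rw [Submodule.mem_orthogonal] at hf
    refine (Submodule.mem_bot ℝ).2 ((Lp.eq_zero_iff_ae_eq_zero).2
      (eq_zero_of_forall_integral_testFunction hΩo (Lp.memLp f) fun ψ => ?_))
    have := hf (L.toL2L (L.ofTest ψ)) ⟨_, rfl⟩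
    rw [← this, MeasureTheory.L2.inner_def]
    refine integral_congr_ae ?_
    filter_upwards [(memLp_testFunction ψ).coeFn_toLp] with x hx
    rw [toL2L_apply, toL2_ofTest, hx]
    rfl
  have := (Submodule.topologicalClosure_eq_top_iff
    (K := LinearMap.range (L.toL2L (Ω := Ω) : L.H Ω →ₗ[ℝ] L2 Ω))).2 hbot
  exact Submodule.dense_iff_topologicalClosure_eq_top.2 this

end XEllipticOperator

/-! ### Cauchy–Schwarz in `L²` and extension of bilinear forms by density. -/

section Auxiliary

theorem MeasureTheory.MemLp.integrable_norm_mul_norm {α : Type*} [MeasurableSpace α] {μ : Measure α}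
    {G G' : Type*} [NormedAddCommGroup G] [NormedAddCommGroup G'] {f : α → G} {g : α → G'}
    (hf : MemLp f 2 μ) (hg : MemLp g 2 μ) : Integrable (fun x => ‖f x‖ * ‖g x‖) μ :=
  hf.norm.integrable_mul hg.norm

theorem MeasureTheory.MemLp.integral_norm_mul_norm_le {α : Type*} [MeasurableSpace α]
    {μ : Measure α} {G G' : Type*} [NormedAddCommGroup G] [NormedAddCommGroup G'] {f : α → G}
    {g : α → G'} (hf : MemLp f 2 μ) (hg : MemLp g 2 μ) :
    ∫ x, ‖f x‖ * ‖g x‖ ∂μ ≤ (eLpNorm f 2 μ).toReal * (eLpNorm g 2 μ).toReal := by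
  have h1 : ∫ x, ‖f x‖ * ‖g x‖ ∂μ = inner ℝ (hg.norm.toLp _) (hf.norm.toLp _) := by
    rw [MeasureTheory.L2.inner_def]
    refine integral_congr_ae ?_
    filter_upwards [hf.norm.coeFn_toLp, hg.norm.coeFn_toLp] with x hx1 hx2
    rw [hx1, hx2]
    simp
  rw [h1]
  refine (real_inner_le_norm _ _).trans (le_of_eq ?_)
  rw [Lp.norm_toLp, Lp.norm_toLp, eLpNorm_norm, eLpNorm_norm, mul_comm]

/-- Extension by density of a bounded bilinear form. -/
theorem exists_bilinear_extension {D G : Type*} [AddCommGroup D] [Module ℝ D]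
    [NormedAddCommGroup G] [NormedSpace ℝ G] (q : D →ₗ[ℝ] D →ₗ[ℝ] ℝ) (i : D →ₗ[ℝ] G)
    (hi : DenseRange i) (C : ℝ) (hq : ∀ x y, |q x y| ≤ C * ‖i x‖ * ‖i y‖) :
    ∃ B : G →L[ℝ] G →L[ℝ] ℝ, ∀ x y, B (i x) (i y) = q x y := by
  have hb : ∀ x, ∃ C', ∀ y, ‖q x y‖ ≤ C' * ‖i y‖ := fun x => ⟨C * ‖i x‖, hq x⟩
  have hext : ∀ S T : G →L[ℝ] ℝ, (∀ y, S (i y) = T (i y)) → S = T := fun S T h =>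
    ContinuousLinearMap.ext fun z =>
      hi.induction_on z (isClosed_eq S.continuous T.continuous) h
  let q' : D →ₗ[ℝ] G →L[ℝ] ℝ :=
    { toFun := fun x => (q x).extendOfNorm i
      map_add' := fun x x' => hext _ _ fun y => by
        rw [add_apply, LinearMap.extendOfNorm_eq hi (hb _),
          LinearMap.extendOfNorm_eq hi (hb _), LinearMap.extendOfNorm_eq hi (hb _), map_add,
          LinearMap.add_apply]
      map_smul' := fun c x => hext _ _ fun y => by
        rw [RingHom.id_apply, smul_apply, LinearMap.extendOfNorm_eq hi (hb _),
          LinearMap.extendOfNorm_eq hi (hb _), map_smul, LinearMap.smul_apply] }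
  have hb' : ∀ x, ‖q' x‖ ≤ |C| * ‖i x‖ := fun x =>
    LinearMap.opNorm_extendOfNorm_le hi (by positivity) fun y => (hq x y).trans (by
      gcongr
      exact le_abs_self C)
  refine ⟨q'.extendOfNorm i, fun x y => ?_⟩
  rw [LinearMap.extendOfNorm_eq hi ⟨_, hb'⟩]
  exact LinearMap.extendOfNorm_eq hi (hb x) y

end Auxiliary

/-! ### The form `a` on `H`. -/

namespace XEllipticOperator

variable {N m : ℕ} (L : XEllipticOperator N m) {Ω : Set (Eucl N)}

/-- The vector of the partial derivatives. -/
def partials (φ : Eucl N → ℝ) (x : Eucl N) : Fin N → ℝ :=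
  fun j => fderiv ℝ φ x (EuclideanSpace.single j 1)

theorem sum_inner_sq_partials (φ : Eucl N → ℝ) (x : Eucl N) :
    ∑ j, (inner ℝ (L.X j x) (WithLp.toLp 2 (partials φ x) : Eucl N)) ^ 2 = ‖L.Xgrad φ x‖ ^ 2 := by
  rw [EuclideanSpace.real_norm_sq_eq]
  refine Finset.sum_congr rfl fun j _ => ?_
  congr 1
  have h1 : L.X j x = ∑ k, L.X j x k • EuclideanSpace.single k (1 : ℝ) := by
    ext i
    simp [Pi.single_apply]
  have h2 : L.Xgrad φ x j = fderiv ℝ φ x (L.X j x) := rfl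
  rw [h2]
  conv_rhs => rw [h1, map_sum]
  rw [PiLp.inner_apply]
  refine Finset.sum_congr rfl fun k _ => ?_
  simp [partials, mul_comm]

/-- The integrand of `testForm` is the value of the coefficient matrix. -/
theorem integrand_eq_toBilin' (φ ψ : Eucl N → ℝ) (x : Eucl N) :
    ∑ i, ∑ j, L.a x i j * fderiv ℝ φ x (EuclideanSpace.single j 1) *
      fderiv ℝ ψ x (EuclideanSpace.single i 1)
      = Matrix.toBilin' (L.a x) (partials ψ x) (partials φ x) := by
  rw [Matrix.toBilin'_apply]
  refine Finset.sum_congr rfl fun i _ => Finset.sum_congr rfl fun j _ => ?_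
  simp only [partials]
  ring

/-- Ellipticity controls only the diagonal. The mixed bound follows from the Cauchy–Schwarz
inequality for the positive semidefinite symmetric matrix at each point. -/
theorem exists_ellipticity_bounds : ∃ C : ℝ, 0 < C ∧ ∀ φ ψ : Eucl N → ℝ, ∀ x,
    1 / C * ‖L.Xgrad φ x‖ ^ 2 ≤ Matrix.toBilin' (L.a x) (partials φ x) (partials φ x) ∧
    |Matrix.toBilin' (L.a x) (partials ψ x) (partials φ x)|
      ≤ C * (‖L.Xgrad φ x‖ * ‖L.Xgrad ψ x‖) := by
  obtain ⟨C, hC, hell⟩ := L.elliptic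
  have hB : ∀ (x : Eucl N) (ξ : Fin N → ℝ), Matrix.toBilin' (L.a x) ξ ξ
      = ∑ i, ∑ j, L.a x i j * ξ i * ξ j := fun x ξ => by
    rw [Matrix.toBilin'_apply]
    refine Finset.sum_congr rfl fun i _ => Finset.sum_congr rfl fun j _ => ?_
    ring
  have hlow : ∀ (x : Eucl N) (ξ : Fin N → ℝ),
      1 / C * ∑ j, (inner ℝ (L.X j x) (WithLp.toLp 2 ξ : Eucl N)) ^ 2
        ≤ Matrix.toBilin' (L.a x) ξ ξ := fun x ξ => by
    rw [hB]
    exact (hell x (WithLp.toLp 2 ξ)).1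
  have hup : ∀ (φ : Eucl N → ℝ) (x : Eucl N),
      Matrix.toBilin' (L.a x) (partials φ x) (partials φ x) ≤ C * ‖L.Xgrad φ x‖ ^ 2 := fun φ x => by
    rw [hB, ← sum_inner_sq_partials]
    exact (hell x (WithLp.toLp 2 (partials φ x))).2
  have hpos : ∀ (x : Eucl N) (ξ : Fin N → ℝ), 0 ≤ Matrix.toBilin' (L.a x) ξ ξ := fun x ξ =>
    le_trans (mul_nonneg (by positivity) (Finset.sum_nonneg fun j _ => sq_nonneg _)) (hlow x ξ)
  refine ⟨C, hC, fun φ ψ x => ⟨?_, ?_⟩⟩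
  · rw [← sum_inner_sq_partials]
    exact hlow x _
  · have hsymm : LinearMap.IsSymm (Matrix.toBilin' (L.a x)) := ⟨fun ξ η => by
      rw [RingHom.id_apply]
      rw [Matrix.toBilin'_apply, Matrix.toBilin'_apply, Finset.sum_comm]
      refine Finset.sum_congr rfl fun i _ => Finset.sum_congr rfl fun j _ => ?_
      rw [L.symm_a x i j]
      ring⟩
    have h := LinearMap.BilinForm.apply_sq_le_of_symm _ (hpos x) hsymm (partials ψ x) (partials φ x)
    refine abs_le_of_sq_le_sq (h.trans ?_) (by positivity)
    calc _ ≤ (C * ‖L.Xgrad ψ x‖ ^ 2) * (C * ‖L.Xgrad φ x‖ ^ 2) :=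
          mul_le_mul (hup ψ x) (hup φ x) (hpos x _) (by positivity)
      _ = _ := by ring

theorem integrable_testForm (φ ψ : testFunctions Ω) :
    Integrable (fun x => Matrix.toBilin' (L.a x) (partials ψ x) (partials φ x))
      (volume.restrict Ω) := by
  obtain ⟨C, hC, hell⟩ := L.exists_ellipticity_bounds
  refine (((L.memLp_Xgrad φ).integrable_norm_mul_norm (L.memLp_Xgrad ψ)).const_mul C).mono' ?_
    (.of_forall fun x => (hell φ ψ x).2)
  simp_rw [Matrix.toBilin'_apply]
  refine AEMeasurable.aestronglyMeasurable ?_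
  refine Finset.aemeasurable_fun_sum _ fun i _ => Finset.aemeasurable_fun_sum _ fun j _ => ?_
  exact (((measurable_fderiv_apply_const ℝ _ _).aemeasurable).mul
    ((L.aemeasurable_a i j).mono_measure Measure.restrict_le_self)).mul
    ((measurable_fderiv_apply_const ℝ _ _).aemeasurable)

theorem testForm_eq (φ ψ : Eucl N → ℝ) : L.testForm Ω φ ψ
    = ∫ x in Ω, Matrix.toBilin' (L.a x) (partials ψ x) (partials φ x) := by
  simp_rw [testForm, integrand_eq_toBilin']

theorem partials_add (φ ψ : testFunctions Ω) (x : Eucl N) :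
    partials ((φ + ψ : testFunctions Ω) : Eucl N → ℝ) x = partials φ x + partials ψ x := by
  funext j
  have h1 := (φ.2.1.differentiable one_ne_zero) x
  have h2 := (ψ.2.1.differentiable one_ne_zero) x
  simp [partials, fderiv_add h1 h2]

theorem partials_smul (c : ℝ) (φ : testFunctions Ω) (x : Eucl N) :
    partials ((c • φ : testFunctions Ω) : Eucl N → ℝ) x = c • partials φ x := by
  funext j
  have h1 := (φ.2.1.differentiable one_ne_zero) x
  simp [partials, fderiv_const_smul h1 c]

variable (Ω) in
/-- `testForm` as a bilinear map. -/
def testBilin : testFunctions Ω →ₗ[ℝ] testFunctions Ω →ₗ[ℝ] ℝ :=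
  LinearMap.mk₂ ℝ (fun φ ψ => L.testForm Ω φ ψ)
    (fun φ φ' ψ => by
      simp_rw [testForm_eq, partials_add, map_add]
      exact integral_add (L.integrable_testForm φ ψ) (L.integrable_testForm φ' ψ))
    (fun c φ ψ => by
      simp_rw [testForm_eq, partials_smul, map_smul, smul_eq_mul]
      exact integral_const_mul _ _)
    (fun φ ψ ψ' => by
      simp_rw [testForm_eq, partials_add, map_add, LinearMap.add_apply]
      exact integral_add (L.integrable_testForm φ ψ) (L.integrable_testForm φ ψ'))
    (fun c φ ψ => by
      simp_rw [testForm_eq, partials_smul, map_smul, LinearMap.smul_apply, smul_eq_mul]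
      exact integral_const_mul _ _)

theorem norm_ofTest_grad_le (φ : testFunctions Ω) :
    (eLpNorm (L.Xgrad φ) 2 (volume.restrict Ω)).toReal ≤ ‖L.ofTest φ‖ := by
  rw [← Lp.norm_toLp _ (L.memLp_Xgrad φ), ← grad_ofTest, ← gradL_apply]
  have h := WithLp.prod_norm_sq_eq_of_L2 (L.ofTest φ : WithLp 2 (L2 Ω × L2Vec Ω m))
  refine abs_le_of_sq_le_sq' ?_ (norm_nonneg _) |>.2
  rw [Submodule.coe_norm, h]
  exact le_add_of_nonneg_left (sq_nonneg _)

/-- The form `a` is a bounded symmetric bilinear form on `H` which controls the `X`-gradient. -/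
theorem exists_bilin_eq_form : ∃ B : L.H Ω →L[ℝ] L.H Ω →L[ℝ] ℝ, (∀ u v, L.form u v = B u v) ∧
    (∀ u v, B u v = B v u) ∧ ∃ C : ℝ, 0 < C ∧ ∀ u, 1 / C * ‖L.grad u‖ ^ 2 ≤ B u u := by
  obtain ⟨C, hC, hell⟩ := L.exists_ellipticity_bounds
  obtain ⟨B, hB⟩ := exists_bilinear_extension (L.testBilin Ω) L.ofTest L.denseRange_ofTest C (by
    intro φ ψ
    change |L.testForm Ω φ ψ| ≤ _
    rw [testForm_eq]
    calc _ ≤ ∫ x in Ω, C * (‖L.Xgrad φ x‖ * ‖L.Xgrad ψ x‖) := by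
          refine (abs_integral_le_integral_abs).trans ?_
          exact integral_mono (L.integrable_testForm φ ψ).abs
            (((L.memLp_Xgrad φ).integrable_norm_mul_norm (L.memLp_Xgrad ψ)).const_mul C)
            fun x => (hell φ ψ x).2
      _ = C * ∫ x in Ω, ‖L.Xgrad φ x‖ * ‖L.Xgrad ψ x‖ := integral_const_mul _ _
      _ ≤ C * (‖L.ofTest φ‖ * ‖L.ofTest ψ‖) := by
          refine mul_le_mul_of_nonneg_left (((L.memLp_Xgrad φ).integral_norm_mul_norm_le
            (L.memLp_Xgrad ψ)).trans ?_) hC.le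
          exact mul_le_mul (L.norm_ofTest_grad_le φ) (L.norm_ofTest_grad_le ψ)
            ENNReal.toReal_nonneg (norm_nonneg _)
      _ = _ := by ring)
  refine ⟨B, fun u v => ?_, fun u v => ?_, C, hC, fun u => ?_⟩
  -- Nontriviality of the filter, which is density of the test functions in `H`, makes the limit
  -- defining the form unique.
  · have hne : (comap (fun p : testFunctions Ω × testFunctions Ω =>
        (L.graphMap Ω p.1, L.graphMap Ω p.2))
        (𝓝 ((u : WithLp 2 (L2 Ω × L2Vec Ω m)), (v : WithLp 2 (L2 Ω × L2Vec Ω m))))).NeBot := by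
      rw [comap_neBot_iff]
      intro s hs
      have hmem : ((u : WithLp 2 (L2 Ω × L2Vec Ω m)), (v : WithLp 2 (L2 Ω × L2Vec Ω m)))
          ∈ closure ((range (L.graphMap Ω)) ×ˢ (range (L.graphMap Ω))) := by
        rw [closure_prod_eq]
        exact ⟨u.2, v.2⟩
      obtain ⟨⟨_, _⟩, hp, ⟨φ, rfl⟩, ⟨ψ, rfl⟩⟩ := mem_closure_iff_nhds.1 hmem s hs
      exact ⟨(φ, ψ), hp⟩
    refine Tendsto.limUnder_eq ?_
    have h1 := (continuous_fst.tendsto _).comp (tendsto_comap (f := fun p : testFunctions Ω ×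
        testFunctions Ω => (L.graphMap Ω p.1, L.graphMap Ω p.2))
        (x := 𝓝 ((u : WithLp 2 (L2 Ω × L2Vec Ω m)), (v : WithLp 2 (L2 Ω × L2Vec Ω m)))))
    have h2 := (continuous_snd.tendsto _).comp (tendsto_comap (f := fun p : testFunctions Ω ×
        testFunctions Ω => (L.graphMap Ω p.1, L.graphMap Ω p.2))
        (x := 𝓝 ((u : WithLp 2 (L2 Ω × L2Vec Ω m)), (v : WithLp 2 (L2 Ω × L2Vec Ω m)))))
    have h1' : Tendsto (fun p : testFunctions Ω × testFunctions Ω => L.ofTest p.1)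
        (comap (fun p : testFunctions Ω × testFunctions Ω => (L.graphMap Ω p.1, L.graphMap Ω p.2))
          (𝓝 ((u : WithLp 2 (L2 Ω × L2Vec Ω m)), (v : WithLp 2 (L2 Ω × L2Vec Ω m))))) (𝓝 u) :=
      tendsto_subtype_rng.2 h1
    have h2' : Tendsto (fun p : testFunctions Ω × testFunctions Ω => L.ofTest p.2)
        (comap (fun p : testFunctions Ω × testFunctions Ω => (L.graphMap Ω p.1, L.graphMap Ω p.2))
          (𝓝 ((u : WithLp 2 (L2 Ω × L2Vec Ω m)), (v : WithLp 2 (L2 Ω × L2Vec Ω m))))) (𝓝 v) :=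
      tendsto_subtype_rng.2 h2
    have h3 := (((B.continuous.comp continuous_fst).clm_apply continuous_snd).tendsto (u, v)).comp
      (h1'.prodMk_nhds h2')
    refine h3.congr fun p => ?_
    exact hB p.1 p.2
  · refine L.denseRange_ofTest.induction_on₂ (p := fun u v => B u v = B v u) ?_ ?_ u v
    · exact isClosed_eq ((B.continuous.comp continuous_fst).clm_apply continuous_snd)
        ((B.continuous.comp continuous_snd).clm_apply continuous_fst)
    · intro φ ψ
      rw [hB, hB]
      change L.testForm Ω φ ψ = L.testForm Ω ψ φ
      rw [testForm, testForm]
      congr 1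
      funext x
      rw [Finset.sum_comm]
      refine Finset.sum_congr rfl fun i _ => Finset.sum_congr rfl fun j _ => ?_
      rw [L.symm_a x i j]
      ring
  · refine L.denseRange_ofTest.induction_on u ?_ fun φ => ?_
    · exact isClosed_le (continuous_const.mul (L.gradL.continuous.norm.pow 2))
        (B.continuous.clm_apply continuous_id)
    · rw [hB]
      change _ ≤ L.testForm Ω φ φ
      have hn : ‖L.grad (L.ofTest φ)‖ ^ 2 = ∫ x in Ω, ‖L.Xgrad φ x‖ ^ 2 := by
        rw [← real_inner_self_eq_norm_sq, MeasureTheory.L2.inner_def]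
        refine integral_congr_ae ?_
        filter_upwards [(L.memLp_Xgrad φ).coeFn_toLp] with x hx
        rw [grad_ofTest, hx, real_inner_self_eq_norm_sq]
      rw [hn, testForm_eq, ← integral_const_mul]
      refine integral_mono ?_ (L.integrable_testForm φ φ) fun x => (hell φ φ x).1
      have := (L.memLp_Xgrad φ).integrable_norm_mul_norm (L.memLp_Xgrad φ)
      simp_rw [← sq] at this
      exact this.const_mul _

end XEllipticOperator

/-! ### Superposition operators and potential energy under the growth condition. -/

section Nemytskii

/-- The bound for the increment of a function of polynomial growth. -/
def growthIncrement (σ a b : ℝ) : ℝ := |a - b| * (3 + |a| ^ σ + |b| ^ σ)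

theorem growthIncrement_nonneg (σ a b : ℝ) : 0 ≤ growthIncrement σ a b := by
  unfold growthIncrement
  positivity

/-- Allows passing to the critical exponent: `t ^ ρ ≤ 1 + t ^ σ` is used twice, which turns `1` into
`3`. -/
theorem one_add_rpow_le {ρ σ : ℝ} (hρ : 0 < ρ) (hρσ : ρ ≤ σ) (a b : ℝ) :
    1 + |a| ^ ρ + |b| ^ ρ ≤ 3 + |a| ^ σ + |b| ^ σ := by
  have h : ∀ a : ℝ, |a| ^ ρ ≤ 1 + |a| ^ σ := by
    intro a
    have h0 : 0 ≤ |a| ^ σ := by positivity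
    rcases le_total |a| 1 with h | h
    · linarith [Real.rpow_le_one (abs_nonneg a) h hρ.le]
    · linarith [Real.rpow_le_rpow_of_exponent_le h hρσ]
  linarith [h a, h b]

variable {α : Type*} [MeasurableSpace α] {μ : Measure α} {σ : ℝ}

/-- Hölder with `1/2 = 1/(2σ+2) + σ/(2σ+2)`. The norm of `|a| ^ σ` with exponent `(2σ+2)/σ` is the
`σ`-th power of the norm of `a` with exponent `2σ+2`. -/
theorem eLpNorm_growthIncrement_le (hσ : 0 < σ) {a b : α → ℝ} (ha : AEStronglyMeasurable a μ)
    (hb : AEStronglyMeasurable b μ) :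
    eLpNorm (fun x => growthIncrement σ (a x) (b x)) 2 μ
      ≤ eLpNorm (fun x => a x - b x) (ENNReal.ofReal (2 * σ + 2)) μ *
        (eLpNorm (fun _ : α => (3 : ℝ)) (ENNReal.ofReal ((2 * σ + 2) / σ)) μ
          + eLpNorm a (ENNReal.ofReal (2 * σ + 2)) μ ^ σ
          + eLpNorm b (ENNReal.ofReal (2 * σ + 2)) μ ^ σ) := by
  have hq : 0 < 2 * σ + 2 := by linarith
  have hr : 0 < (2 * σ + 2) / σ := by positivity
  have hT : ENNReal.HolderTriple (ENNReal.ofReal (2 * σ + 2)) (ENNReal.ofReal ((2 * σ + 2) / σ)) 2 :=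
    ⟨by
      rw [← ENNReal.ofReal_inv_of_pos hq, ← ENNReal.ofReal_inv_of_pos hr,
        ← ENNReal.ofReal_add (by positivity) (by positivity), ← ENNReal.ofReal_ofNat 2,
        ← ENNReal.ofReal_inv_of_pos two_pos]
      congr 1
      field_simp
      ring⟩
  have hr1 : 1 ≤ ENNReal.ofReal ((2 * σ + 2) / σ) := by
    rw [ENNReal.one_le_ofReal, one_le_div hσ]
    linarith
  have hpow : ∀ {d : α → ℝ}, AEStronglyMeasurable d μ →
      AEStronglyMeasurable (fun x => ‖d x‖ ^ σ) μ := fun hd =>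
    (Real.continuous_rpow_const hσ.le).comp_aestronglyMeasurable hd.norm
  have hnorm : ∀ d : α → ℝ, eLpNorm (fun x => ‖d x‖ ^ σ) (ENNReal.ofReal ((2 * σ + 2) / σ)) μ
      = eLpNorm d (ENNReal.ofReal (2 * σ + 2)) μ ^ σ := fun d => by
    rw [eLpNorm_norm_rpow _ hσ, ← ENNReal.ofReal_mul hr.le, div_mul_cancel₀ _ hσ.ne']
  have h1 := eLpNorm_smul_le_mul_eLpNorm (μ := μ) (r := 2)
    (f := fun x => 3 + ‖a x‖ ^ σ + ‖b x‖ ^ σ) (φ := fun x => a x - b x)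
    ((aestronglyMeasurable_const.add (hpow ha)).add (hpow hb)) (ha.sub hb) (hpqr := hT)
  have h2 : eLpNorm (fun x => growthIncrement σ (a x) (b x)) 2 μ
      = eLpNorm ((fun x => a x - b x) • fun x => 3 + ‖a x‖ ^ σ + ‖b x‖ ^ σ) 2 μ := by
    refine eLpNorm_congr_norm_ae (.of_forall fun x => ?_)
    simp only [growthIncrement, Pi.smul_apply', smul_eq_mul, norm_mul, Real.norm_eq_abs, abs_abs]
  rw [h2]
  refine h1.trans (mul_le_mul_right ?_ _)
  rw [← hnorm a, ← hnorm b]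
  exact (eLpNorm_add_le (aestronglyMeasurable_const.add (hpow ha)) (hpow hb) hr1).trans
    (add_le_add_left (eLpNorm_add_le aestronglyMeasurable_const (hpow ha) hr1) _)

variable {f : ℝ → ℝ} {c : ℝ}

theorem continuous_of_growth (hσ : 0 < σ) (hf : ∀ a b, |f a - f b| ≤ c * growthIncrement σ a b) :
    Continuous f := by
  rw [continuous_iff_continuousAt]
  intro b
  rw [ContinuousAt, tendsto_iff_norm_sub_tendsto_zero]
  refine squeeze_zero (fun _ => norm_nonneg _) (fun a => hf a b) ?_
  have : Continuous fun a => c * growthIncrement σ a b := by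
    unfold growthIncrement
    have := (Real.continuous_rpow_const hσ.le).comp continuous_abs
    simp only [Function.comp_def] at this
    fun_prop
  simpa [growthIncrement] using this.tendsto b

/-- The primitive of `f` vanishing at `0`. -/
def primitive (f : ℝ → ℝ) (a : ℝ) : ℝ := ∫ τ in (0 : ℝ)..a, f τ

theorem hasDerivAt_primitive (hf : Continuous f) (a : ℝ) : HasDerivAt (primitive f) (f a) a :=
  (hf.integral_hasStrictDerivAt 0 a).hasDerivAt

/-- The Taylor remainder is the integral of `f τ - f a`. For `τ` between `a` and `b` one has `|τ| ^
σ ≤ |a| ^ σ + |b| ^ σ`, which costs the factor `2`. -/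
theorem abs_primitive_sub_le (hσ : 0 < σ) (hc : 0 ≤ c)
    (hf : ∀ a b, |f a - f b| ≤ c * growthIncrement σ a b) (a b : ℝ) :
    |primitive f b - primitive f a - f a * (b - a)|
      ≤ 2 * c * (|b - a| * growthIncrement σ b a) := by
  have hfc := continuous_of_growth hσ hf
  have h1 : primitive f b - primitive f a - f a * (b - a) = ∫ τ in a..b, (f τ - f a) := by
    rw [intervalIntegral.integral_sub (hfc.intervalIntegrable _ _) (by simp),
      primitive, primitive, intervalIntegral.integral_interval_sub_left
        (hfc.intervalIntegrable _ _) (hfc.intervalIntegrable _ _), intervalIntegral.integral_const,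
      smul_eq_mul, mul_comm (f a)]
  rw [h1, ← Real.norm_eq_abs]
  refine (intervalIntegral.norm_integral_le_of_norm_le_const
    (C := 2 * c * growthIncrement σ b a) fun τ hτ => ?_).trans (le_of_eq (by ring))
  have hτ' := uIoc_subset_uIcc hτ
  have hτa : |τ - a| ≤ |b - a| := by
    rcases mem_uIcc.1 hτ' with h | h
    · rw [abs_of_nonneg (by linarith), abs_of_nonneg (by linarith)]; linarith
    · rw [abs_of_nonpos (by linarith), abs_of_nonpos (by linarith)]; linarith
  have hτm : |τ| ^ σ ≤ |a| ^ σ + |b| ^ σ := by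
    have : |τ| ≤ max |a| |b| := by
      rcases mem_uIcc.1 hτ' with h | h
      · exact abs_le_max_abs_abs h.1 h.2
      · rw [max_comm]; exact abs_le_max_abs_abs h.1 h.2
    rcases le_max_iff.1 this with h | h
    · exact (Real.rpow_le_rpow (abs_nonneg _) h hσ.le).trans (le_add_of_nonneg_right (by positivity))
    · exact (Real.rpow_le_rpow (abs_nonneg _) h hσ.le).trans (le_add_of_nonneg_left (by positivity))
  have ha0 : 0 ≤ |a| ^ σ := by positivity
  have hb0 : 0 ≤ |b| ^ σ := by positivity
  calc ‖f τ - f a‖ ≤ c * (|τ - a| * (3 + |τ| ^ σ + |a| ^ σ)) := hf τ a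
    _ ≤ c * (|b - a| * (2 * (3 + |b| ^ σ + |a| ^ σ))) := by
      refine mul_le_mul_of_nonneg_left (mul_le_mul hτa ?_ (by positivity) (by positivity)) hc
      linarith
    _ = _ := by unfold growthIncrement; ring

/-- A function of growth below `μ₁ a` has a primitive below `ν a² / 2`, up to a constant. -/
theorem exists_primitive_le (hf : Continuous f) {μ₁ : ℝ}
    (hsign : limsup (fun u : ℝ => ((f u / u : ℝ) : EReal)) (comap (fun u : ℝ => |u|) atTop)
      < (μ₁ : EReal)) :
    ∃ ν < μ₁, ∃ C, ∀ a, 2 * primitive f a ≤ ν * a ^ 2 + C := by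
  -- A real number strictly between the limsup and `μ₁` serves as `ν`.
  obtain ⟨y, hy1, hy2⟩ := EReal.lt_iff_exists_real_btwn.1 hsign
  have hev := eventually_lt_of_limsup_lt hy1
  rw [eventually_comap, eventually_atTop] at hev
  obtain ⟨r₀, hr₀⟩ := hev
  set r := max r₀ 1
  have hr1 : 1 ≤ r := le_max_right _ _
  have hfy : ∀ u, r ≤ |u| → f u / u ≤ y := fun u hu => by
    have := hr₀ |u| ((le_max_left _ _).trans hu) u rfl
    exact (EReal.coe_lt_coe_iff.1 this).le
  -- Beyond `|a| = r` this function decreases away from the origin, so a bound on `[-r, r]` is a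
  -- global upper bound.
  set G := fun a => 2 * primitive f a - y * a ^ 2 with hG
  have hGd : ∀ a, HasDerivAt G (2 * f a - y * (2 * a)) a := fun a => by
    refine (((hasDerivAt_primitive hf a).const_mul 2).sub
      ((hasDerivAt_pow 2 a).const_mul y)).congr_deriv ?_
    simp
  have hGc : Continuous G := continuous_iff_continuousAt.2 fun a => (hGd a).continuousAt
  obtain ⟨C, hC⟩ := isCompact_Icc.exists_bound_of_continuousOn hGc.continuousOn (s := Icc (-r) r)
  have hin : ∀ a, |a| ≤ r → G a ≤ C := fun a ha =>
    (le_abs_self _).trans (hC a (abs_le.1 ha))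
  refine ⟨y, EReal.coe_lt_coe_iff.1 hy2, C, fun a => ?_⟩
  suffices h : G a ≤ C by simp only [hG] at h; linarith
  rcases le_total |a| r with h | h
  · exact hin a h
  rcases le_abs'.1 h with h | h
  · have hmono : MonotoneOn G (Iic (-r)) := by
      refine monotoneOn_of_hasDerivWithinAt_nonneg (convex_Iic _) hGc.continuousOn
        (fun x _ => (hGd x).hasDerivWithinAt) fun x hx => ?_
      rw [interior_Iic, mem_Iio] at hx
      have hx0 : x < 0 := by linarith
      have := hfy x (by rw [abs_of_neg hx0]; linarith)
      rw [div_le_iff_of_neg hx0] at this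
      linarith
    exact (hmono h (mem_Iic.2 le_rfl) h).trans (hin _ (by rw [abs_neg, abs_of_pos (by linarith)]))
  · have hanti : AntitoneOn G (Ici r) := by
      refine antitoneOn_of_hasDerivWithinAt_nonpos (convex_Ici _) hGc.continuousOn
        (fun x _ => (hGd x).hasDerivWithinAt) fun x hx => ?_
      rw [interior_Ici, mem_Ioi] at hx
      have hx0 : 0 < x := by linarith
      have := hfy x (by rw [abs_of_pos hx0]; linarith)
      rw [div_le_iff₀ hx0] at this
      linarith
    exact (hanti (mem_Ici.2 le_rfl) h h).trans (hin _ (by rw [abs_of_pos (by linarith)]))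

variable {G : Type*} [NormedAddCommGroup G] [NormedSpace ℝ G]

/-- The boundedness of an embedding `G → L²(μ)` as a map into `L^p(μ)`, `p = 2σ + 2`. -/
def IsBoundedInto (σ : ℝ) (J : G →L[ℝ] Lp ℝ 2 μ) : Prop :=
  ∃ C : ℝ≥0, ∀ u, eLpNorm (J u) (ENNReal.ofReal (2 * σ + 2)) μ ≤ C * ‖u‖ₑ

variable {J : G →L[ℝ] Lp ℝ 2 μ}

theorem IsBoundedInto.memLp (hJ : IsBoundedInto σ J) (u : G) :
    MemLp (J u) (ENNReal.ofReal (2 * σ + 2)) μ := by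
  obtain ⟨C, hC⟩ := hJ
  exact ⟨(Lp.memLp (J u)).1, (hC u).trans_lt (ENNReal.mul_lt_top ENNReal.coe_lt_top
    enorm_lt_top)⟩

variable [IsFiniteMeasure μ]

theorem memLp_growthIncrement (hσ : 0 < σ) {a b : α → ℝ}
    (ha : MemLp a (ENNReal.ofReal (2 * σ + 2)) μ) (hb : MemLp b (ENNReal.ofReal (2 * σ + 2)) μ) :
    MemLp (fun x => growthIncrement σ (a x) (b x)) 2 μ := by
  have hpow : ∀ {d : α → ℝ}, AEStronglyMeasurable d μ →
      AEStronglyMeasurable (fun x => |d x| ^ σ) μ := fun hd =>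
    (Real.continuous_rpow_const hσ.le).comp_aestronglyMeasurable hd.norm
  refine ⟨((ha.1.sub hb.1).norm).mul ((aestronglyMeasurable_const.add (hpow ha.1)).add
    (hpow hb.1)), (eLpNorm_growthIncrement_le hσ ha.1 hb.1).trans_lt ?_⟩
  refine ENNReal.mul_lt_top (ha.sub hb).2 (ENNReal.add_lt_top.2 ⟨ENNReal.add_lt_top.2
    ⟨(memLp_const 3).2, ?_⟩, ?_⟩)
  · exact ENNReal.rpow_lt_top_of_nonneg hσ.le ha.2.ne
  · exact ENNReal.rpow_lt_top_of_nonneg hσ.le hb.2.ne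

theorem memLp_nemytskii (hσ : 0 < σ) (hf : ∀ a b, |f a - f b| ≤ c * growthIncrement σ a b)
    {a : α → ℝ} (ha : MemLp a (ENNReal.ofReal (2 * σ + 2)) μ) :
    MemLp (fun x => f (a x)) 2 μ := by
  have h0 : MemLp (fun _ : α => (0 : ℝ)) (ENNReal.ofReal (2 * σ + 2)) μ := MemLp.zero'
  have h1 : MemLp (fun x => f (a x) - f 0) 2 μ := by
    refine ((memLp_growthIncrement hσ ha h0).const_mul c).mono
      (((continuous_of_growth hσ hf).comp_aestronglyMeasurable ha.1).sub
        aestronglyMeasurable_const) (.of_forall fun x => ?_)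
    exact (hf (a x) 0).trans (le_abs_self _)
  exact (memLp_congr_ae (.of_forall fun x => by simp)).1 (h1.add (memLp_const (f 0)))

theorem IsBoundedInto.exists_growthIncrement_le (hσ : 0 < σ) (hJ : IsBoundedInto σ J) (M : ℝ) :
    ∃ K : ℝ≥0, ∀ u ∈ Metric.closedBall (0 : G) M, ∀ v ∈ Metric.closedBall (0 : G) M,
      (eLpNorm (fun x => growthIncrement σ (J u x) (J v x)) 2 μ).toReal ≤ K * ‖u - v‖ := by
  obtain ⟨C, hC⟩ := hJ
  set D : ℝ≥0∞ := eLpNorm (fun _ : α => (3 : ℝ)) (ENNReal.ofReal ((2 * σ + 2) / σ)) μ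
    + (C * ENNReal.ofReal M) ^ σ + (C * ENNReal.ofReal M) ^ σ with hD
  have hDtop : D ≠ ∞ := by
    have h : (C * ENNReal.ofReal M) ^ σ ≠ ∞ := ENNReal.rpow_ne_top_of_nonneg hσ.le
      (ENNReal.mul_ne_top ENNReal.coe_ne_top ENNReal.ofReal_ne_top)
    exact ENNReal.add_ne_top.2 ⟨ENNReal.add_ne_top.2 ⟨(memLp_const 3).2.ne, h⟩, h⟩
  refine ⟨C * D.toNNReal, fun u hu v hv => ?_⟩
  have hb : ∀ w ∈ Metric.closedBall (0 : G) M,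
      eLpNorm (J w) (ENNReal.ofReal (2 * σ + 2)) μ ^ σ ≤ (C * ENNReal.ofReal M) ^ σ := by
    intro w hw
    refine ENNReal.rpow_le_rpow ((hC w).trans (mul_le_mul_right ?_ _)) hσ.le
    rw [← ofReal_norm]
    exact ENNReal.ofReal_le_ofReal (by simpa using hw)
  have hsub : eLpNorm (fun x => J u x - J v x) (ENNReal.ofReal (2 * σ + 2)) μ ≤ C * ‖u - v‖ₑ := by
    refine le_trans (le_of_eq (eLpNorm_congr_ae ?_)) (hC (u - v))
    rw [map_sub]
    exact (Lp.coeFn_sub _ _).symm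
  have h := (eLpNorm_growthIncrement_le hσ (Lp.memLp (J u)).1 (Lp.memLp (J v)).1).trans
    (mul_le_mul' hsub (add_le_add (add_le_add_right (hb u hu) _) (hb v hv)))
  have h2 := ENNReal.toReal_mono (ENNReal.mul_ne_top (ENNReal.mul_ne_top ENNReal.coe_ne_top
    enorm_ne_top) hDtop) h
  refine h2.trans (le_of_eq ?_)
  rw [ENNReal.toReal_mul, ENNReal.toReal_mul, toReal_enorm, NNReal.coe_mul,
    ENNReal.coe_toReal]
  change _ = C * D.toReal * _
  ring

variable (J) in
/-- The superposition operator `u ↦ f(u)`; it is `0` where `f(u)` is not square integrable. -/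
def nemytskii (f : ℝ → ℝ) (u : G) : Lp ℝ 2 μ :=
  open Classical in
  if h : MemLp (fun x => f (J u x)) 2 μ then h.toLp _ else 0

theorem coeFn_nemytskii (hσ : 0 < σ) (hJ : IsBoundedInto σ J)
    (hf : ∀ a b, |f a - f b| ≤ c * growthIncrement σ a b) (u : G) :
    nemytskii J f u =ᵐ[μ] fun x => f (J u x) := by
  rw [nemytskii, dif_pos (memLp_nemytskii hσ hf (hJ.memLp u))]
  exact MemLp.coeFn_toLp _

theorem exists_lipschitzOnWith_nemytskii (hσ : 0 < σ) (hc : 0 ≤ c) (hJ : IsBoundedInto σ J)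
    (hf : ∀ a b, |f a - f b| ≤ c * growthIncrement σ a b) (M : ℝ) :
    ∃ K : ℝ≥0, LipschitzOnWith K (nemytskii J f) (Metric.closedBall 0 M) := by
  obtain ⟨K, hK⟩ := hJ.exists_growthIncrement_le hσ M
  refine ⟨c.toNNReal * K, LipschitzOnWith.of_dist_le_mul fun u hu v hv => ?_⟩
  have hmem := memLp_growthIncrement hσ (hJ.memLp u) (hJ.memLp v)
  have h1 : ‖nemytskii J f u - nemytskii J f v‖ ≤ c * ‖hmem.toLp _‖ := by
    refine Lp.norm_le_mul_norm_of_ae_le_mul ?_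
    filter_upwards [Lp.coeFn_sub (nemytskii J f u) (nemytskii J f v), coeFn_nemytskii hσ hJ hf u,
      coeFn_nemytskii hσ hJ hf v, hmem.coeFn_toLp] with x h1 h2 h3 h4
    rw [h1, Pi.sub_apply, h2, h3, h4, Real.norm_of_nonneg (growthIncrement_nonneg _ _ _)]
    exact hf _ _
  rw [Lp.norm_toLp] at h1
  rw [dist_eq_norm, dist_eq_norm, NNReal.coe_mul, mul_assoc, Real.coe_toNNReal c hc]
  exact h1.trans (mul_le_mul_of_nonneg_left (hK u hu v hv) hc)

variable (J) in
/-- The potential energy `∫ F(u)`, where `F` is the primitive of `f`. -/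
def potentialEnergy (f : ℝ → ℝ) (u : G) : ℝ := ∫ x, primitive f (J u x) ∂μ

theorem integrable_primitive (hσ : 0 < σ) (hc : 0 ≤ c) (hJ : IsBoundedInto σ J)
    (hf : ∀ a b, |f a - f b| ≤ c * growthIncrement σ a b) (u : G) :
    Integrable (fun x => primitive f (J u x)) μ := by
  have h0 : MemLp (fun _ : α => (0 : ℝ)) (ENNReal.ofReal (2 * σ + 2)) μ := MemLp.zero'
  have hJu := Lp.memLp (J u)
  have hfc := continuous_of_growth hσ hf
  have hFc : Continuous (primitive f) :=
    continuous_iff_continuousAt.2 fun a => (hasDerivAt_primitive hfc a).continuousAt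
  have h1 : Integrable (fun x => |f 0| * ‖J u x‖ + 2 * c *
      (‖J u x‖ * ‖growthIncrement σ (J u x) 0‖)) μ :=
    ((hJu.integrable one_le_two).norm.const_mul _).add
      ((hJu.integrable_norm_mul_norm (memLp_growthIncrement hσ (hJ.memLp u) h0)).const_mul _)
  refine h1.mono' (hFc.comp_aestronglyMeasurable hJu.1) (.of_forall fun x => ?_)
  have h2 := abs_primitive_sub_le hσ hc hf 0 (J u x)
  rw [primitive, primitive, intervalIntegral.integral_same, sub_zero, sub_zero] at h2
  rw [primitive, Real.norm_of_nonneg (growthIncrement_nonneg _ _ _)]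
  calc ‖∫ τ in (0 : ℝ)..J u x, f τ‖
      = |(∫ τ in (0 : ℝ)..J u x, f τ) - f 0 * J u x + f 0 * J u x| := by
        rw [sub_add_cancel, Real.norm_eq_abs]
    _ ≤ _ := (abs_add_le _ _).trans (by rw [abs_mul, Real.norm_eq_abs]; linarith)

/-- The pointwise Taylor remainder is a product of `|J (v - u)|` and a growth increment.
Cauchy–Schwarz separates them, and on bounded sets the second factor has `L²` norm at most a
multiple of `‖v - u‖`. -/
theorem isPotential_potentialEnergy {G : Type*} [NormedAddCommGroup G] [InnerProductSpace ℝ G]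
    {J : G →L[ℝ] Lp ℝ 2 μ} (hσ : 0 < σ) (hc : 0 ≤ c) (hJ : IsBoundedInto σ J)
    (hf : ∀ a b, |f a - f b| ≤ c * growthIncrement σ a b) :
    IsPotential J (nemytskii J f) (potentialEnergy J f) := by
  intro M
  obtain ⟨K, hK⟩ := hJ.exists_growthIncrement_le hσ M
  refine ⟨2 * c.toNNReal * K, fun u hu v hv => ?_⟩
  have hmem := memLp_growthIncrement hσ (hJ.memLp v) (hJ.memLp u)
  have hd := Lp.memLp (J (v - u))
  have hi1 := integrable_primitive hσ hc hJ hf v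
  have hi2 := integrable_primitive hσ hc hJ hf u
  have hi3 : Integrable (fun x => inner ℝ (nemytskii J f u x) (J (v - u) x)) μ :=
    MeasureTheory.L2.integrable_inner _ _
  have h1 : potentialEnergy J f v - potentialEnergy J f u - inner ℝ (nemytskii J f u) (J (v - u))
      = ∫ x, (primitive f (J v x) - primitive f (J u x)
        - inner ℝ (nemytskii J f u x) (J (v - u) x)) ∂μ := by
    rw [MeasureTheory.L2.inner_def]
    refine (congrArg (· - _) (integral_sub hi1 hi2).symm).trans ?_
    exact (integral_sub (hi1.sub hi2) hi3).symm
  rw [h1]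
  have h2 : |∫ x, (primitive f (J v x) - primitive f (J u x)
        - inner ℝ (nemytskii J f u x) (J (v - u) x)) ∂μ|
      ≤ ∫ x, 2 * c * (‖J (v - u) x‖ * ‖growthIncrement σ (J v x) (J u x)‖) ∂μ := by
    rw [← Real.norm_eq_abs]
    refine norm_integral_le_of_norm_le ((hd.integrable_norm_mul_norm hmem).const_mul _) ?_
    have hsub := Lp.coeFn_sub (J v) (J u)
    rw [← map_sub] at hsub
    filter_upwards [hsub, coeFn_nemytskii hσ hJ hf u] with x e1 e2
    rw [e1, e2, Pi.sub_apply, Real.norm_of_nonneg (growthIncrement_nonneg _ _ _)]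
    have := abs_primitive_sub_le hσ hc hf (J u x) (J v x)
    simpa [mul_comm] using this
  refine h2.trans ?_
  rw [integral_const_mul]
  calc _ ≤ 2 * c * (‖J (v - u)‖ * (K * ‖v - u‖)) := by
        refine mul_le_mul_of_nonneg_left ((hd.integral_norm_mul_norm_le hmem).trans ?_)
          (by positivity)
        rw [← Lp.norm_def]
        exact mul_le_mul_of_nonneg_left (hK v hv u hu) (norm_nonneg _)
    _ = _ := by
        rw [NNReal.coe_mul, NNReal.coe_mul, Real.coe_toNNReal c hc, NNReal.coe_ofNat]
        ring

theorem exists_potentialEnergy_le (hσ : 0 < σ) (hc : 0 ≤ c) (hJ : IsBoundedInto σ J)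
    (hf : ∀ a b, |f a - f b| ≤ c * growthIncrement σ a b) {ν C : ℝ}
    (hν : ∀ a, 2 * primitive f a ≤ ν * a ^ 2 + C) (u : G) :
    2 * potentialEnergy J f u ≤ ν * ‖J u‖ ^ 2 + C * μ.real univ := by
  have hsq : ‖J u‖ ^ 2 = ∫ x, (J u x) ^ 2 ∂μ := by
    rw [← real_inner_self_eq_norm_sq, MeasureTheory.L2.inner_def]
    exact integral_congr_ae (.of_forall fun x => by simp [sq])
  have hint : Integrable (fun x => (J u x) ^ 2) μ := (Lp.memLp (J u)).integrable_sq
  rw [hsq, potentialEnergy, ← integral_const_mul, ← integral_const_mul]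
  have h := integral_mono ((integrable_primitive hσ hc hJ hf u).const_mul 2)
    ((hint.const_mul ν).add (integrable_const C)) (fun x => hν (J u x))
  refine h.trans (le_of_eq ?_)
  simp only [Pi.add_apply]
  rw [integral_add (hint.const_mul ν) (integrable_const C), integral_const, smul_eq_mul,
    mul_comm C]

end Nemytskii

/-! ### Sequential compactness, conjugation of processes and elementary inequalities. -/

section Auxiliary

/-- A linear map is compact if it maps bounded sequences to sequences with a convergent
subsequence. -/
theorem isCompactOperator_of_forall_seq {G W : Type*} [NormedAddCommGroup G] [NormedSpace ℝ G]
    [NormedAddCommGroup W] [NormedSpace ℝ W] (J : G →L[ℝ] W)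
    (h : ∀ u : ℕ → G, (∀ n, ‖u n‖ ≤ 1) →
      ∃ (k : ℕ → ℕ) (z : W), StrictMono k ∧ Tendsto (fun n => J (u (k n))) atTop (𝓝 z)) :
    IsCompactOperator J := by
  refine (isCompactOperator_iff_isCompact_closure_image_closedBall (J : G →ₗ[ℝ] W) one_pos).2
    (IsSeqCompact.isCompact fun y hy => ?_)
  have hy' : ∀ n : ℕ, ∃ u : G, ‖u‖ ≤ 1 ∧ dist (y n) (J u) < 1 / ((n : ℝ) + 1) := fun n => by
    obtain ⟨_, ⟨u, hu, rfl⟩, hd⟩ := Metric.mem_closure_iff.1 (hy n) (1 / ((n : ℝ) + 1)) (by positivity)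
    exact ⟨u, by simpa using hu, hd⟩
  choose u hu hd using hy'
  obtain ⟨k, z, hk, hz⟩ := h u hu
  refine ⟨z, isClosed_closure.mem_of_tendsto hz (.of_forall fun n => subset_closure
    ⟨u (k n), by simpa using hu (k n), rfl⟩), k, hk, ?_⟩
  refine hz.congr_dist ?_
  refine squeeze_zero (fun _ => dist_nonneg) (fun n => ?_)
    (tendsto_one_div_add_atTop_nhds_zero_nat.comp hk.tendsto_atTop)
  rw [dist_comm]
  exact (hd (k n)).le

theorem IsProcess.conj {Y Z : Type*} [TopologicalSpace Y] [TopologicalSpace Z] (ψ : Y ≃ₜ Z)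
    {S : ℝ → ℝ → Y → Y} (hS : IsProcess S) : IsProcess fun t s z => ψ (S t s (ψ.symm z)) where
  self t z := by rw [hS.self, ψ.apply_symm_apply]
  comp t τ s h1 h2 z := by rw [ψ.symm_apply_apply, hS.comp t τ s h1 h2]
  continuousOn := ψ.continuous.comp_continuousOn (hS.continuousOn.comp
    (f := fun p : ℝ × ℝ × Z => (p.1, p.2.1, ψ.symm p.2.2)) (by fun_prop) fun _ h => h)

/-- For `ν > 0` the ratio `ν / μ₁` works; for `ν ≤ 0` the choice `0` avoids any sign condition on
`μ₁`. -/
theorem exists_lt_one_of_lt {μ₁ ν : ℝ} (h : ν < μ₁) :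
    ∃ θ : ℝ, 0 ≤ θ ∧ θ < 1 ∧ ∀ a b : ℝ, 0 ≤ a → 0 ≤ b → μ₁ * a ≤ b → ν * a ≤ θ * b := by
  rcases le_or_gt ν 0 with hν | hν
  · refine ⟨0, le_rfl, one_pos, fun a b ha _ _ => ?_⟩
    rw [zero_mul]
    exact mul_nonpos_of_nonpos_of_nonneg hν ha
  · have hμ := hν.trans h
    refine ⟨ν / μ₁, by positivity, (div_lt_one hμ).2 h, fun a b _ _ hab => ?_⟩
    calc ν * a = ν / μ₁ * (μ₁ * a) := by field_simp
      _ ≤ _ := mul_le_mul_of_nonneg_left hab (by positivity)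

theorem exists_mem_timeInterval_gt {s t : ℝ} {T : EReal} (ht : t ∈ timeInterval s T) :
    ∃ c : ℝ, t < c ∧ (c : EReal) < T := by
  obtain ⟨c, h1, h2⟩ := EReal.lt_iff_exists_real_btwn.1 ht.2
  exact ⟨c, EReal.coe_lt_coe_iff.1 h1, h2⟩

end Auxiliary

/-! ### Energy space, first eigenvalue and reduction to the abstract wave equation. -/

namespace XEllipticOperator

variable {N m : ℕ} (L : XEllipticOperator N m) {Ω : Set (Eucl N)} {Q : ℝ}

variable {L} in
theorem SobolevEmbedding.exists_norm_toL2_le (hQ : 2 < Q) (hSob : L.SobolevEmbedding Ω Q) :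
    ∃ C : ℝ≥0, ∀ u : L.H Ω, ‖L.toL2 u‖ ≤ C * ‖L.grad u‖ := by
  have h2 : 2 ≤ 2 * Q / (Q - 2) := by
    rw [le_div_iff₀ (by linarith)]
    linarith
  obtain ⟨C, hC⟩ := hSob.1 2 one_le_two h2
  refine ⟨C, fun u => ?_⟩
  have h := hC u
  rw [ENNReal.ofReal_ofNat, ← Lp.enorm_def] at h
  have := ENNReal.toReal_mono (ENNReal.mul_ne_top ENNReal.coe_ne_top enorm_ne_top) h
  simpa using this

theorem norm_sq_eq (u : L.H Ω) : ‖u‖ ^ 2 = ‖L.toL2 u‖ ^ 2 + ‖L.grad u‖ ^ 2 :=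
  WithLp.prod_norm_sq_eq_of_L2 (u : WithLp 2 (L2 Ω × L2Vec Ω m))

theorem norm_grad_le (u : L.H Ω) : ‖L.grad u‖ ≤ ‖u‖ :=
  le_of_sq_le_sq (by rw [norm_sq_eq]; exact le_add_of_nonneg_left (sq_nonneg _)) (norm_nonneg _)

variable {L} in
theorem SobolevEmbedding.isCompactOperator_toL2L (hQ : 2 < Q) (hSob : L.SobolevEmbedding Ω Q) :
    IsCompactOperator (L.toL2L (Ω := Ω)) := by
  have h2 : 2 < 2 * Q / (Q - 2) := by
    rw [lt_div_iff₀ (by linarith)]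
    linarith
  refine isCompactOperator_of_forall_seq _ fun u hu => ?_
  obtain ⟨k, g, hk, hg, hlim⟩ := hSob.2 2 one_le_two h2 u
    ⟨1, fun n => (L.norm_grad_le (u n)).trans (hu n)⟩
  rw [ENNReal.ofReal_ofNat] at hg hlim
  refine ⟨k, hg.toLp g, hk, ?_⟩
  have h := (Lp.tendsto_Lp_iff_tendsto_eLpNorm'' (fun n => (L.toL2 (u (k n)) : Eucl N → ℝ))
    (fun n => Lp.memLp _) g hg).2 hlim
  simp only [Lp.toLp_coeFn] at h
  exact h

variable {L} in
/-- The space `H` carries a Hilbert space structure whose inner product is the form `a`. -/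
theorem SobolevEmbedding.exists_energy_space (hQ : 2 < Q) (hSob : L.SobolevEmbedding Ω Q) :
    ∃ (E : Type) (_ : NormedAddCommGroup E) (_ : InnerProductSpace ℝ E) (_ : CompleteSpace E)
      (φ : E ≃L[ℝ] L.H Ω), ∀ x y, inner ℝ x y = L.form (φ x) (φ y) := by
  obtain ⟨B, hform, hsymm, C, hC, hcoer⟩ := L.exists_bilin_eq_form (Ω := Ω)
  obtain ⟨D, hD⟩ := hSob.exists_norm_toL2_le hQ
  obtain ⟨E, i1, i2, i3, φ, hφ⟩ := exists_renorming B hsymm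
    ⟨1 / C * (1 / ((D : ℝ) ^ 2 + 1)), by positivity, fun u => by
      refine le_trans ?_ (hcoer u)
      rw [mul_assoc]
      refine mul_le_mul_of_nonneg_left ?_ (by positivity)
      rw [one_div_mul_eq_div, div_le_iff₀ (by positivity), norm_sq_eq]
      have := pow_le_pow_left₀ (norm_nonneg _) (hD u) 2
      linarith [mul_pow (D : ℝ) ‖L.grad u‖ 2]⟩
  exact ⟨E, i1, i2, i3, φ, fun x y => by rw [hφ, hform]⟩

variable {E : Type} [NormedAddCommGroup E] [InnerProductSpace ℝ E]
  {φ : E ≃L[ℝ] L.H Ω}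

variable {L} in
-- The exponent `σ = (q - 2) / 2` is the one with `2σ + 2 = q`, so only continuity of the endpoint
-- embedding is needed.
theorem SobolevEmbedding.isBoundedInto (hQ : 2 < Q) (hSob : L.SobolevEmbedding Ω Q)
    (φ : E ≃L[ℝ] L.H Ω) :
    IsBoundedInto ((2 * Q / (Q - 2) - 2) / 2) (L.toL2L ∘L (φ : E →L[ℝ] L.H Ω)) := by
  have h2 : 2 ≤ 2 * Q / (Q - 2) := by
    rw [le_div_iff₀ (by linarith)]
    linarith
  obtain ⟨C, hC⟩ := hSob.1 _ (one_le_two.trans h2) le_rfl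
  refine ⟨C * ‖(φ : E →L[ℝ] L.H Ω)‖₊, fun u => ?_⟩
  rw [show 2 * ((2 * Q / (Q - 2) - 2) / 2) + 2 = 2 * Q / (Q - 2) by ring]
  refine (hC (φ u)).trans ?_
  rw [ENNReal.coe_mul, mul_assoc]
  refine mul_le_mul_right ?_ _
  rw [enorm_eq_nnnorm, enorm_eq_nnnorm, ← ENNReal.coe_mul, ENNReal.coe_le_coe]
  exact (L.norm_grad_le (φ u)).trans ((φ : E →L[ℝ] L.H Ω).le_opNorm u)

theorem form_self_eq (hφ : ∀ x y, inner ℝ x y = L.form (φ x) (φ y)) (u : L.H Ω) :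
    L.form u u = ‖φ.symm u‖ ^ 2 := by
  rw [← real_inner_self_eq_norm_sq, hφ, φ.apply_symm_apply]

/-- A right singular vector is an eigenfunction with eigenvalue `ω ^ 2`. The infimum is a true lower
bound since all eigenvalues are nonnegative: `a(u, u) ≥ 0`, and an eigenfunction has nonzero `L²`
norm by injectivity. -/
theorem firstEigenvalue_le_sq_of_singular_value (hΩo : IsOpen Ω) (hΩb : Bornology.IsBounded Ω)
    (hφ : ∀ x y, inner ℝ x y = L.form (φ x) (φ y)) {ω : ℝ} (hω : 0 < ω) {x : E} {y : L2 Ω}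
    (hx : x ≠ 0) (hxy : L.toL2 (φ x) = ω⁻¹ • y)
    (h : ∀ z, inner ℝ x z = ω * inner ℝ y (L.toL2 (φ z))) : L.firstEigenvalue Ω ≤ ω ^ 2 := by
  refine csInf_le ⟨0, fun μ hμ => ?_⟩ ⟨φ x, fun h0 => hx (φ.injective (h0.trans (map_zero φ).symm)),
    fun v => ?_⟩
  · obtain ⟨u, hu, huv⟩ := hμ
    have h1 := huv u
    rw [L.form_self_eq hφ, real_inner_self_eq_norm_sq] at h1
    have h2 : 0 < ‖L.toL2 u‖ := norm_pos_iff.2 fun h0 =>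
      hu (L.injective_toL2L hΩo hΩb (h0.trans (map_zero L.toL2L).symm))
    by_contra! hneg
    have := mul_neg_of_neg_of_pos hneg (pow_pos h2 2)
    linarith [sq_nonneg ‖φ.symm u‖]
  · have := h (φ.symm v)
    rw [hφ, φ.apply_symm_apply] at this
    rw [this, hxy, real_inner_smul_left, ← mul_assoc]
    congr 1
    field_simp

/-- The identification of the energy space `E × L²(Ω)` with the phase space. -/
def phaseEquiv (φ : E ≃L[ℝ] L.H Ω) : (E × L2 Ω) ≃L[ℝ] L.V Ω :=
  φ.prodCongr (ContinuousLinearEquiv.refl ℝ (L2 Ω))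

theorem normV_eq (hφ : ∀ x y, inner ℝ x y = L.form (φ x) (φ y)) (w : L.V Ω) :
    L.normV w = √(‖((L.phaseEquiv φ).symm w).1‖ ^ 2 + ‖((L.phaseEquiv φ).symm w).2‖ ^ 2) := by
  rw [normV, L.form_self_eq hφ]
  rfl

/-- Weak solutions of the boundary value problem are solutions of the abstract wave equation. -/
theorem isWeakSolution_iff (hφ : ∀ x y, inner ℝ x y = L.form (φ x) (φ y)) {β f : ℝ → ℝ}
    (hf : ∀ u : E, nemytskii (L.toL2L ∘L (φ : E →L[ℝ] L.H Ω)) f u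
      =ᵐ[volume.restrict Ω] fun x => f (L.toL2 (φ u) x))
    {s : ℝ} {T : EReal} {w₀ : L.V Ω} {w : ℝ → L.V Ω} :
    IsWeakSolution L Ω β f s T w₀ w ↔ w s = w₀ ∧ ∀ c : ℝ, (c : EReal) < T →
      IsWaveSolution (L.toL2L ∘L (φ : E →L[ℝ] L.H Ω)) β
        (nemytskii (L.toL2L ∘L (φ : E →L[ℝ] L.H Ω)) f)
        (fun t => (L.phaseEquiv φ).symm (w t)) s c := by
  set J := L.toL2L ∘L (φ : E →L[ℝ] L.H Ω) with hJ
  have hJw : ∀ t, J ((L.phaseEquiv φ).symm (w t)).1 = L.toL2 (w t).1 := fun t =>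
    congrArg L.toL2 (φ.apply_symm_apply _)
  have heq : ∀ t v, -β t * inner ℝ ((L.phaseEquiv φ).symm (w t)).2 (J v)
        - inner ℝ ((L.phaseEquiv φ).symm (w t)).1 v
        + inner ℝ (nemytskii J f ((L.phaseEquiv φ).symm (w t)).1) (J v)
      = -β t * inner ℝ (w t).2 (L.toL2 (φ v)) - L.form (w t).1 (φ v)
        + ∫ x in Ω, f (L.toL2 (w t).1 x) * L.toL2 (φ v) x := by
    intro t v
    have e1 : inner ℝ ((L.phaseEquiv φ).symm (w t)).1 v = L.form (w t).1 (φ v) := by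
      rw [hφ]
      exact congrArg (L.form · _) (φ.apply_symm_apply _)
    have e2 : inner ℝ (nemytskii J f ((L.phaseEquiv φ).symm (w t)).1) (J v)
        = ∫ x in Ω, f (L.toL2 (w t).1 x) * L.toL2 (φ v) x := by
      rw [MeasureTheory.L2.inner_def]
      refine integral_congr_ae ?_
      filter_upwards [hf ((L.phaseEquiv φ).symm (w t)).1] with x hx
      rw [hx, ← hJw t]
      exact mul_comm _ _
    rw [e1, e2]
    rfl
  constructor
  · refine fun h => ⟨h.initial, fun c hc => ?_⟩
    have hsub : ∀ t, s ≤ t → t ≤ c → t ∈ timeInterval s T := fun t h1 h2 =>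
      ⟨h1, (EReal.coe_le_coe_iff.2 h2).trans_lt hc⟩
    refine ⟨(L.phaseEquiv φ).symm.continuous.comp_continuousOn
      (h.continuousOn.mono fun t ht => hsub t ht.1 ht.2), fun t ht => ?_, fun t ht v => ?_⟩
    · simp_rw [hJw]
      exact h.hasDerivAt t (hsub t ht.1.le ht.2.le) ht.1
    · rw [heq]
      exact h.equation t (hsub t ht.1.le ht.2.le) ht.1 (φ v)
  · rintro ⟨h0, h⟩
    -- Each condition is local in time, and any `t < T` is followed by a real `c < T`, so compact
    -- intervals suffice.
    refine ⟨fun t ht => ?_, h0, fun t ht hst => ?_, fun t ht hst v => ?_⟩ <;>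
      obtain ⟨c, htc, hcT⟩ := exists_mem_timeInterval_gt ht
    · have h1 := (L.phaseEquiv φ).continuous.comp_continuousOn (h c hcT).continuousOn
      simp only [Function.comp_def, ContinuousLinearEquiv.apply_symm_apply] at h1
      refine (h1 t ⟨ht.1, htc.le⟩).mono_of_mem_nhdsWithin ?_
      filter_upwards [self_mem_nhdsWithin, mem_nhdsWithin_of_mem_nhds (Iio_mem_nhds htc)]
        with τ h2 h3
      exact ⟨h2.1, le_of_lt h3⟩
    · have h1 := (h c hcT).hasDerivAt t ⟨hst, htc⟩
      simp_rw [hJw] at h1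
      exact h1
    · have h1 := (h c hcT).equation t ⟨hst, htc⟩ (φ.symm v)
      rw [heq] at h1
      have h2 : J (φ.symm v) = L.toL2 v := congrArg L.toL2 (φ.apply_symm_apply v)
      rw [φ.apply_symm_apply, h2] at h1
      exact h1

end XEllipticOperator

end

/-! ### Assembly of the main theorem. -/

theorem mainTheorem5 {N m : ℕ} (L : XEllipticOperator N m) (Ω : Set (Eucl N))
    (hΩo : IsOpen Ω) (hΩb : Bornology.IsBounded Ω) (hΩne : Ω.Nonempty)
    (Q : ℝ) (hQ : 2 < Q) (hSob : L.SobolevEmbedding Ω Q)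
    (β : ℝ → ℝ) (hβ : Continuous β) (Cβ : ℝ) (hCβ : 1 ≤ Cβ)
    (hβ0 : ∀ t : ℝ, 1 ≤ ∫ τ in t..(t + 1), β τ ∧ ∫ τ in t..(t + 1), β τ ≤ Cβ)
    (hβ1 : Integrable (fun t : ℝ => max (-β t) 0))
    (f : ℝ → ℝ) (c ρ : ℝ) (hc : 0 ≤ c) (hρ : 0 < ρ) (hρQ : ρ ≤ (2 * Q / (Q - 2) - 2) / 2)
    (hf : ∀ u v : ℝ, |f u - f v| ≤ c * |u - v| * (1 + |u| ^ ρ + |v| ^ ρ))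
    (hsign : limsup (fun u : ℝ => ((f u / u : ℝ) : EReal)) (comap (fun u : ℝ => |u|) atTop)
      < (L.firstEigenvalue Ω : EReal)) :
    (∀ R : ℝ, ∃ M : ℝ, ∀ (s : ℝ) (T : EReal) (w₀ : L.V Ω) (w : ℝ → L.V Ω), (s : EReal) < T →
      L.normV w₀ ≤ R → IsWeakSolution L Ω β f s T w₀ w →
      ∀ t ∈ timeInterval s T, L.normV (w t) ≤ M) ∧
    (∀ (s : ℝ) (T : EReal) (w₀ : L.V Ω) (w : ℝ → L.V Ω), (s : EReal) < T →
      IsMaximalWeakSolution L Ω β f s T w₀ w → T = ⊤) ∧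
    (∃ S : ℝ → ℝ → L.V Ω → L.V Ω, IsProcess S ∧ ∀ (s : ℝ) (w₀ : L.V Ω),
      IsWeakSolution L Ω β f s ⊤ w₀ (fun t => S t s w₀) ∧
      ∀ (T : EReal) (w : ℝ → L.V Ω), (s : EReal) < T → IsWeakSolution L Ω β f s T w₀ w →
        ∀ t ∈ timeInterval s T, w t = S t s w₀) := by
  have : IsFiniteMeasure (volume.restrict Ω) := ⟨by
    rw [Measure.restrict_apply_univ]
    exact hΩb.measure_lt_top⟩
  obtain ⟨E, _, _, _, φ, hφ⟩ := hSob.exists_energy_space hQ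
  set J : E →L[ℝ] L2 Ω := L.toL2L ∘L (φ : E →L[ℝ] L.H Ω) with hJdef
  obtain ⟨ι, b, e, ω, hω, hJ, hJ'⟩ := exists_singular_value_decomposition J
    ((hSob.isCompactOperator_toL2L hQ).comp_clm _) ((L.injective_toL2L hΩo hΩb).comp φ.injective)
    ((L.denseRange_toL2L hΩo).comp φ.surjective.denseRange L.toL2L.continuous)
  set σ := (2 * Q / (Q - 2) - 2) / 2 with hσdef
  have hσ : 0 < σ := hρ.trans_le hρQ
  have hbd : IsBoundedInto σ J := hSob.isBoundedInto hQ φ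
  have hfσ : ∀ u v : ℝ, |f u - f v| ≤ c * growthIncrement σ u v := fun u v => by
    refine (hf u v).trans ?_
    rw [mul_assoc]
    exact mul_le_mul_of_nonneg_left (mul_le_mul_of_nonneg_left (one_add_rpow_le hρ hρQ u v)
      (abs_nonneg _)) hc
  have hg := exists_lipschitzOnWith_nemytskii hσ hc hbd hfσ
  have hgc : Continuous (nemytskii J f) := continuous_iff_continuousAt.2 fun u => by
    obtain ⟨K, hK⟩ := hg (‖u‖ + 1)
    exact hK.continuousOn.continuousAt (Metric.closedBall_mem_nhds_of_mem (by simp))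
  have hΨ := isLocallyLipschitzField_waveField ω b e hβ hg
  have hμ : ∀ u, L.firstEigenvalue Ω * ‖J u‖ ^ 2 ≤ ‖u‖ ^ 2 :=
    mul_norm_sq_le_of_le_singular_values hJ' fun k =>
      L.firstEigenvalue_le_sq_of_singular_value hΩo hΩb hφ (hω k) (b.orthonormal.ne_zero k) (hJ k)
        (hJ' k)
  obtain ⟨ν, hν, C, hC⟩ := exists_primitive_le (continuous_of_growth hσ hfσ) hsign
  obtain ⟨θ, hθ0, hθ1, hθ⟩ := exists_lt_one_of_lt hν
  -- The hypothesis on the potential is the chain `2 Φ(u) ≤ ν ‖J u‖² + C' ≤ θ ‖u‖² + C'`, whose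
  -- second inequality uses `μ₁ ‖J u‖² ≤ ‖u‖²`.
  have hb : HasBoundedTrajectories (waveField ω b e β (nemytskii J f)) :=
    hasBoundedTrajectories_waveField hω hJ hJ' hβ hβ1 hgc
      (isPotential_potentialEnergy hσ hc hbd hfσ) hθ0 hθ1 fun u =>
        (exists_potentialEnergy_le hσ hc hbd hfσ hC u).trans
          (add_le_add_left (hθ _ _ (sq_nonneg _) (sq_nonneg _) (hμ u)) _)
  have hweak : ∀ {s : ℝ} {T : EReal} {w₀ : L.V Ω} {w : ℝ → L.V Ω},
      IsWeakSolution L Ω β f s T w₀ w ↔ w s = w₀ ∧ ∀ c : ℝ, (c : EReal) < T →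
        IsWaveSolution J β (nemytskii J f) (fun t => (L.phaseEquiv φ).symm (w t)) s c :=
    L.isWeakSolution_iff hφ fun u => coeFn_nemytskii hσ hbd hfσ u
  have hprocess : ∃ S : ℝ → ℝ → L.V Ω → L.V Ω, IsProcess S ∧ ∀ (s : ℝ) (w₀ : L.V Ω),
      IsWeakSolution L Ω β f s ⊤ w₀ (fun t => S t s w₀) ∧
      ∀ (T : EReal) (w : ℝ → L.V Ω), (s : EReal) < T → IsWeakSolution L Ω β f s T w₀ w →
        ∀ t ∈ timeInterval s T, w t = S t s w₀ := by
    obtain ⟨S, hS, hsol, huniq⟩ := hΨ.exists_wave_process hω hJ hJ' hβ hgc hb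
    have hS' := hS.conj (L.phaseEquiv φ).toHomeomorph
    refine ⟨_, hS', fun s w₀ => ⟨hweak.2 ⟨hS'.self s w₀, fun c _ => ?_⟩, fun T w _ hw t ht => ?_⟩⟩
    · refine (congrArg (IsWaveSolution J β (nemytskii J f) · s c) (funext fun t => ?_)).mp
        (hsol s c ((L.phaseEquiv φ).symm w₀))
      exact ((L.phaseEquiv φ).symm_apply_apply _).symm
    · obtain ⟨c, htc, hcT⟩ := exists_mem_timeInterval_gt ht
      have h := huniq s c _ ((hweak.1 hw).2 c hcT) t ⟨ht.1, htc.le⟩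
      rw [hw.initial] at h
      exact (L.phaseEquiv φ).symm_apply_eq.1 h
  refine ⟨fun R => ?_, fun s T w₀ w hs hw => ?_, hprocess⟩
  · obtain ⟨M, hM⟩ := hb.bounded_waves hω hJ hJ' hΨ R
    refine ⟨M, fun s T w₀ w _ hR hw t ht => ?_⟩
    obtain ⟨c, htc, hcT⟩ := exists_mem_timeInterval_gt ht
    rw [L.normV_eq hφ]
    rw [L.normV_eq hφ, ← hw.initial] at hR
    exact hM s c _ ((hweak.1 hw).2 c hcT) hR t ⟨ht.1, htc.le⟩
  · obtain ⟨S, -, hS⟩ := hprocess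
    -- The process supplies a solution on `[s, ∞)` extending `w`, so maximality forces `⊤ ≤ T`.
    exact top_le_iff.1 (hw.2 ⊤ _ (hS s w₀).1 fun t ht => (hS s w₀).2 T w hs hw.1 t ht)
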